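/- **The quantum group.** Let $h,g\in\mathbb C$. Let $A=GL_{h,g}(2)$ be the Hopf algebra over $\mathbb C$ generated by $a,b,c,d$ and $D^{-1}$ with the relations $$ca=ac-gc^2,\quad cd=dc-hc^2,\quad db=bd+g(D-d^2),\quad ab=ba+h(D-a^2),$$ $$cb=bc-hac-gdc+ghc^2,\quad da=ad+hac-gdc,\quad DD^{-1}=D^{-1}D=1,\qquad D=ad-bc+hac .$$ With $T=\begin{pmatrix}a&b\\c&d\end{pmatrix}$, the structure maps are $\Delta T_{ij}=\sum_k T_{ik}\otimes T_{kj}$, $\varepsilon(T_{ij})=\delta_{ij}$ and $$S(a)=D^{-1}(d+gc),\quad S(b)=D^{-1}(gd-ga-b+g^2c),\quad S(c)=-D^{-1}c,\quad S(d)=D^{-1}(a-gc).$$ **The first order calculi.** Write $\Theta=\begin{pmatrix}\theta_1&\theta_2\\ \theta_3&\theta_4\end{pmatrix}=(\theta_{st})$. Consider the bicovariant first order differential calculi $(\Gamma,d)$ over $A$ such that $\Gamma$ is free as a left $A$-module on the left-invariant forms $\theta_1,\dots,\theta_4$, with $$dT=T\Theta,\qquad \Delta_R(\theta_{ik})=\sum_{s,t}\theta_{st}\otimes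 S(T_{is})\,T_{tk},$$ $$\theta_i a=\sum_j(aA_{ij}+bC_{ij})\theta_j,\quad \theta_i b=\sum_j(aB_{ij}+bD_{ij})\theta_j,\quad \theta_i c=\sum_j(cA_{ij}+dC_{ij})\theta_j,\quad \theta_i d=\sum_j(cB_{ij}+dD_{ij})\theta_j,$$ where the complex $4\times4$ matrices $A,B,C,D$ (the last not to be confused with the determinant) belong to one of three families with a parameter $z\in\mathbb C$. Put $s=h+g$. *Family $\Gamma_1$, $z\neq-1$:* $$A=\begin{pmatrix}\frac{3z+2}2&0&\frac{-(3h+g)z-2h}2&-\frac z2\\ h(z+1)&z+1&-h^2(z+1)&-h(z+1)\\0&0&z+1&0\\ \frac z2&0&\frac{(h-g)z+2h}2&\frac{z+2}2\end{pmatrix},\quad B=\begin{pmatrix}0&z&hs(z+1)&0\\0&s(z+1)&-hgs(z+1)&0\\0&0&-s(z+1)&0\\0&z&gs(z+1)&0\end{pmatrix},$$ $$C=\begin{pmatrix}0&0&z&0\\0&0&0&0\\0&0&0&0\\0&0&z&0\end{pmatrix},\quad D=\begin{pmatrix}\frac{z+2}2&0&\frac{-(h-g)z+2g}2&\frac z2\\-g(z+1)&z+1&-g^2(z+1)&g(z+1)\\0&0&z+1&0\\-\frac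 z2&0&\frac{-(h+3g)z-2g}2&\frac{3z+2}2\end{pmatrix}.$$ *Family $\Gamma_2$, $z$ arbitrary:* $$A=\begin{pmatrix}\frac{z+2}2&0&\frac{sz-2h}2&\frac z2\\h(z+1)&1&h(sz-h)&h(z-1)\\0&0&1&0\\-\frac z2&0&\frac{-sz+2h}2&\frac{2-z}2\end{pmatrix},\quad B=\begin{pmatrix}-hz&0&hs(1-z)&-hz\\hgz&s&hgs(z-1)&hgz\\z&0&s(z-1)&z\\-gz&0&gs(1-z)&-gz\end{pmatrix},$$ $$C=\begin{pmatrix}0&0&0&0\\z&0&sz&z\\0&0&0&0\\0&0&0&0\end{pmatrix},\quad D=\begin{pmatrix}\frac{2-z}2&0&\frac{-sz+2g}2&-\frac z2\\g(z-1)&1&g(sz-g)&g(z+1)\\0&0&1&0\\\frac z2&0&\frac{sz-2g}2&\frac{z+2}2\end{pmatrix}.$$ *Family $\Gamma_3$, $z\neq-1$:* $$A=\begin{pmatrix}\frac{z+2}2&0&\frac{sz-2h}2&\frac z2\\h&1&-h^2&-h\\0&0&1&0\\\frac z2&0&\frac{sz+2h}2&\frac{z+2}2\end{pmatrix},\quad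 B=\begin{pmatrix}0&0&hs&0\\0&s&-hgs&0\\0&0&-s&0\\0&0&gs&0\end{pmatrix},$$ $$C=0,\quad D=\begin{pmatrix}\frac{z+2}2&0&\frac{sz+2g}2&\frac z2\\-g&1&-g^2&g\\0&0&1&0\\\frac z2&0&\frac{sz-2g}2&\frac{z+2}2\end{pmatrix}.$$ **Woronowicz's external algebra.** Let $\Lambda$ be the bimodule automorphism of $\Gamma\otimes_A\Gamma$ with $\Lambda(\theta\otimes\eta)=\eta\otimes\theta$ for $\theta$ left-invariant and $\eta$ right-invariant. Let $W_n=\sum_{\pi\in S_n}\operatorname{sgn}(\pi)\Lambda_\pi$ on $\Gamma^{\otimes n}$, where $\Lambda_\pi$ is obtained from a reduced word of $\pi$. Let $\Gamma^{\otimes}$ be the tensor algebra of $\Gamma$ over $A$, and let $\Omega$ be its quotient by the two-sided ideal generated by $\ker W_n$, $n\ge2$, with product $\wedge$. Let $\Omega_1,\Omega_2,\Omega_3$ be the algebras so obtained from $\Gamma_1,\Gamma_2,\Gamma_3$. **Theorem.** In $\Omega_1$ (for each $z\ne-1$) the left-invariant forms satisfy $$\begin{aligned} \theta_3\wedge\theta_3&=0,\\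 \theta_3\wedge\theta_4&=-\tfrac{2z+1}{z+1}\theta_4\wedge\theta_3+\tfrac z{z+1}\theta_1\wedge\theta_3,\\ \theta_3\wedge\theta_1&=-\tfrac1{z+1}\theta_1\wedge\theta_3-\tfrac z{z+1}\theta_4\wedge\theta_3,\\ \theta_3\wedge\theta_2&=-\theta_2\wedge\theta_3+s\,\theta_1\wedge\theta_3-s\,\theta_4\wedge\theta_3,\\ \theta_4\wedge\theta_4&=\tfrac z{z+1}\theta_2\wedge\theta_3-\tfrac{zs}{z+1}\theta_1\wedge\theta_3+\tfrac{zs}{z+1}\theta_4\wedge\theta_3,\\ \theta_4\wedge\theta_1&=-\theta_1\wedge\theta_4-\tfrac{zs}{z+1}\theta_1\wedge\theta_3+\tfrac{zs}{z+1}\theta_4\wedge\theta_3,\\ \theta_4\wedge\theta_2&=-\tfrac{2z+1}{z+1}\theta_2\wedge\theta_4+\tfrac z{z+1}\theta_2\wedge\theta_1+\tfrac{(2z+1)s}{z+1}\theta_2\wedge\theta_3-s^2\theta_1\wedge\theta_3+s^2\theta_4\wedge\theta_3,\\ \theta_1\wedge\theta_1&=-\tfrac z{z+1}\theta_2\wedge\theta_3,\\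 \theta_1\wedge\theta_2&=-\tfrac1{z+1}\theta_2\wedge\theta_1-\tfrac z{z+1}\theta_2\wedge\theta_4-\tfrac s{z+1}\theta_2\wedge\theta_3,\\ \theta_2\wedge\theta_2&=s\,\theta_2\wedge\theta_1-s\,\theta_2\wedge\theta_4+s^2\theta_2\wedge\theta_3. \end{aligned}$$ In $\Omega_2$ (for each $z$) and in $\Omega_3$ (for each $z\neq-1$) they satisfy $$\begin{aligned} \theta_3\wedge\theta_3&=0,\qquad \theta_3\wedge\theta_4=-\theta_4\wedge\theta_3,\qquad \theta_3\wedge\theta_1=-\theta_1\wedge\theta_3,\\ \theta_3\wedge\theta_2&=-\theta_2\wedge\theta_3+s\,\theta_1\wedge\theta_3-s\,\theta_4\wedge\theta_3,\\ \theta_4\wedge\theta_4&=0,\qquad \theta_4\wedge\theta_1=-\theta_1\wedge\theta_4,\\ \theta_4\wedge\theta_2&=-\theta_2\wedge\theta_4+s\,\theta_2\wedge\theta_3-s^2\theta_1\wedge\theta_3+s^2\theta_4\wedge\theta_3,\\ \theta_1\wedge\theta_1&=0,\qquad \theta_1\wedge\theta_2=-\theta_2\wedge\theta_1-s\,\theta_2\wedge\theta_3,\\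 \theta_2\wedge\theta_2&=s\,\theta_2\wedge\theta_1-s\,\theta_2\wedge\theta_4+s^2\theta_2\wedge\theta_3. \end{aligned}$$ Moreover, in each of the three cases, let $R_1,\dots,R_{10}\in\Gamma\otimes_A\Gamma$ be the differences (left side minus right side, with $\otimes_A$ in place of $\wedge$) of these ten relations. Then: 1. The relations generate all relations: the kernel of $\Gamma^{\otimes}\to\Omega$ is the two-sided ideal generated by $R_1,\dots,R_{10}$. 2. They are consistent with the bimodule relations: $R_kx\in\sum_lA R_l$ for all $k$ and all $x\in A$. 3. They are consistent with $\operatorname{Tr}_h\Theta\wedge\operatorname{Tr}_h\Theta=0$ for the bi-invariant form $\operatorname{Tr}_h\Theta=\theta_1+s\,\theta_3+\theta_4$: the element $\operatorname{Tr}_h\Theta\otimes\operatorname{Tr}_h\Theta$ is a $\mathbb C$-linear combination of the $R_l$. 4. The $16$ ordered monomials $\theta_2^\alpha\theta_1^\beta\theta_4^\gamma\theta_3^\delta$ (wedge products), $\alpha,\beta,\gamma,\delta\in\{0,1\}$, are a basis of $\Omega$ as a left $A$-module. They also span, over $\mathbb C$, the subalgebra generated by $\theta_1,\dots,\theta_4$.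 Those with $\alpha+\beta+\gamma+\delta=n$ are a basis of the left $A$-module $\Omega^n$ of $n$-forms, which therefore has the classical rank $\binom4n$. Finally, the relations of $\Omega_1$ are consistent with $$\operatorname{Tr}_h\Theta\wedge\theta_i+\theta_i\wedge\operatorname{Tr}_h\Theta=-2z\,(\Theta\wedge\Theta)_i\;(=2z\,d\theta_i),\qquad i=1,\dots,4,$$ where $(\Theta\wedge\Theta)_1,\dots,(\Theta\wedge\Theta)_4$ are the entries $(1,1),(1,2),(2,1),(2,2)$ of $\Theta\wedge\Theta$: the corresponding elements of $\Gamma\otimes_A\Gamma$ (left side minus right side) are $\mathbb C$-linear combinations of $R_1,\dots,R_{10}$. -/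

import Mathlib

open scoped TensorProduct

set_option linter.unusedSimpArgs false
set_option linter.unusedSectionVars false
set_option linter.unreachableTactic false
set_option linter.unusedTactic false

noncomputable section

namespace Jordanian

/-- The generators `a, b, c, d` and the inverse of the quantum determinant. -/
inductive Gen
  | a | b | c | d | detInv

/-- `a, b, c, d, e` satisfy the defining relations of `GL_{h,g}(2)`, where `e` is the inverse of
the quantum determinant `a d - b c + h a c`. -/
structure IsGLPoint {R : Type*} [Ring R] [Algebra ℂ R] (h g : ℂ) (a b c d e : R) : Prop where
  ca : c * a = a * c - g • (c * c)
  cd : c * d = d * c - h • (c * c)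
  db : d * b = b * d + g • (a * d - b * c + h • (a * c) - d * d)
  ab : a * b = b * a + h • (a * d - b * c + h • (a * c) - a * a)
  cb : c * b = b * c - h • (a * c) - g • (d * c) + (g * h) • (c * c)
  da : d * a = a * d + h • (a * c) - g • (d * c)
  det_e : (a * d - b * c + h • (a * c)) * e = 1
  e_det : e * (a * d - b * c + h • (a * c)) = 1

theorem IsGLPoint.comm_detInv {R : Type*} [Ring R] [Algebra ℂ R] {h g : ℂ} {a b c d e : R}
    (H : IsGLPoint h g a b c d e) :
    (a * d - b * c + h • (a * c)) * e = 1 ∧ a * e = e * a + (h - g) • (e * c) ∧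
    b * e = e * b + (h - g) • (e * d - e * a - (h - g) • (e * c)) ∧ c * e = e * c ∧
    d * e = e * d - (h - g) • (e * c) := by
  obtain ⟨ca, cd, db, ab, cb, da, hD, hD'⟩ := H
  have r : ∀ {x y w : R}, x * y = w → ∀ z, x * (y * z) = w * z := by
    rintro x y w rfl z; rw [mul_assoc]
  set D := a * d - b * c + h • (a * c) with hDdef
  have move : ∀ x y : R, D * y = x * D → y * e = e * x := by
    intro x y hxy
    calc y * e = e * (D * y) * e := by rw [← mul_assoc e D y, hD', one_mul]
      _ = e * x * (D * e) := by rw [hxy]; simp only [mul_assoc]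
      _ = e * x := by rw [hD, mul_one]
  refine ⟨hD, ?_, ?_, ?_, ?_⟩
  · rw [move (a + (h - g) • c) a]
    · simp only [mul_add, mul_smul_comm]
    · simp only [hDdef, mul_add, mul_sub, add_mul, sub_mul,
        smul_mul_assoc, mul_smul_comm, smul_add, smul_sub, mul_assoc,
        ca, cd, db, ab, cb, da, r ca, r cd, r db, r ab, r cb, r da]
      module
  · rw [move (b + (h - g) • (d - a - (h - g) • c)) b]
    · simp only [mul_add, mul_sub, mul_smul_comm]
    · simp only [hDdef, mul_add, mul_sub, add_mul, sub_mul,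
        smul_mul_assoc, mul_smul_comm, smul_add, smul_sub, mul_assoc,
        ca, cd, db, ab, cb, da, r ca, r cd, r db, r ab, r cb, r da]
      module
  · rw [move c c]
    · simp only [hDdef, mul_add, mul_sub, add_mul, sub_mul,
        smul_mul_assoc, mul_smul_comm, smul_add, smul_sub, mul_assoc,
        ca, cd, db, ab, cb, da, r ca, r cd, r db, r ab, r cb, r da]
      module
  · rw [move (d - (h - g) • c) d]
    · simp only [mul_sub, mul_smul_comm]
    · simp only [hDdef, mul_add, mul_sub, add_mul, sub_mul,
        smul_mul_assoc, mul_smul_comm, smul_add, smul_sub, mul_assoc,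
        ca, cd, db, ab, cb, da, r ca, r cd, r db, r ab, r cb, r da]
      module

open FreeAlgebra Gen in
/-- The defining relations of `GL_{h,g}(2)`. -/
inductive GLRel (h g : ℂ) : FreeAlgebra ℂ Gen → FreeAlgebra ℂ Gen → Prop
  | ca : GLRel h g (ι ℂ c * ι ℂ a) (ι ℂ a * ι ℂ c - g • (ι ℂ c * ι ℂ c))
  | cd : GLRel h g (ι ℂ c * ι ℂ d) (ι ℂ d * ι ℂ c - h • (ι ℂ c * ι ℂ c))
  | db : GLRel h g (ι ℂ d * ι ℂ b) (ι ℂ b * ι ℂ d +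
      g • (ι ℂ a * ι ℂ d - ι ℂ b * ι ℂ c + h • (ι ℂ a * ι ℂ c) - ι ℂ d * ι ℂ d))
  | ab : GLRel h g (ι ℂ a * ι ℂ b) (ι ℂ b * ι ℂ a +
      h • (ι ℂ a * ι ℂ d - ι ℂ b * ι ℂ c + h • (ι ℂ a * ι ℂ c) - ι ℂ a * ι ℂ a))
  | cb : GLRel h g (ι ℂ c * ι ℂ b) (ι ℂ b * ι ℂ c - h • (ι ℂ a * ι ℂ c) - g • (ι ℂ d * ι ℂ c) +
      (g * h) • (ι ℂ c * ι ℂ c))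
  | da : GLRel h g (ι ℂ d * ι ℂ a) (ι ℂ a * ι ℂ d + h • (ι ℂ a * ι ℂ c) - g • (ι ℂ d * ι ℂ c))
  | det_e : GLRel h g
      ((ι ℂ a * ι ℂ d - ι ℂ b * ι ℂ c + h • (ι ℂ a * ι ℂ c)) * ι ℂ detInv) 1
  | e_det : GLRel h g
      (ι ℂ detInv * (ι ℂ a * ι ℂ d - ι ℂ b * ι ℂ c + h • (ι ℂ a * ι ℂ c))) 1

/-- The algebra `GL_{h,g}(2)`. -/
def GLhg (h g : ℂ) : Type := RingQuot (GLRel h g)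

instance (h g : ℂ) : Ring (GLhg h g) := inferInstanceAs (Ring (RingQuot (GLRel h g)))
instance (h g : ℂ) : Algebra ℂ (GLhg h g) := inferInstanceAs (Algebra ℂ (RingQuot (GLRel h g)))

namespace GLhg
variable {h g : ℂ}

/-- The image of a generator in `GL_{h,g}(2)`. -/
def gen (h g : ℂ) (x : Gen) : GLhg h g := RingQuot.mkAlgHom ℂ (GLRel h g) (FreeAlgebra.ι ℂ x)

theorem isGLPoint_gen : IsGLPoint h g (gen h g .a) (gen h g .b) (gen h g .c) (gen h g .d)
    (gen h g .detInv) where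
  ca := by simpa using! RingQuot.mkAlgHom_rel ℂ (GLRel.ca (h := h) (g := g))
  cd := by simpa using! RingQuot.mkAlgHom_rel ℂ (GLRel.cd (h := h) (g := g))
  db := by simpa using! RingQuot.mkAlgHom_rel ℂ (GLRel.db (h := h) (g := g))
  ab := by simpa using! RingQuot.mkAlgHom_rel ℂ (GLRel.ab (h := h) (g := g))
  cb := by simpa using! RingQuot.mkAlgHom_rel ℂ (GLRel.cb (h := h) (g := g))
  da := by simpa using! RingQuot.mkAlgHom_rel ℂ (GLRel.da (h := h) (g := g))
  det_e := by simpa using! RingQuot.mkAlgHom_rel ℂ (GLRel.det_e (h := h) (g := g))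
  e_det := by simpa using! RingQuot.mkAlgHom_rel ℂ (GLRel.e_det (h := h) (g := g))

variable {R : Type*} [Ring R] [Algebra ℂ R]

/-- Five elements satisfying the defining relations define an algebra map out of `GL_{h,g}(2)`. -/
def lift {a b c d e : R} (H : IsGLPoint h g a b c d e) : GLhg h g →ₐ[ℂ] R :=
  RingQuot.liftAlgHom ℂ ⟨FreeAlgebra.lift ℂ (fun x : Gen => match x with
    | .a => a | .b => b | .c => c | .d => d | .detInv => e), by
      rintro _ _ (_ | _ | _ | _ | _ | _ | _ | _) <;> simp
      exacts [H.ca, H.cd, H.db, H.ab, H.cb, H.da, H.det_e, H.e_det]⟩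

section
variable {a b c d e : R} (H : IsGLPoint h g a b c d e)
@[simp] theorem lift_a : lift H (gen h g .a) = a :=
  (RingQuot.liftAlgHom_mkAlgHom_apply ..).trans (by simp)
@[simp] theorem lift_b : lift H (gen h g .b) = b :=
  (RingQuot.liftAlgHom_mkAlgHom_apply ..).trans (by simp)
@[simp] theorem lift_c : lift H (gen h g .c) = c :=
  (RingQuot.liftAlgHom_mkAlgHom_apply ..).trans (by simp)
@[simp] theorem lift_d : lift H (gen h g .d) = d :=
  (RingQuot.liftAlgHom_mkAlgHom_apply ..).trans (by simp)
@[simp] theorem lift_detInv : lift H (gen h g .detInv) = e :=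
  (RingQuot.liftAlgHom_mkAlgHom_apply ..).trans (by simp)
end

theorem algHom_ext {φ ψ : GLhg h g →ₐ[ℂ] R} (H : ∀ x, φ (gen h g x) = ψ (gen h g x)) : φ = ψ := by
  apply RingQuot.ringQuot_ext'
  ext x
  exact H x

theorem isGLPoint_comul : IsGLPoint h g
    (gen h g .a ⊗ₜ[ℂ] gen h g .a + gen h g .b ⊗ₜ[ℂ] gen h g .c)
    (gen h g .a ⊗ₜ[ℂ] gen h g .b + gen h g .b ⊗ₜ[ℂ] gen h g .d)
    (gen h g .c ⊗ₜ[ℂ] gen h g .a + gen h g .d ⊗ₜ[ℂ] gen h g .c)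
    (gen h g .c ⊗ₜ[ℂ] gen h g .b + gen h g .d ⊗ₜ[ℂ] gen h g .d)
    (gen h g .detInv ⊗ₜ[ℂ] gen h g .detInv) := by
  obtain ⟨ca, cd, db, ab, cb, da, de, ed⟩ := isGLPoint_gen (h := h) (g := g)
  generalize gen h g .a = a at *
  generalize gen h g .b = b at *
  generalize gen h g .c = c at *
  generalize gen h g .d = d at *
  generalize gen h g .detInv = e at *
  have key : (a ⊗ₜ[ℂ] a + b ⊗ₜ[ℂ] c) * (c ⊗ₜ[ℂ] b + d ⊗ₜ[ℂ] d)
      - (a ⊗ₜ[ℂ] b + b ⊗ₜ[ℂ] d) * (c ⊗ₜ[ℂ] a + d ⊗ₜ[ℂ] c)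
      + h • ((a ⊗ₜ[ℂ] a + b ⊗ₜ[ℂ] c) * (c ⊗ₜ[ℂ] a + d ⊗ₜ[ℂ] c))
      = (a * d - b * c + h • (a * c)) ⊗ₜ[ℂ] (a * d - b * c + h • (a * c)) := by
    simp only [add_mul, mul_add, Algebra.TensorProduct.tmul_mul_tmul, ca, cd, db, ab, cb, da,
      TensorProduct.tmul_add, TensorProduct.add_tmul, TensorProduct.tmul_sub,
      TensorProduct.sub_tmul, TensorProduct.tmul_smul, ← TensorProduct.smul_tmul']
    module
  refine ⟨?_, ?_, ?_, ?_, ?_, ?_, ?_, ?_⟩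
  iterate 6
    · simp only [add_mul, mul_add, Algebra.TensorProduct.tmul_mul_tmul, ca, cd, db, ab, cb, da,
        TensorProduct.tmul_add, TensorProduct.add_tmul, TensorProduct.tmul_sub,
        TensorProduct.sub_tmul, TensorProduct.tmul_smul, ← TensorProduct.smul_tmul']
      module
  · rw [key, Algebra.TensorProduct.tmul_mul_tmul, de, Algebra.TensorProduct.one_def]
  · rw [key, Algebra.TensorProduct.tmul_mul_tmul, ed, Algebra.TensorProduct.one_def]

theorem isGLPoint_counit : IsGLPoint h g (1 : ℂ) 0 0 1 1 := by
  constructor <;> simp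

theorem isGLPoint_antipode : IsGLPoint h g
    (MulOpposite.op (gen h g .detInv * (gen h g .d + g • gen h g .c)))
    (MulOpposite.op (gen h g .detInv * (g • gen h g .d - g • gen h g .a - gen h g .b
      + (g ^ 2) • gen h g .c)))
    (MulOpposite.op (-(gen h g .detInv * gen h g .c)))
    (MulOpposite.op (gen h g .detInv * (gen h g .a - g • gen h g .c)))
    (MulOpposite.op (gen h g .a * gen h g .d - gen h g .b * gen h g .c
      + h • (gen h g .a * gen h g .c))) := by
  have H := isGLPoint_gen (h := h) (g := g)
  generalize gen h g .a = a at *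
  generalize gen h g .b = b at *
  generalize gen h g .c = c at *
  generalize gen h g .d = d at *
  generalize gen h g .detInv = e at *
  obtain ⟨hD, ae, be, ce, de⟩ := H.comm_detInv
  obtain ⟨ca, cd, db, ab, cb, da, -, hD'⟩ := H
  have r : ∀ {x y w : GLhg h g}, x * y = w → ∀ z, x * (y * z) = w * z := by
    rintro x y w rfl z; rw [mul_assoc]
  have key : e * (e * (a * d - b * c + h • (a * c))) = e := by rw [hD', mul_one]
  refine ⟨?_, ?_, ?_, ?_, ?_, ?_, ?_, ?_⟩
  iterate 6
    · rw [← MulOpposite.unop_inj]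
      simp only [MulOpposite.unop_op, MulOpposite.unop_mul, MulOpposite.unop_add,
        MulOpposite.unop_sub, MulOpposite.unop_smul, mul_add, mul_sub, add_mul, sub_mul, neg_mul,
        mul_neg, smul_mul_assoc, mul_smul_comm, smul_add, smul_sub, mul_assoc,
        ca, cd, db, ab, cb, da, ae, be, ce, de,
        r ca, r cd, r db, r ab, r cb, r da, r ae, r be, r ce, r de]
      module
  · rw [← MulOpposite.unop_inj, MulOpposite.unop_one, ← hD']
    refine Eq.trans ?_ (congrArg (fun t => (a * d - b * c + h • (a * c)) * t) key |>.trans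
      (by rw [hD, hD']))
    rw [MulOpposite.unop_mul, MulOpposite.unop_op]
    congr 1
    simp only [MulOpposite.unop_op, MulOpposite.unop_mul, MulOpposite.unop_add,
      MulOpposite.unop_sub, MulOpposite.unop_smul, mul_add, mul_sub, add_mul, sub_mul, neg_mul,
      mul_neg, smul_mul_assoc, mul_smul_comm, smul_add, smul_sub, mul_assoc,
      ca, cd, db, ab, cb, da, ae, be, ce, de,
      r ca, r cd, r db, r ab, r cb, r da, r ae, r be, r ce, r de]
    module
  · rw [← MulOpposite.unop_inj, MulOpposite.unop_one, ← hD']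
    refine Eq.trans ?_ (congrArg (fun t => t * (a * d - b * c + h • (a * c))) key |>.trans rfl)
    rw [MulOpposite.unop_mul, MulOpposite.unop_op]
    congr 1
    simp only [MulOpposite.unop_op, MulOpposite.unop_mul, MulOpposite.unop_add,
      MulOpposite.unop_sub, MulOpposite.unop_smul, mul_add, mul_sub, add_mul, sub_mul, neg_mul,
      mul_neg, smul_mul_assoc, mul_smul_comm, smul_add, smul_sub, mul_assoc,
      ca, cd, db, ab, cb, da, ae, be, ce, de,
      r ca, r cd, r db, r ab, r cb, r da, r ae, r be, r ce, r de]
    module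

theorem induction {P : GLhg h g → Prop} (hmap : ∀ r : ℂ, P (algebraMap ℂ _ r))
    (hadd : ∀ x y, P x → P y → P (x + y)) (hmul : ∀ x y, P x → P y → P (x * y))
    (hgen : ∀ t, P (gen h g t)) (x : GLhg h g) : P x := by
  obtain ⟨y, rfl⟩ := RingQuot.mkAlgHom_surjective ℂ (GLRel h g) x
  induction y using FreeAlgebra.induction with
  | grade0 r => rw [AlgHom.commutes]; exact hmap r
  | grade1 t => exact hgen t
  | mul x y hx hy => rw [map_mul]; exact hmul _ _ hx hy
  | add x y hx hy => rw [map_add]; exact hadd _ _ hx hy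

/-- `Δ(T_{ij}) = ∑ T_{ik} ⊗ T_{kj}` and `Δ(D⁻¹) = D⁻¹ ⊗ D⁻¹`. -/
def comulHom (h g : ℂ) : GLhg h g →ₐ[ℂ] GLhg h g ⊗[ℂ] GLhg h g := lift isGLPoint_comul

/-- `ε(T_{ij}) = δ_{ij}` and `ε(D⁻¹) = 1`. -/
def counitHom (h g : ℂ) : GLhg h g →ₐ[ℂ] ℂ := lift isGLPoint_counit

/-- The antipode, as an algebra map into the opposite algebra. -/
def antipodeHom (h g : ℂ) : GLhg h g →ₐ[ℂ] (GLhg h g)ᵐᵒᵖ := lift isGLPoint_antipode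

instance : Bialgebra ℂ (GLhg h g) :=
  Bialgebra.ofAlgHom (comulHom h g) (counitHom h g)
    (by
      apply algHom_ext
      rintro (_ | _ | _ | _ | _) <;>
        simp [comulHom, TensorProduct.add_tmul, TensorProduct.tmul_add] <;> abel)
    (by apply algHom_ext; rintro (_ | _ | _ | _ | _) <;> simp [comulHom, counitHom])
    (by apply algHom_ext; rintro (_ | _ | _ | _ | _) <;> simp [comulHom, counitHom])

/-- The antipode. -/
def antipodeLin (h g : ℂ) : GLhg h g →ₗ[ℂ] GLhg h g :=
  (MulOpposite.opLinearEquiv ℂ).symm.toLinearMap ∘ₗ (antipodeHom h g).toLinearMap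

theorem antipodeLin_mul (x y : GLhg h g) :
    antipodeLin h g (x * y) = antipodeLin h g y * antipodeLin h g x := by
  simp [antipodeLin]

theorem antipodeLin_algebraMap (r : ℂ) :
    antipodeLin h g (algebraMap ℂ _ r) = algebraMap ℂ _ r := by
  simp [antipodeLin]


section Convolution
variable {A : Type*} [Ring A] [Algebra ℂ A]

theorem mul'_rTensor_mul {S : A →ₗ[ℂ] A} (hS : ∀ x y, S (x * y) = S y * S x) {P Q : A ⊗[ℂ] A}
    {r : ℂ} (hP : LinearMap.mul' ℂ A (S.rTensor A P) = algebraMap ℂ A r) :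
    LinearMap.mul' ℂ A (S.rTensor A (P * Q)) = r • LinearMap.mul' ℂ A (S.rTensor A Q) := by
  have key : ∀ (P : A ⊗[ℂ] A) (q₁ q₂ : A), LinearMap.mul' ℂ A (S.rTensor A (P * q₁ ⊗ₜ q₂)) =
      S q₁ * LinearMap.mul' ℂ A (S.rTensor A P) * q₂ := by
    intro P q₁ q₂
    induction P with
    | zero => simp
    | tmul x y => simp [hS, mul_assoc]
    | add x y hx hy => rw [add_mul, map_add, map_add, hx, hy, map_add, map_add, mul_add, add_mul]
  induction Q with
  | zero => simp
  | tmul x y =>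
    rw [key, hP, ← Algebra.commutes, mul_assoc, ← Algebra.smul_def]; simp
  | add x y hx hy => rw [mul_add, map_add, map_add, hx, hy, map_add, map_add, smul_add]

theorem mul'_lTensor_mul {S : A →ₗ[ℂ] A} (hS : ∀ x y, S (x * y) = S y * S x) {P Q : A ⊗[ℂ] A}
    {r : ℂ} (hQ : LinearMap.mul' ℂ A (S.lTensor A Q) = algebraMap ℂ A r) :
    LinearMap.mul' ℂ A (S.lTensor A (P * Q)) = r • LinearMap.mul' ℂ A (S.lTensor A P) := by
  have key : ∀ (Q : A ⊗[ℂ] A) (p₁ p₂ : A), LinearMap.mul' ℂ A (S.lTensor A (p₁ ⊗ₜ p₂ * Q)) =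
      p₁ * LinearMap.mul' ℂ A (S.lTensor A Q) * S p₂ := by
    intro P q₁ q₂
    induction P with
    | zero => simp
    | tmul x y => simp [hS, mul_assoc]
    | add x y hx hy => rw [mul_add, map_add, map_add, hx, hy, map_add, map_add, mul_add, add_mul]
  induction P with
  | zero => simp
  | tmul x y =>
    rw [key, hQ, ← Algebra.commutes, mul_assoc, ← Algebra.smul_def]; simp
  | add x y hx hy => rw [add_mul, map_add, map_add, hx, hy, map_add, map_add, smul_add]

end Convolution

theorem antipode_mul_id (x : GLhg h g) :
    LinearMap.mul' ℂ _ ((antipodeLin h g).rTensor _ (comulHom h g x)) =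
      algebraMap ℂ _ (counitHom h g x) := by
  induction x using GLhg.induction with
  | hmap r => simp [Algebra.algebraMap_eq_smul_one, Algebra.TensorProduct.one_def, antipodeLin]
  | hadd x y hx hy => simp only [map_add, hx, hy]
  | hmul x y hx hy =>
    rw [map_mul, mul'_rTensor_mul antipodeLin_mul hx, hy, map_mul, map_mul, Algebra.smul_def]
  | hgen t =>
    obtain ⟨hD, ae, be, ce, de⟩ := (isGLPoint_gen (h := h) (g := g)).comm_detInv
    obtain ⟨ca, cd, db, ab, cb, da, -, hD'⟩ := isGLPoint_gen (h := h) (g := g)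
    have r : ∀ {x y w : GLhg h g}, x * y = w → ∀ z, x * (y * z) = w * z := by
      rintro x y w rfl z; rw [mul_assoc]
    rcases t with _ | _ | _ | _ | _
    iterate 4
      · simp only [comulHom, counitHom, lift_a, lift_b, lift_c, lift_d, lift_detInv, map_add,
          LinearMap.rTensor_tmul, LinearMap.mul'_apply, antipodeLin, antipodeHom,
          LinearMap.comp_apply, AlgHom.toLinearMap_apply, LinearEquiv.coe_coe,
          MulOpposite.coe_opLinearEquiv_symm, MulOpposite.unop_op, map_one, map_zero]
        try rw [← hD']
        simp only [mul_add, mul_sub, add_mul, sub_mul, neg_mul,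
          mul_neg, smul_mul_assoc, mul_smul_comm, smul_add, smul_sub, mul_assoc,
          ca, cd, db, ab, cb, da, r ae, r be, r ce, r de]
        module
    · simp [comulHom, counitHom, antipodeLin, antipodeHom, hD, hD']

theorem id_mul_antipode (x : GLhg h g) :
    LinearMap.mul' ℂ _ ((antipodeLin h g).lTensor _ (comulHom h g x)) =
      algebraMap ℂ _ (counitHom h g x) := by
  induction x using GLhg.induction with
  | hmap r => simp [Algebra.algebraMap_eq_smul_one, Algebra.TensorProduct.one_def, antipodeLin]
  | hadd x y hx hy => simp only [map_add, hx, hy]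
  | hmul x y hx hy =>
    rw [map_mul, mul'_lTensor_mul antipodeLin_mul hy, hx, map_mul, map_mul, Algebra.smul_def,
      Algebra.commutes]
  | hgen t =>
    obtain ⟨hD, ae, be, ce, de⟩ := (isGLPoint_gen (h := h) (g := g)).comm_detInv
    obtain ⟨ca, cd, db, ab, cb, da, -, hD'⟩ := isGLPoint_gen (h := h) (g := g)
    have r : ∀ {x y w : GLhg h g}, x * y = w → ∀ z, x * (y * z) = w * z := by
      rintro x y w rfl z; rw [mul_assoc]
    rcases t with _ | _ | _ | _ | _
    iterate 4
      · simp only [comulHom, counitHom, lift_a, lift_b, lift_c, lift_d, lift_detInv, map_add,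
          LinearMap.lTensor_tmul, LinearMap.mul'_apply, antipodeLin, antipodeHom,
          LinearMap.comp_apply, AlgHom.toLinearMap_apply, LinearEquiv.coe_coe,
          MulOpposite.coe_opLinearEquiv_symm, MulOpposite.unop_op, map_one, map_zero]
        try rw [← hD']
        simp only [mul_add, mul_sub, add_mul, sub_mul, neg_mul,
          mul_neg, smul_mul_assoc, mul_smul_comm, smul_add, smul_sub, mul_assoc,
          ca, cd, db, ab, cb, da, r ae, r be, r ce, r de]
        module
    · simp [comulHom, counitHom, antipodeLin, antipodeHom, hD, hD']

instance : HopfAlgebra ℂ (GLhg h g) where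
  antipode := antipodeLin h g
  mul_antipode_rTensor_comul := LinearMap.ext antipode_mul_id
  mul_antipode_lTensor_comul := LinearMap.ext id_mul_antipode

end GLhg
end Jordanian

namespace Woronowicz

variable {A : Type} [Ring A] [HopfAlgebra ℂ A] {I : Type} [Fintype I] [DecidableEq I]

/-- `φ ⋆ x = x₍₁₎ φ(x₍₂₎)`. -/
def starLeft (φ : A →ₗ[ℂ] ℂ) : A →ₗ[ℂ] A :=
  (TensorProduct.rid ℂ A).toLinearMap ∘ₗ φ.lTensor A ∘ₗ Coalgebra.comul

/-- `x ⋆ φ = φ(x₍₁₎) x₍₂₎`. -/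
def starRight (φ : A →ₗ[ℂ] ℂ) : A →ₗ[ℂ] A :=
  (TensorProduct.lid ℂ A).toLinearMap ∘ₗ φ.rTensor A ∘ₗ Coalgebra.comul

/-- The matrix entry `f_{ij}` of a representation, as a linear functional. -/
def entry (f : A →ₐ[ℂ] Matrix I I ℂ) (i j : I) : A →ₗ[ℂ] ℂ :=
  Matrix.entryLinearMap ℂ ℂ i j ∘ₗ f.toLinearMap

variable (A I) in
/-- A bicovariant bimodule `Γ` over the Hopf algebra `A` with a finite basis `(θ_i)` of left-invariant
elements, through its structure functionals `f_{ij}` and elements `v_{ij}`. As a left module `Γ` is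
free on the `θ_i`, so that its elements `∑ ω_i θ_i` are functions `ω : I → A`; the right
multiplication is `θ_i x = ∑ (f_{ij} ⋆ x) θ_j`, and the coactions are `Δ_L(θ_i) = 1 ⊗ θ_i` and
`Δ_R(θ_i) = ∑ θ_j ⊗ v_{ji}`. -/
structure BicovariantBimodule where
  f : A →ₐ[ℂ] Matrix I I ℂ
  v : Matrix I I A
  comul_v : ∀ i k, Coalgebra.comul (R := ℂ) (v i k) = ∑ j, v i j ⊗ₜ[ℂ] v j k
  counit_v : ∀ i k, Coalgebra.counit (R := ℂ) (v i k) = if i = k then 1 else 0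
  /-- `∑ v_{ji} (x ⋆ f_{jk}) = ∑ (f_{ij} ⋆ x) v_{kj}`. -/
  compat : ∀ x i k, ∑ j, v j i * starRight (entry f j k) x = ∑ j, starLeft (entry f i j) x * v k j

variable (A I) in
/-- A bicovariant first order differential calculus: a bicovariant bimodule with the functionals
`χ_i` of the differential `dx = ∑ (χ_i ⋆ x) θ_i`. The fields are the Leibniz rule, the right
covariance of `d` (left covariance is automatic), and the condition that `Γ` be generated by
differentials as a left module. -/
structure BicovariantCalculus extends BicovariantBimodule A I where
  χ : I → A →ₗ[ℂ] ℂ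
  χ_mul : ∀ i x y, χ i (x * y) = ∑ j, χ j x * f y j i + Coalgebra.counit (R := ℂ) x * χ i y
  χ_right : ∀ j x, ∑ i, starLeft (χ i) x * v j i = starRight (χ j) x
  χ_span : ∀ i, ∃ x, ∀ j, χ j x = if i = j then 1 else 0

namespace BicovariantBimodule

variable (Γ : BicovariantBimodule A I)

/-- `ω x` for `ω ∈ Γ` and `x ∈ A`. -/
def rightMul (ω : I → A) (x : A) : I → A :=
  fun j => ∑ i, ω i * starLeft (entry Γ.f i j) x

/-- The left coaction `∑ ω_i θ_i ↦ ∑ Δ(ω_i) (1 ⊗ θ_i)`. -/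
def coactLeft (_Γ : BicovariantBimodule A I) : (I → A) →ₗ[ℂ] A ⊗[ℂ] (I → A) :=
  ∑ i, (LinearMap.single ℂ (fun _ => A) i).lTensor A ∘ₗ Coalgebra.comul ∘ₗ LinearMap.proj i

/-- The right coaction `∑ ω_i θ_i ↦ ∑ Δ(ω_i) (θ_j ⊗ v_{ji})`. -/
def coactRight : (I → A) →ₗ[ℂ] (I → A) ⊗[ℂ] A :=
  ∑ i, ∑ j, (LinearMap.single ℂ (fun _ => A) j).rTensor A ∘ₗ
    LinearMap.mulRight ℂ ((1 : A) ⊗ₜ[ℂ] Γ.v j i) ∘ₗ Coalgebra.comul ∘ₗ LinearMap.proj i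

/-- The coefficients `Λ_{ik,st} = f_{it}(v_{sk})` of Woronowicz's braiding
`Λ(θ_i ⊗ θ_k) = ∑ Λ_{ik,st} θ_s ⊗ θ_t`; see `braid_flip` and `braid_rightMul`. -/
def braidCoeff (i k s t : I) : ℂ := Γ.f (Γ.v s k) i t

/-- `Λ` acting on the tensor factors `j` and `j + 1` (counted from zero) of
`Γ^{⊗n} = Γ ⊗_A ⋯ ⊗_A Γ`. The element `∑ t_J θ_{J 0} ⊗ ⋯ ⊗ θ_{J (n-1)}` is the function `t`, and the
map is left `A`-linear. -/
def braidAt (n j : ℕ) : Module.End A ((Fin n → I) → A) :=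
  if hj : j + 1 < n then
    { toFun := fun t J => ∑ i, ∑ k, Γ.braidCoeff i k (J ⟨j, by omega⟩) (J ⟨j + 1, hj⟩) •
        t (Function.update (Function.update J ⟨j, by omega⟩ i) ⟨j + 1, hj⟩ k)
      map_add' := fun t u => by
        funext J; simp only [Pi.add_apply, smul_add, Finset.sum_add_distrib]
      map_smul' := fun x t => by
        funext J
        simp only [Pi.smul_apply, smul_eq_mul, Finset.mul_sum, RingHom.id_apply, mul_smul_comm] }
  else 0

/-- `Λ_{m-1} Λ_{m-2} ⋯ Λ_{m-k}`, where `Λ_j` is `braidAt n j`; for `k = 0` the identity. These are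
the braids of the minimal coset representatives of `S_m` in `S_{m+1}`. -/
def braidChain (n m : ℕ) : ℕ → Module.End A ((Fin n → I) → A)
  | 0 => 1
  | k + 1 => braidChain n m k * Γ.braidAt n (m - 1 - k)

/-- The antisymmetrizer on the first `m` factors, by `W_1 = 1` and
`W_{m+1} = W_m (1 - Λ_{m-1} + Λ_{m-1} Λ_{m-2} - ⋯ ± Λ_{m-1} ⋯ Λ_0)`: the sum over all permutations
in `S_m` of the sign times the braid of a reduced word. -/
def antisymmetrizerAux (n : ℕ) : ℕ → Module.End A ((Fin n → I) → A)
  | 0 => 1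
  | m + 1 => antisymmetrizerAux n m *
      ∑ k ∈ Finset.range (m + 1), (-1) ^ k * Γ.braidChain n m k

/-- Woronowicz's antisymmetrizer `W_{1…n}` on `Γ^{⊗n}`. -/
def antisymmetrizer (n : ℕ) : Module.End A ((Fin n → I) → A) := Γ.antisymmetrizerAux n n


/-- The defining relations of the tensor algebra `Γ^⊗ = A ⊕ Γ ⊕ Γ^{⊗2} ⊕ ⋯`, generated by `A` and the
`θ_i`. -/
inductive TensorRel : FreeAlgebra ℂ (A ⊕ I) → FreeAlgebra ℂ (A ⊕ I) → Prop
  | algebraMap (r : ℂ) : TensorRel (FreeAlgebra.ι ℂ (.inl (algebraMap ℂ A r))) (algebraMap ℂ _ r)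
  | add (x y : A) : TensorRel (FreeAlgebra.ι ℂ (.inl (x + y)))
      (FreeAlgebra.ι ℂ (.inl x) + FreeAlgebra.ι ℂ (.inl y))
  | mul (x y : A) : TensorRel (FreeAlgebra.ι ℂ (.inl (x * y)))
      (FreeAlgebra.ι ℂ (.inl x) * FreeAlgebra.ι ℂ (.inl y))
  | form_mul (i : I) (x : A) : TensorRel (FreeAlgebra.ι ℂ (.inr i) * FreeAlgebra.ι ℂ (.inl x))
      (∑ j, FreeAlgebra.ι ℂ (.inl (starLeft (entry Γ.f i j) x)) * FreeAlgebra.ι ℂ (.inr j))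

/-- The tensor algebra `Γ^⊗` of the bimodule `Γ` over `A`. -/
def TensorAlg : Type := RingQuot Γ.TensorRel

instance : Ring Γ.TensorAlg := inferInstanceAs (Ring (RingQuot Γ.TensorRel))
instance : Algebra ℂ Γ.TensorAlg := inferInstanceAs (Algebra ℂ (RingQuot Γ.TensorRel))

namespace TensorAlg

/-- The quotient map onto the tensor algebra. -/
def mk : FreeAlgebra ℂ (A ⊕ I) →ₐ[ℂ] Γ.TensorAlg := RingQuot.mkAlgHom ℂ Γ.TensorRel

/-- The inclusion of `A`. -/
def coeff : A →ₐ[ℂ] Γ.TensorAlg where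
  toFun x := mk Γ (FreeAlgebra.ι ℂ (.inl x))
  map_add' x y := (RingQuot.mkAlgHom_rel ℂ (TensorRel.add x y)).trans (map_add _ _ _)
  map_mul' x y := (RingQuot.mkAlgHom_rel ℂ (TensorRel.mul x y)).trans (map_mul _ _ _)
  map_one' := by
    simpa using! RingQuot.mkAlgHom_rel ℂ (TensorRel.algebraMap (Γ := Γ) 1)
  map_zero' := by
    simpa using! RingQuot.mkAlgHom_rel ℂ (TensorRel.algebraMap (Γ := Γ) 0)
  commutes' r := (RingQuot.mkAlgHom_rel ℂ (TensorRel.algebraMap r)).trans (AlgHom.commutes _ r)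

/-- The basic left-invariant form `θ_i`. -/
def form (i : I) : Γ.TensorAlg := mk Γ (FreeAlgebra.ι ℂ (.inr i))

/-- The element `∑ t_J θ_{J 0} ⊗ ⋯ ⊗ θ_{J (n-1)}` of `Γ^{⊗n}` in the tensor algebra. -/
def incl (n : ℕ) (t : (Fin n → I) → A) : Γ.TensorAlg :=
  ∑ J, coeff Γ (t J) * (List.ofFn fun p => form Γ (J p)).prod

end TensorAlg

/-- The elements of `ker W_{1…n}`, `n ≥ 2`, are set to zero. -/
inductive ExteriorRel : Γ.TensorAlg → Γ.TensorAlg → Prop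
  | ker (n : ℕ) (hn : 2 ≤ n) (t : (Fin n → I) → A) (ht : Γ.antisymmetrizer n t = 0) :
      ExteriorRel (TensorAlg.incl Γ n t) 0

/-- Woronowicz's external algebra `Ω = Γ^⊗ / ⨁ ker W_{1…n}`; its product is the wedge product. -/
def ExteriorAlg : Type := RingQuot Γ.ExteriorRel

instance : Ring Γ.ExteriorAlg := inferInstanceAs (Ring (RingQuot Γ.ExteriorRel))
instance : Algebra ℂ Γ.ExteriorAlg := inferInstanceAs (Algebra ℂ (RingQuot Γ.ExteriorRel))

namespace ExteriorAlg

/-- The projection `Γ^⊗ → Ω`. -/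
def proj : Γ.TensorAlg →ₐ[ℂ] Γ.ExteriorAlg := RingQuot.mkAlgHom ℂ Γ.ExteriorRel

/-- The inclusion of `A`. -/
def coeff : A →ₐ[ℂ] Γ.ExteriorAlg := (proj Γ).comp (TensorAlg.coeff Γ)

/-- The basic left-invariant form `θ_i`. -/
def form (i : I) : Γ.ExteriorAlg := proj Γ (TensorAlg.form Γ i)

end ExteriorAlg

/-- `ω ⊗ η ∈ Γ ⊗_A Γ`. -/
def tensor (ω η : I → A) : (Fin 2 → I) → A :=
  fun J => ∑ i, ω i * starLeft (entry Γ.f i (J 0)) (η (J 1))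

/-- The right multiplication of `Γ ⊗_A Γ`. -/
def rightMul₂ (t : (Fin 2 → I) → A) (x : A) : (Fin 2 → I) → A :=
  fun J => ∑ i, ∑ k, t ![i, k] * starLeft (entry Γ.f i (J 0)) (starLeft (entry Γ.f k (J 1)) x)

theorem starLeft_one (i j : I) : starLeft (entry Γ.f i j) 1 = if i = j then 1 else 0 := by
  simp [starLeft, entry, Bialgebra.comul_one, Algebra.TensorProduct.one_def, Matrix.one_apply]

theorem braid_apply (t : (Fin 2 → I) → A) (J : Fin 2 → I) :
    Γ.braidAt 2 0 t J = ∑ i, ∑ k, Γ.braidCoeff i k (J 0) (J 1) • t ![i, k] := by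
  have h : ∀ i k, Function.update (Function.update J 0 i) 1 k = ![i, k] := by
    intro i k; funext p; fin_cases p <;> simp [Function.update]
  simp [braidAt, h]

theorem eq_smul_one_of_inv (θ : I → A) (hθ : Γ.coactLeft θ = 1 ⊗ₜ θ) (i : I) :
    θ i = Coalgebra.counit (R := ℂ) (θ i) • (1 : A) := by
  have h := congrArg (fun P => (LinearMap.proj (R := ℂ) (φ := fun _ : I => A) i).lTensor A P) hθ
  have h2 : Coalgebra.comul (R := ℂ) (θ i) = 1 ⊗ₜ θ i := by
    rw [← show (LinearMap.proj (R := ℂ) (φ := fun _ : I => A) i).lTensor A (Γ.coactLeft θ) =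
      Coalgebra.comul (R := ℂ) (θ i) from ?_, h]
    · simp
    · rw [coactLeft, LinearMap.sum_apply, map_sum, Finset.sum_eq_single i]
      · rw [LinearMap.comp_apply, LinearMap.comp_apply, ← LinearMap.lTensor_comp_apply,
          LinearMap.proj_comp_single_same]
        simp
      · intro j _ hj
        rw [LinearMap.comp_apply, LinearMap.comp_apply, ← LinearMap.lTensor_comp_apply,
          LinearMap.proj_comp_single_ne ℂ (fun _ : I => A) _ _ hj.symm]
        simp
      · simp
  have h3 := Coalgebra.lTensor_counit_comul (R := ℂ) (θ i)
  rw [h2] at h3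
  have h4 := congrArg (TensorProduct.rid ℂ A) h3
  simpa using h4.symm


theorem starLeft_mul_v (P : A ⊗[ℂ] A) (v : A) (i t : I) :
    TensorProduct.rid ℂ A ((entry Γ.f i t).lTensor A (P * 1 ⊗ₜ v)) =
      ∑ l, Γ.f v l t • TensorProduct.rid ℂ A ((entry Γ.f i l).lTensor A P) := by
  induction P with
  | zero => simp
  | tmul x y =>
    simp only [Algebra.TensorProduct.tmul_mul_tmul, mul_one, LinearMap.lTensor_tmul, entry,
      LinearMap.comp_apply, AlgHom.toLinearMap_apply, map_mul, Matrix.entryLinearMap_apply,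
      Matrix.mul_apply, TensorProduct.rid_tmul, Finset.sum_smul, smul_smul]
    exact Finset.sum_congr rfl fun l _ => by rw [mul_comm]
  | add x y hx hy => simp only [add_mul, map_add, hx, hy, smul_add, Finset.sum_add_distrib]

theorem right_inv_eq (η : I → A) (hη : Γ.coactRight η = η ⊗ₜ 1) (s : I) :
    ∑ k, Coalgebra.comul (R := ℂ) (η k) * 1 ⊗ₜ[ℂ] Γ.v s k = η s ⊗ₜ 1 := by
  have h := congrArg (fun P => (LinearMap.proj (R := ℂ) (φ := fun _ : I => A) s).rTensor A P) hη
  simp only [LinearMap.rTensor_tmul, LinearMap.proj_apply] at h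
  rw [← h, coactRight, LinearMap.sum_apply, map_sum]
  refine Finset.sum_congr rfl fun k _ => ?_
  rw [LinearMap.sum_apply, map_sum, Finset.sum_eq_single s]
  · rw [LinearMap.comp_apply, ← LinearMap.rTensor_comp_apply, LinearMap.proj_comp_single_same]
    simp
  · intro j _ hj
    rw [LinearMap.comp_apply, ← LinearMap.rTensor_comp_apply,
      LinearMap.proj_comp_single_ne ℂ (fun _ : I => A) _ _ hj.symm]
    simp
  · simp

/-- `Λ(θ ⊗ η) = η ⊗ θ` for left-invariant `θ` and right-invariant `η`. -/
theorem braid_flip (θ η : I → A) (hθ : Γ.coactLeft θ = 1 ⊗ₜ θ) (hη : Γ.coactRight η = η ⊗ₜ 1) :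
    Γ.braidAt 2 0 (Γ.tensor θ η) = Γ.tensor η θ := by
  obtain ⟨c, hc⟩ : ∃ c : I → ℂ, ∀ i, θ i = c i • (1 : A) := ⟨_, Γ.eq_smul_one_of_inv θ hθ⟩
  have key : ∀ s i t, ∑ k, ∑ l, Γ.f (Γ.v s k) l t • starLeft (entry Γ.f i l) (η k) =
      if i = t then η s else 0 := by
    intro s i t
    have := congrArg (fun P => TensorProduct.rid ℂ A ((entry Γ.f i t).lTensor A P))
      (Γ.right_inv_eq η hη s)
    simp only [map_sum, Γ.starLeft_mul_v] at this
    refine this.trans ?_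
    simp [entry, Matrix.one_apply]
  funext J
  rw [braid_apply]
  calc ∑ i, ∑ k, Γ.braidCoeff i k (J 0) (J 1) • Γ.tensor θ η ![i, k]
      = ∑ l, c l • ∑ k, ∑ i, Γ.f (Γ.v (J 0) k) i (J 1) • starLeft (entry Γ.f l i) (η k) := by
        simp only [tensor, hc, braidCoeff, Matrix.cons_val_zero, Matrix.cons_val_one,
          Finset.smul_sum, smul_mul_assoc, one_mul]
        rw [Finset.sum_comm]
        conv_rhs => rw [Finset.sum_comm]
        refine Finset.sum_congr rfl fun k _ => ?_
        rw [Finset.sum_comm]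
        refine Finset.sum_congr rfl fun l _ => Finset.sum_congr rfl fun i _ => ?_
        rw [smul_comm]
    _ = Γ.tensor η θ J := by
        simp only [key, tensor, hc, map_smul, starLeft_one]
        simp


theorem starLeft_comp (φ ψ : A →ₗ[ℂ] ℂ) (x : A) : starLeft φ (starLeft ψ x) =
    starLeft (LinearMap.mul' ℂ ℂ ∘ₗ TensorProduct.map φ ψ ∘ₗ Coalgebra.comul) x := by
  have h : ∀ P : A ⊗[ℂ] (A ⊗[ℂ] A), TensorProduct.rid ℂ A (φ.lTensor A
      (TensorProduct.rid ℂ (A ⊗[ℂ] A) (ψ.lTensor (A ⊗[ℂ] A)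
        ((TensorProduct.assoc ℂ A A A).symm P)))) =
      TensorProduct.rid ℂ A (((LinearMap.mul' ℂ ℂ ∘ₗ TensorProduct.map φ ψ)).lTensor A P) := by
    intro P
    induction P with
    | zero => simp
    | add x y hx hy => simp only [map_add, hx, hy]
    | tmul x y =>
      induction y with
      | zero => simp
      | add y z hy hz => simp only [TensorProduct.tmul_add, map_add, hy, hz]
      | tmul y z => simp [smul_smul, mul_comm]
  have h2 : ∀ P : A ⊗[ℂ] A, Coalgebra.comul (R := ℂ) (TensorProduct.rid ℂ A (ψ.lTensor A P)) =
      TensorProduct.rid ℂ (A ⊗[ℂ] A) (ψ.lTensor (A ⊗[ℂ] A) (Coalgebra.comul.rTensor A P)) := by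
    intro P
    induction P with
    | zero => simp
    | add x y hx hy => simp only [map_add, hx, hy]
    | tmul x y => simp
  have h3 := h (Coalgebra.comul.lTensor A (Coalgebra.comul (R := ℂ) x))
  rw [Coalgebra.coassoc_symm_apply] at h3
  simp only [starLeft, LinearMap.comp_apply, LinearEquiv.coe_coe, h2]
  rw [h3, ← LinearMap.lTensor_comp_apply]
  rfl


theorem apply_starLeft (φ ψ : A →ₗ[ℂ] ℂ) (x : A) : φ (starLeft ψ x) =
    (LinearMap.mul' ℂ ℂ ∘ₗ TensorProduct.map φ ψ ∘ₗ Coalgebra.comul) x := by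
  simp only [starLeft, LinearMap.comp_apply]
  induction Coalgebra.comul (R := ℂ) x with
  | zero => simp
  | add x y hx hy => simp only [map_add, hx, hy]
  | tmul x y => simp [mul_comm]

theorem apply_starRight (φ ψ : A →ₗ[ℂ] ℂ) (x : A) : ψ (starRight φ x) =
    (LinearMap.mul' ℂ ℂ ∘ₗ TensorProduct.map φ ψ ∘ₗ Coalgebra.comul) x := by
  simp only [starRight, LinearMap.comp_apply]
  induction Coalgebra.comul (R := ℂ) x with
  | zero => simp
  | add x y hx hy => simp only [map_add, hx, hy]
  | tmul x y => simp [mul_comm]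

theorem braidCoeff_conv (p q s t : I) :
    ∑ i, ∑ k, Γ.braidCoeff i k s t •
      (LinearMap.mul' ℂ ℂ ∘ₗ TensorProduct.map (entry Γ.f p i) (entry Γ.f q k) ∘ₗ
        Coalgebra.comul : A →ₗ[ℂ] ℂ) =
    ∑ i, ∑ k, Γ.braidCoeff p q i k •
      (LinearMap.mul' ℂ ℂ ∘ₗ TensorProduct.map (entry Γ.f i s) (entry Γ.f k t) ∘ₗ
        Coalgebra.comul : A →ₗ[ℂ] ℂ) := by
  ext x
  have h := congrArg (fun y => Γ.f y p t) (Γ.compat x q s)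
  simp only [map_sum, Matrix.sum_apply, map_mul, Matrix.mul_apply] at h
  simp only [LinearMap.sum_apply, LinearMap.smul_apply, ← apply_starLeft (entry Γ.f _ _), smul_eq_mul,
    braidCoeff]
  conv_rhs =>
    enter [2, i, 2, k]
    rw [apply_starLeft, ← apply_starRight]
  rw [Finset.sum_comm]
  refine Eq.trans ?_ h.symm
  refine Finset.sum_congr rfl fun i _ => Finset.sum_congr rfl fun k _ => ?_
  simp [entry, mul_comm]

theorem starLeft_sum {κ : Type} (S : Finset κ) (φ : κ → A →ₗ[ℂ] ℂ) (x : A) :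
    starLeft (∑ a ∈ S, φ a) x = ∑ a ∈ S, starLeft (φ a) x := by
  simp only [starLeft, LinearMap.comp_apply]
  induction Coalgebra.comul (R := ℂ) x with
  | zero => simp
  | add x y hx hy => simp only [map_add, hx, hy, Finset.sum_add_distrib]
  | tmul x y => simp [Finset.sum_smul]

theorem starLeft_smul (c : ℂ) (φ : A →ₗ[ℂ] ℂ) (x : A) :
    starLeft (c • φ) x = c • starLeft φ x := by
  simp only [starLeft, LinearMap.comp_apply]
  induction Coalgebra.comul (R := ℂ) x with
  | zero => simp
  | add x y hx hy => simp only [map_add, hx, hy, smul_add]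
  | tmul x y => simp [smul_smul]

theorem sum_four_comm {M : Type} [AddCommMonoid M] (F : I → I → I → I → M) :
    ∑ i, ∑ k, ∑ p, ∑ q, F i k p q = ∑ p, ∑ q, ∑ i, ∑ k, F i k p q := by
  calc ∑ i, ∑ k, ∑ p, ∑ q, F i k p q = ∑ i, ∑ p, ∑ k, ∑ q, F i k p q :=
        Finset.sum_congr rfl fun i _ => Finset.sum_comm
    _ = ∑ p, ∑ i, ∑ q, ∑ k, F i k p q := by
        rw [Finset.sum_comm]
        exact Finset.sum_congr rfl fun p _ => Finset.sum_congr rfl fun i _ => Finset.sum_comm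
    _ = _ := Finset.sum_congr rfl fun p _ => Finset.sum_comm

/-- `Λ` is right `A`-linear. -/
theorem braid_rightMul (t : (Fin 2 → I) → A) (x : A) :
    Γ.braidAt 2 0 (Γ.rightMul₂ t x) = Γ.rightMul₂ (Γ.braidAt 2 0 t) x := by
  funext J
  have key := fun p q => congrArg (fun φ => starLeft φ x) (Γ.braidCoeff_conv p q (J 0) (J 1))
  simp only [starLeft_sum, starLeft_smul, ← starLeft_comp] at key
  rw [braid_apply]
  simp only [rightMul₂, braid_apply, Matrix.cons_val_zero, Matrix.cons_val_one]
  calc _ = ∑ p, ∑ q, t ![p, q] * ∑ i, ∑ k, Γ.braidCoeff i k (J 0) (J 1) •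
        starLeft (entry Γ.f p i) (starLeft (entry Γ.f q k) x) := by
        simp only [Finset.smul_sum, Finset.mul_sum, mul_smul_comm]
        exact sum_four_comm _
    _ = _ := by
        simp only [key]
        simp only [Finset.sum_mul, Finset.mul_sum, mul_smul_comm, smul_mul_assoc]
        exact (sum_four_comm _).symm

end BicovariantBimodule

end Woronowicz

namespace Jordanian
open Woronowicz

namespace GLhg
variable {h g : ℂ}

/-- The elements `v_{ij}`, from `Δ_R(θ_{ik}) = ∑ θ_{st} ⊗ S(T_{is}) T_{tk}`. -/
def vMat (h g : ℂ) : Matrix (Fin 4) (Fin 4) (GLhg h g) :=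
  let a := gen h g .a; let b := gen h g .b; let c := gen h g .c; let d := gen h g .d
  let S := HopfAlgebra.antipode ℂ (A := GLhg h g)
  !![S a * a, S a * b, S c * a, S c * b;
     S a * c, S a * d, S c * c, S c * d;
     S b * a, S b * b, S d * a, S d * b;
     S b * c, S b * d, S d * c, S d * d]

theorem comul_def (x : GLhg h g) : Coalgebra.comul (R := ℂ) x = comulHom h g x := rfl
theorem counit_def (x : GLhg h g) : Coalgebra.counit (R := ℂ) x = counitHom h g x := rfl
theorem antipode_def (x : GLhg h g) : HopfAlgebra.antipode ℂ x = antipodeLin h g x := rfl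

theorem antipode_a : HopfAlgebra.antipode ℂ (gen h g .a) =
    gen h g .detInv * (gen h g .d + g • gen h g .c) := by
  simp [antipode_def, antipodeLin, antipodeHom]
theorem antipode_b : HopfAlgebra.antipode ℂ (gen h g .b) =
    gen h g .detInv * (g • gen h g .d - g • gen h g .a - gen h g .b + (g ^ 2) • gen h g .c) := by
  simp [antipode_def, antipodeLin, antipodeHom]
theorem antipode_c : HopfAlgebra.antipode ℂ (gen h g .c) = -(gen h g .detInv * gen h g .c) := by
  simp [antipode_def, antipodeLin, antipodeHom]
theorem antipode_d : HopfAlgebra.antipode ℂ (gen h g .d) =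
    gen h g .detInv * (gen h g .a - g • gen h g .c) := by
  simp [antipode_def, antipodeLin, antipodeHom]

theorem comul_antipode :
    let S := HopfAlgebra.antipode ℂ (A := GLhg h g)
    let a := gen h g .a; let b := gen h g .b; let c := gen h g .c; let d := gen h g .d
    Coalgebra.comul (R := ℂ) (S a) = S a ⊗ₜ[ℂ] S a + S c ⊗ₜ S b ∧
    Coalgebra.comul (R := ℂ) (S b) = S b ⊗ₜ[ℂ] S a + S d ⊗ₜ S b ∧
    Coalgebra.comul (R := ℂ) (S c) = S a ⊗ₜ[ℂ] S c + S c ⊗ₜ S d ∧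
    Coalgebra.comul (R := ℂ) (S d) = S b ⊗ₜ[ℂ] S c + S d ⊗ₜ S d := by
  simp only [antipode_a, antipode_b, antipode_c, antipode_d, comul_def, comulHom, map_mul,
    map_add, map_sub, map_smul, map_neg, lift_a, lift_b, lift_c, lift_d, lift_detInv]
  obtain ⟨hD, ae, be, ce, de⟩ := (isGLPoint_gen (h := h) (g := g)).comm_detInv
  obtain ⟨ca, cd, db, ab, cb, da, -, hD'⟩ := isGLPoint_gen (h := h) (g := g)
  refine ⟨?_, ?_, ?_, ?_⟩ <;>
  · simp only [mul_add, mul_sub, mul_smul_comm, smul_add, smul_sub, mul_neg,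
      Algebra.TensorProduct.tmul_mul_tmul, TensorProduct.tmul_add, TensorProduct.add_tmul,
      TensorProduct.tmul_sub, TensorProduct.neg_tmul, TensorProduct.tmul_neg,
      TensorProduct.sub_tmul, TensorProduct.tmul_smul, ← TensorProduct.smul_tmul']
    module

theorem comul_vMat (i k : Fin 4) : Coalgebra.comul (R := ℂ) (vMat h g i k) =
    ∑ j, vMat h g i j ⊗ₜ[ℂ] vMat h g j k := by
  obtain ⟨ha, hb, hc, hd⟩ := comul_antipode (h := h) (g := g)
  have ca : Coalgebra.comul (R := ℂ) (gen h g .a) = _ := lift_a isGLPoint_comul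
  have cb : Coalgebra.comul (R := ℂ) (gen h g .b) = _ := lift_b isGLPoint_comul
  have cc : Coalgebra.comul (R := ℂ) (gen h g .c) = _ := lift_c isGLPoint_comul
  have cd : Coalgebra.comul (R := ℂ) (gen h g .d) = _ := lift_d isGLPoint_comul
  fin_cases i <;> fin_cases k <;>
  · simp [vMat, Fin.sum_univ_four, Bialgebra.comul_mul, ha, hb, hc, hd, ca, cb, cc, cd, mul_add,
      add_mul]
    abel

theorem counit_vMat (i k : Fin 4) : Coalgebra.counit (R := ℂ) (vMat h g i k) =
    if i = k then 1 else 0 := by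
  have ca : Coalgebra.counit (R := ℂ) (gen h g .a) = _ := lift_a isGLPoint_counit
  have cb : Coalgebra.counit (R := ℂ) (gen h g .b) = _ := lift_b isGLPoint_counit
  have cc : Coalgebra.counit (R := ℂ) (gen h g .c) = _ := lift_c isGLPoint_counit
  have cd : Coalgebra.counit (R := ℂ) (gen h g .d) = _ := lift_d isGLPoint_counit
  fin_cases i <;> fin_cases k <;> simp [vMat, Bialgebra.counit_mul, ca, cb, cc, cd]

end GLhg
end Jordanian

namespace Jordanian
open Woronowicz

section Families
variable (h g z : ℂ)

/-! The matrices `A = f(a)`, `B = f(b)`, `C = f(c)`, `D = f(d)` of the three families. -/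

def A₁ : Matrix (Fin 4) (Fin 4) ℂ :=
  !![(3 * z + 2) / 2, 0, (-(3 * h + g) * z - 2 * h) / 2, -z / 2;
     h * (z + 1), z + 1, -h ^ 2 * (z + 1), -h * (z + 1);
     0, 0, z + 1, 0;
     z / 2, 0, ((h - g) * z + 2 * h) / 2, (z + 2) / 2]

def B₁ : Matrix (Fin 4) (Fin 4) ℂ :=
  !![0, z, h * (h + g) * (z + 1), 0;
     0, (h + g) * (z + 1), -h * g * (h + g) * (z + 1), 0;
     0, 0, -(h + g) * (z + 1), 0;
     0, z, g * (h + g) * (z + 1), 0]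

def C₁ : Matrix (Fin 4) (Fin 4) ℂ :=
  !![0, 0, z, 0;
     0, 0, 0, 0;
     0, 0, 0, 0;
     0, 0, z, 0]

def D₁ : Matrix (Fin 4) (Fin 4) ℂ :=
  !![(z + 2) / 2, 0, (-(h - g) * z + 2 * g) / 2, z / 2;
     -g * (z + 1), z + 1, -g ^ 2 * (z + 1), g * (z + 1);
     0, 0, z + 1, 0;
     -z / 2, 0, (-(h + 3 * g) * z - 2 * g) / 2, (3 * z + 2) / 2]

def A₂ : Matrix (Fin 4) (Fin 4) ℂ :=
  !![(z + 2) / 2, 0, ((h + g) * z - 2 * h) / 2, z / 2;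
     h * (z + 1), 1, h * ((h + g) * z - h), h * (z - 1);
     0, 0, 1, 0;
     -z / 2, 0, (-(h + g) * z + 2 * h) / 2, (-z + 2) / 2]

def B₂ : Matrix (Fin 4) (Fin 4) ℂ :=
  !![-h * z, 0, h * (h + g) * (1 - z), -h * z;
     h * g * z, h + g, h * g * (h + g) * (z - 1), g * h * z;
     z, 0, (h + g) * (z - 1), z;
     -g * z, 0, g * (h + g) * (1 - z), -g * z]

def C₂ : Matrix (Fin 4) (Fin 4) ℂ :=
  !![0, 0, 0, 0;
     z, 0, (h + g) * z, z;
     0, 0, 0, 0;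
     0, 0, 0, 0]

def D₂ : Matrix (Fin 4) (Fin 4) ℂ :=
  !![(-z + 2) / 2, 0, (-(h + g) * z + 2 * g) / 2, -z / 2;
     g * (z - 1), 1, g * ((h + g) * z - g), g * (z + 1);
     0, 0, 1, 0;
     z / 2, 0, ((h + g) * z - 2 * g) / 2, (z + 2) / 2]

def A₃ : Matrix (Fin 4) (Fin 4) ℂ :=
  !![(z + 2) / 2, 0, ((h + g) * z - 2 * h) / 2, z / 2;
     h, 1, -h ^ 2, -h;
     0, 0, 1, 0;
     z / 2, 0, ((h + g) * z + 2 * h) / 2, (z + 2) / 2]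

def B₃ : Matrix (Fin 4) (Fin 4) ℂ :=
  !![0, 0, h * (h + g), 0;
     0, h + g, -h * g * (h + g), 0;
     0, 0, -(h + g), 0;
     0, 0, g * (h + g), 0]

def C₃ : Matrix (Fin 4) (Fin 4) ℂ := 0

def D₃ : Matrix (Fin 4) (Fin 4) ℂ :=
  !![(z + 2) / 2, 0, ((h + g) * z + 2 * g) / 2, z / 2;
     -g, 1, -g ^ 2, g;
     0, 0, 1, 0;
     z / 2, 0, ((h + g) * z - 2 * g) / 2, (z + 2) / 2]

/-! The values of `f` on the inverse of the quantum determinant. -/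

def U : Matrix (Fin 4) (Fin 4) ℂ :=
  !![1, 0, h - g, 0;
     -(h - g), 1, -(h - g) ^ 2, h - g;
     0, 0, 1, 0;
     0, 0, -(h - g), 1]

def E₁ : Matrix (Fin 4) (Fin 4) ℂ := ((z + 1) ^ 2)⁻¹ • U h g

def E₃ : Matrix (Fin 4) (Fin 4) ℂ := U h g - ((z ^ 2 + 2 * z) / (2 * (z + 1) ^ 2)) •
  !![1, 0, h + g, 1; 0, 0, 0, 0; 0, 0, 0, 0; 1, 0, h + g, 1]

end Families

section Literal

variable (p00 p01 p02 p03 p10 p11 p12 p13 p20 p21 p22 p23 p30 p31 p32 p33 : ℂ)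
  (q00 q01 q02 q03 q10 q11 q12 q13 q20 q21 q22 q23 q30 q31 q32 q33 : ℂ) (s : ℂ)

theorem mul4 : (!![p00, p01, p02, p03; p10, p11, p12, p13; p20, p21, p22, p23; p30, p31, p32, p33] : Matrix (Fin 4) (Fin 4) ℂ) * !![q00, q01, q02, q03; q10, q11, q12, q13; q20, q21, q22, q23; q30, q31, q32, q33] = !![p00*q00+p01*q10+p02*q20+p03*q30,
      p00*q01+p01*q11+p02*q21+p03*q31,
      p00*q02+p01*q12+p02*q22+p03*q32,
      p00*q03+p01*q13+p02*q23+p03*q33;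
      p10*q00+p11*q10+p12*q20+p13*q30,
      p10*q01+p11*q11+p12*q21+p13*q31,
      p10*q02+p11*q12+p12*q22+p13*q32,
      p10*q03+p11*q13+p12*q23+p13*q33;
      p20*q00+p21*q10+p22*q20+p23*q30,
      p20*q01+p21*q11+p22*q21+p23*q31,
      p20*q02+p21*q12+p22*q22+p23*q32,
      p20*q03+p21*q13+p22*q23+p23*q33;
      p30*q00+p31*q10+p32*q20+p33*q30,
      p30*q01+p31*q11+p32*q21+p33*q31,
      p30*q02+p31*q12+p32*q22+p33*q32,
      p30*q03+p31*q13+p32*q23+p33*q33] := by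
  ext i j; fin_cases i <;> fin_cases j <;> simp [Matrix.mul_apply, Fin.sum_univ_four]

theorem add4 : (!![p00, p01, p02, p03; p10, p11, p12, p13; p20, p21, p22, p23; p30, p31, p32, p33] : Matrix (Fin 4) (Fin 4) ℂ) + !![q00, q01, q02, q03; q10, q11, q12, q13; q20, q21, q22, q23; q30, q31, q32, q33] = !![p00+q00, p01+q01, p02+q02, p03+q03; p10+q10, p11+q11, p12+q12, p13+q13; p20+q20, p21+q21, p22+q22, p23+q23; p30+q30, p31+q31, p32+q32, p33+q33] := by
  ext i j; fin_cases i <;> fin_cases j <;> simp [Matrix.mul_apply, Fin.sum_univ_four]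

theorem sub4 : (!![p00, p01, p02, p03; p10, p11, p12, p13; p20, p21, p22, p23; p30, p31, p32, p33] : Matrix (Fin 4) (Fin 4) ℂ) - !![q00, q01, q02, q03; q10, q11, q12, q13; q20, q21, q22, q23; q30, q31, q32, q33] = !![p00-q00, p01-q01, p02-q02, p03-q03; p10-q10, p11-q11, p12-q12, p13-q13; p20-q20, p21-q21, p22-q22, p23-q23; p30-q30, p31-q31, p32-q32, p33-q33] := by
  ext i j; fin_cases i <;> fin_cases j <;> simp [Matrix.mul_apply, Fin.sum_univ_four]

theorem smul4 : s • (!![p00, p01, p02, p03; p10, p11, p12, p13; p20, p21, p22, p23; p30, p31, p32, p33] : Matrix (Fin 4) (Fin 4) ℂ) = !![s*p00, s*p01, s*p02, s*p03; s*p10, s*p11, s*p12, s*p13; s*p20, s*p21, s*p22, s*p23; s*p30, s*p31, s*p32, s*p33] := by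
  ext i j; fin_cases i <;> fin_cases j <;> simp [Matrix.mul_apply, Fin.sum_univ_four]

theorem one4 : (1 : Matrix (Fin 4) (Fin 4) ℂ) = !![1,0,0,0;0,1,0,0;0,0,1,0;0,0,0,1] := by
  ext i j; fin_cases i <;> fin_cases j <;> rfl

theorem zero4 : (0 : Matrix (Fin 4) (Fin 4) ℂ) = !![0,0,0,0;0,0,0,0;0,0,0,0;0,0,0,0] := by
  ext i j; fin_cases i <;> fin_cases j <;> rfl

theorem eq4 (h00 : p00 = q00) (h01 : p01 = q01) (h02 : p02 = q02) (h03 : p03 = q03) (h10 : p10 = q10) (h11 : p11 = q11) (h12 : p12 = q12) (h13 : p13 = q13) (h20 : p20 = q20) (h21 : p21 = q21) (h22 : p22 = q22) (h23 : p23 = q23) (h30 : p30 = q30) (h31 : p31 = q31) (h32 : p32 = q32) (h33 : p33 = q33) :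
    (!![p00, p01, p02, p03; p10, p11, p12, p13; p20, p21, p22, p23; p30, p31, p32, p33] : Matrix (Fin 4) (Fin 4) ℂ) = !![q00, q01, q02, q03; q10, q11, q12, q13; q20, q21, q22, q23; q30, q31, q32, q33] := by
  subst_vars; rfl

end Literal

section Families
variable (h g z : ℂ)

set_option maxHeartbeats 4000000 in
theorem isGLPoint₁ (hz : z ≠ -1) :
    IsGLPoint h g (A₁ h g z) (B₁ h g z) (C₁ z) (D₁ h g z) (E₁ h g z) := by
  have hz' : z + 1 ≠ 0 := fun h0 => hz (by linear_combination h0)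
  constructor <;> simp only [A₁, B₁, C₁, D₁, E₁, U, mul4, add4, sub4, smul4, one4, zero4, mul_zero, zero_mul, add_zero, zero_add, sub_zero, zero_sub, mul_one, one_mul] <;>
    apply eq4 <;> first | ring1 | (field_simp; done) | (field_simp; ring1)

set_option maxHeartbeats 4000000 in
theorem isGLPoint₂ :
    IsGLPoint h g (A₂ h g z) (B₂ h g z) (C₂ h g z) (D₂ h g z) (U h g) := by
  constructor <;> simp only [A₂, B₂, C₂, D₂, U, mul4, add4, sub4, smul4, one4, zero4, mul_zero, zero_mul, add_zero, zero_add, sub_zero, zero_sub, mul_one, one_mul] <;>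
    apply eq4 <;> ring1

set_option maxHeartbeats 4000000 in
theorem isGLPoint₃ (hz : z ≠ -1) :
    IsGLPoint h g (A₃ h g z) (B₃ h g) C₃ (D₃ h g z) (E₃ h g z) := by
  have hz' : z + 1 ≠ 0 := fun h0 => hz (by linear_combination h0)
  constructor <;> simp only [A₃, B₃, C₃, D₃, E₃, U, mul4, add4, sub4, smul4, one4, zero4, mul_zero, zero_mul, add_zero, zero_add, sub_zero, zero_sub, mul_one, one_mul] <;>
    apply eq4 <;> first | ring1 | (field_simp; done) | (field_simp; ring1)

end Families
end Jordanian

namespace Jordanian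
open Woronowicz

namespace GLhg
variable {h g : ℂ}

/-- The matrix `T` of generators. -/
def T (h g : ℂ) : Matrix (Fin 2) (Fin 2) (GLhg h g) :=
  !![gen h g .a, gen h g .b; gen h g .c, gen h g .d]

theorem vMat_apply (s t p q : Fin 2) :
    vMat h g (finProdFinEquiv (s, t)) (finProdFinEquiv (p, q)) =
      HopfAlgebra.antipode ℂ (T h g p s) * T h g t q := by
  fin_cases s <;> fin_cases t <;> fin_cases p <;> fin_cases q <;> rfl

theorem antipode_T (p q : Fin 2) :
    ∑ s, HopfAlgebra.antipode ℂ (T h g p s) * T h g s q = if p = q then 1 else 0 := by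
  have key := fun x : GLhg h g => HopfAlgebra.mul_antipode_rTensor_comul_apply (R := ℂ) x
  have ha := key (gen h g .a)
  have hb := key (gen h g .b)
  have hc := key (gen h g .c)
  have hd := key (gen h g .d)
  simp only [comul_def, comulHom, counit_def, counitHom, lift_a, lift_b, lift_c, lift_d, map_add,
    LinearMap.rTensor_tmul, LinearMap.mul'_apply, map_one, map_zero] at ha hb hc hd
  fin_cases p <;> fin_cases q <;> simpa [T, Fin.sum_univ_two]

theorem T_antipode (p q : Fin 2) :
    ∑ s, T h g p s * HopfAlgebra.antipode ℂ (T h g s q) = if p = q then 1 else 0 := by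
  have key := fun x : GLhg h g => HopfAlgebra.mul_antipode_lTensor_comul_apply (R := ℂ) x
  have ha := key (gen h g .a)
  have hb := key (gen h g .b)
  have hc := key (gen h g .c)
  have hd := key (gen h g .d)
  simp only [comul_def, comulHom, counit_def, counitHom, lift_a, lift_b, lift_c, lift_d, map_add,
    LinearMap.lTensor_tmul, LinearMap.mul'_apply, map_one, map_zero] at ha hb hc hd
  fin_cases p <;> fin_cases q <;> simpa [T, Fin.sum_univ_two]

def alphaM (h g : ℂ) (m n : Fin 2) : Matrix (Fin 2) (Fin 2) ℂ :=
  !![!![1, -h; 0, 1], !![h, h * g; 0, -g]; 0, !![1, g; 0, 1]] m n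

def betaM (h g : ℂ) (m n : Fin 2) : Matrix (Fin 2) (Fin 2) ℂ :=
  !![!![1, 0; h, 1], !![-h, 0; h * g, g]; 0, !![1, 0; -g, 1]] m n

theorem alpha_rtt (m n p q : Fin 2) :
    ∑ k, ∑ s, alphaM h g m k p s • (T h g k n * T h g s q) =
      ∑ k, ∑ s, alphaM h g k n s q • (T h g p s * T h g m k) := by
  obtain ⟨ca, cd, db, ab, cb, da, -, hD'⟩ := isGLPoint_gen (h := h) (g := g)
  fin_cases m <;> fin_cases n <;> fin_cases p <;> fin_cases q <;>
  · simp [T, alphaM, Fin.sum_univ_two, ca, cd, db, ab, cb, da]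
    try module

theorem beta_rtt (m n q t : Fin 2) :
    ∑ l, ∑ s, betaM h g m l s t • (T h g s q * T h g l n) =
      ∑ l, ∑ s, betaM h g l n q s • (T h g m l * T h g t s) := by
  obtain ⟨ca, cd, db, ab, cb, da, -, hD'⟩ := isGLPoint_gen (h := h) (g := g)
  fin_cases m <;> fin_cases n <;> fin_cases q <;> fin_cases t <;>
  · simp [T, betaM, Fin.sum_univ_two, ca, cd, db, ab, cb, da]
    try module

end GLhg
end Jordanian

namespace Jordanian
open Woronowicz

namespace GLhg
variable {h g : ℂ}

theorem alpha_antipode (m n p u : Fin 2) :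
    ∑ k, ∑ s, alphaM h g m k s u • (HopfAlgebra.antipode ℂ (T h g p s) * T h g k n) =
      ∑ k, ∑ s, alphaM h g k n p s • (T h g m k * HopfAlgebra.antipode ℂ (T h g s u)) := by
  obtain ⟨X, hX⟩ : ∃ X : Matrix (Fin 2) (Fin 2) (GLhg h g), ∀ p s, X p s = ∑ k, alphaM h g m k p s • T h g k n := ⟨_, fun _ _ => rfl⟩
  obtain ⟨Y, hY⟩ : ∃ Y : Matrix (Fin 2) (Fin 2) (GLhg h g), ∀ p s, Y p s = ∑ k, alphaM h g k n p s • T h g m k := ⟨_, fun _ _ => rfl⟩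
  obtain ⟨N, hN⟩ : ∃ N : Matrix (Fin 2) (Fin 2) (GLhg h g), ∀ p s, N p s = HopfAlgebra.antipode ℂ (T h g p s) := ⟨_, fun _ _ => rfl⟩
  have hXY : X * T h g = T h g * Y := by
    ext p q
    simp only [Matrix.mul_apply, hX, hY, Finset.sum_mul, Finset.mul_sum, smul_mul_assoc,
      mul_smul_comm]
    rw [Finset.sum_comm, alpha_rtt, Finset.sum_comm]
  have h1 : N * T h g = 1 := by
    ext p q; simp only [Matrix.mul_apply, hN, antipode_T, Matrix.one_apply]
  have h2 : T h g * N = 1 := by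
    ext p q; simp only [Matrix.mul_apply, hN, T_antipode, Matrix.one_apply]
  have h3 : N * X = Y * N := by
    calc N * X = N * (X * T h g) * N := by rw [mul_assoc, mul_assoc, h2, mul_one]
      _ = Y * N := by rw [hXY, ← mul_assoc, h1, one_mul]
  have h4 := congrFun (congrFun h3 p) u
  simp only [Matrix.mul_apply, hX, hY, hN, Finset.sum_mul, Finset.mul_sum, smul_mul_assoc,
      mul_smul_comm] at h4
  rw [Finset.sum_comm, h4, Finset.sum_comm]

/-- Compatibility of the values of `f` on generators with the matrix `V`. -/
def CompatGen (h g : ℂ) (F : Fin 2 → Fin 2 → Matrix (Fin 4) (Fin 4) ℂ) : Prop :=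
  ∀ m n i k, ∑ j, ∑ l, F m l j k • (vMat h g j i * T h g l n) =
    ∑ j, ∑ l, F l n i j • (T h g m l * vMat h g k j)

theorem CompatGen.add {F G : Fin 2 → Fin 2 → Matrix (Fin 4) (Fin 4) ℂ} (hF : CompatGen h g F)
    (hG : CompatGen h g G) : CompatGen h g (F + G) := by
  intro m n i k
  simp only [Pi.add_apply, Matrix.add_apply, add_smul, Finset.sum_add_distrib, hF m n i k,
    hG m n i k]

theorem CompatGen.smul {F : Fin 2 → Fin 2 → Matrix (Fin 4) (Fin 4) ℂ} (hF : CompatGen h g F)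
    (x : ℂ) : CompatGen h g (x • F) := by
  intro m n i k
  simp only [Pi.smul_apply, Matrix.smul_apply, smul_eq_mul, mul_smul, ← Finset.smul_sum,
    hF m n i k]

theorem sum_fin_four {M : Type} [AddCommMonoid M] (F : Fin 4 → M) :
    ∑ j, F j = ∑ s : Fin 2, ∑ t : Fin 2, F (finProdFinEquiv (s, t)) := by
  rw [← (finProdFinEquiv (m := 2) (n := 2)).sum_comp F, Fintype.sum_prod_type]

theorem CompatGen.of_prod {F : Fin 2 → Fin 2 → Matrix (Fin 4) (Fin 4) ℂ}
    (H : ∀ m n p q u w, ∑ s, ∑ t, ∑ l,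
      F m l (finProdFinEquiv (s, t)) (finProdFinEquiv (u, w)) •
        (HopfAlgebra.antipode ℂ (T h g p s) * T h g t q * T h g l n) =
      ∑ s, ∑ t, ∑ l, F l n (finProdFinEquiv (p, q)) (finProdFinEquiv (s, t)) •
        (T h g m l * (HopfAlgebra.antipode ℂ (T h g s u) * T h g w t))) :
    CompatGen h g F := by
  intro m n i k
  obtain ⟨⟨p, q⟩, rfl⟩ := (finProdFinEquiv (m := 2) (n := 2)).surjective i
  obtain ⟨⟨u, w⟩, rfl⟩ := (finProdFinEquiv (m := 2) (n := 2)).surjective k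
  rw [sum_fin_four, sum_fin_four]
  simp only [vMat_apply]
  exact H m n p q u w

/-- The common value of the three families at `z = 0`, as a product. -/
def F₀ (h g : ℂ) (m n : Fin 2) : Matrix (Fin 4) (Fin 4) ℂ :=
  Matrix.reindex (finProdFinEquiv (m := 2) (n := 2)) (finProdFinEquiv (m := 2) (n := 2))
    (∑ k, Matrix.kroneckerMap (· * ·) (alphaM h g m k) (betaM h g k n))

theorem compatGen_F₀ : CompatGen h g (F₀ h g) := by
  apply CompatGen.of_prod
  intro m n p q u w
  simp only [F₀, Matrix.reindex_apply, Matrix.submatrix_apply, Equiv.symm_apply_apply,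
    Matrix.sum_apply, Matrix.kroneckerMap_apply]
  have hb := fun κ => beta_rtt (h := h) (g := g) κ n q w
  have ha := fun l => alpha_antipode (h := h) (g := g) m l p u
  calc _ = ∑ κ, ∑ s, alphaM h g m κ s u • (HopfAlgebra.antipode ℂ (T h g p s) *
        ∑ l, ∑ t, betaM h g κ l t w • (T h g t q * T h g l n)) := by
        simp only [Fin.sum_univ_two, add_smul, mul_smul, mul_add, mul_smul_comm, smul_add,
          mul_assoc]
        module
    _ = ∑ l, ∑ t, betaM h g l n q t • ((∑ κ, ∑ s, alphaM h g m κ s u •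
        (HopfAlgebra.antipode ℂ (T h g p s) * T h g κ l)) * T h g w t) := by
        simp only [hb]
        simp only [Fin.sum_univ_two, mul_add, add_mul, mul_smul_comm, smul_mul_assoc, smul_add,
          mul_assoc]
        module
    _ = _ := by
        simp only [ha]
        simp only [Fin.sum_univ_two, mul_add, add_mul, mul_smul_comm, smul_mul_assoc, smul_add,
          mul_assoc]
        module

end GLhg
end Jordanian

namespace Jordanian
open Woronowicz

namespace GLhg
variable {h g : ℂ}

def tau : Fin 4 → ℂ := ![1, 0, 0, 1]

def rho (h g : ℂ) : Fin 4 → ℂ := ![1, 0, h + g, 1]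

def wVec (h g : ℂ) (m n : Fin 2) : Fin 4 → ℂ :=
  !![![1, 2 * h, 0, -1], ![-2 * h, 2 * h * g, 2, -2 * g]; ![0, 2, 0, 0], ![-1, 2 * g, 0, 1]] m n

def wRow (h g : ℂ) (m n : Fin 2) : Fin 4 → ℂ :=
  !![![1, 0, -(h + g), -1], ![0, 2, 0, 0]; ![0, 0, 2, 0], ![-1, 0, -(h + g), 1]] m n

theorem tau_vMat (i : Fin 4) : ∑ j, tau j • vMat h g j i = tau i • 1 := by
  obtain ⟨⟨p, q⟩, rfl⟩ := (finProdFinEquiv (m := 2) (n := 2)).surjective i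
  rw [sum_fin_four]
  simp only [vMat_apply]
  have := antipode_T (h := h) (g := g) p q
  fin_cases p <;> fin_cases q <;> simpa [tau, Fin.sum_univ_two, finProdFinEquiv] using! this

theorem rho_vMat (k : Fin 4) : ∑ j, rho h g j • vMat h g k j = rho h g k • 1 := by
  obtain ⟨hD, ae, be, ce, de⟩ := (isGLPoint_gen (h := h) (g := g)).comm_detInv
  obtain ⟨ca, cd, db, ab, cb, da, -, hD'⟩ := isGLPoint_gen (h := h) (g := g)
  rw [← hD']
  fin_cases k <;>
  · simp [rho, vMat, Fin.sum_univ_four, antipode_a, antipode_b, antipode_c, antipode_d, mul_add,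
      mul_sub, add_mul, sub_mul, mul_assoc, ca, cd, db, ab, cb, da]
    try module

theorem wVec_rtt (m n r q : Fin 2) :
    ∑ t, ∑ l, wVec h g m l (finProdFinEquiv (r, t)) • (T h g t q * T h g l n) =
      ∑ p, ∑ l, wVec h g l n (finProdFinEquiv (p, q)) • (T h g r p * T h g m l) := by
  obtain ⟨ca, cd, db, ab, cb, da, -, hD'⟩ := isGLPoint_gen (h := h) (g := g)
  fin_cases m <;> fin_cases n <;> fin_cases r <;> fin_cases q <;>
  · simp [T, wVec, Fin.sum_univ_two, finProdFinEquiv, ca, cd, db, ab, cb, da]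
    try module

theorem wRow_rtt (x n : Fin 2) (k : Fin 4) :
    ∑ m, ∑ l, wRow h g m l k • (HopfAlgebra.antipode ℂ (T h g x m) * T h g l n) =
      ∑ j, wRow h g x n j • vMat h g k j := by
  obtain ⟨ca, cd, db, ab, cb, da, -, hD'⟩ := isGLPoint_gen (h := h) (g := g)
  fin_cases x <;> fin_cases n <;> fin_cases k <;>
  · simp [T, wRow, vMat, Fin.sum_univ_two, Fin.sum_univ_four, antipode_a, antipode_b, antipode_c,
      antipode_d, mul_add, mul_sub, add_mul, sub_mul, mul_assoc, ca, cd, db, ab, cb, da]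
    try module

end GLhg
end Jordanian

namespace Jordanian
open Woronowicz

namespace GLhg
variable {h g : ℂ}

theorem compatGen_tau_rho : CompatGen h g
    (fun m n => if m = n then Matrix.vecMulVec tau (rho h g) else 0) := by
  intro m n i k
  have h1 := tau_vMat (h := h) (g := g) i
  have h2 := rho_vMat (h := h) (g := g) k
  calc _ = rho h g k • ((∑ j, tau j • vMat h g j i) * T h g m n) := by
        simp only [Matrix.ite_apply, Matrix.zero_apply, ite_smul, zero_smul, Finset.sum_ite_eq,
          Finset.mem_univ, if_true, Matrix.vecMulVec_apply, Finset.sum_mul, Finset.smul_sum,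
          smul_mul_assoc, smul_smul, mul_comm (tau _)]
    _ = tau i • (T h g m n * (∑ j, rho h g j • vMat h g k j)) := by
        rw [h1, h2, smul_one_mul, mul_smul_comm, mul_one, smul_comm]
    _ = _ := by
        simp only [Matrix.ite_apply, Matrix.zero_apply, ite_smul, zero_smul, Finset.sum_ite_eq',
          Finset.mem_univ, if_true, Matrix.vecMulVec_apply, Finset.mul_sum, Finset.smul_sum,
          mul_smul_comm, smul_smul]

theorem compatGen_wRow : CompatGen h g
    (fun m n => Matrix.vecMulVec tau (wRow h g m n)) := by
  intro m n i k
  have h1 := tau_vMat (h := h) (g := g) i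
  have h2 := fun x => congrArg (fun y => T h g m x * y) (wRow_rtt (h := h) (g := g) x n k)
  have h3 : ∑ l, wRow h g m l k • T h g l n =
      ∑ l, ∑ j, wRow h g l n j • (T h g m l * vMat h g k j) := by
    calc _ = ∑ y, ∑ l, wRow h g y l k •
          ((∑ x, T h g m x * HopfAlgebra.antipode ℂ (T h g x y)) * T h g l n) := by
          simp only [T_antipode, ite_mul, one_mul, zero_mul, smul_ite, smul_zero]
          rw [Finset.sum_comm]
          simp
      _ = ∑ x, T h g m x * ∑ y, ∑ l, wRow h g y l k •
          (HopfAlgebra.antipode ℂ (T h g x y) * T h g l n) := by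
          simp only [Fin.sum_univ_two, mul_add, add_mul, mul_smul_comm, smul_add, mul_assoc]
          abel
      _ = _ := by
          simp only [h2]
          simp only [Finset.mul_sum, mul_smul_comm]
  calc _ = (∑ j, tau j • vMat h g j i) * ∑ l, wRow h g m l k • T h g l n := by
        simp only [Matrix.vecMulVec_apply, Finset.sum_mul, Finset.mul_sum, smul_mul_assoc,
          mul_smul_comm, smul_smul, Finset.smul_sum]
        rw [Finset.sum_comm]
        simp only [mul_comm (tau _)]
    _ = tau i • ∑ l, ∑ j, wRow h g l n j • (T h g m l * vMat h g k j) := by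
        rw [h1, smul_one_mul, h3]
    _ = _ := by
        rw [Finset.sum_comm]
        simp only [Matrix.vecMulVec_apply, Finset.smul_sum, smul_smul]

theorem compatGen_wVec : CompatGen h g
    (fun m n => Matrix.vecMulVec (wVec h g m n) (rho h g)) := by
  intro m n i k
  have h2 := rho_vMat (h := h) (g := g) k
  have h3 : ∑ j, ∑ l, wVec h g m l j • (vMat h g j i * T h g l n) =
      ∑ l, wVec h g l n i • T h g m l := by
    obtain ⟨⟨p, q⟩, rfl⟩ := (finProdFinEquiv (m := 2) (n := 2)).surjective i
    rw [sum_fin_four]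
    simp only [vMat_apply]
    calc _ = ∑ r, HopfAlgebra.antipode ℂ (T h g p r) * ∑ t, ∑ l,
          wVec h g m l (finProdFinEquiv (r, t)) • (T h g t q * T h g l n) := by
          simp only [Finset.mul_sum, mul_smul_comm, mul_assoc]
      _ = ∑ y, ∑ l, wVec h g l n (finProdFinEquiv (y, q)) •
          ((∑ r, HopfAlgebra.antipode ℂ (T h g p r) * T h g r y) * T h g m l) := by
          simp only [wVec_rtt]
          simp only [Fin.sum_univ_two, mul_add, add_mul, mul_smul_comm, smul_add, mul_assoc]
          abel
      _ = _ := by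
          simp only [antipode_T, ite_mul, one_mul, zero_mul, smul_ite, smul_zero]
          rw [Finset.sum_comm]
          simp
  calc _ = rho h g k • ∑ j, ∑ l, wVec h g m l j • (vMat h g j i * T h g l n) := by
        simp only [Matrix.vecMulVec_apply, Finset.smul_sum, smul_smul, mul_comm (rho h g k)]
    _ = ∑ l, wVec h g l n i • (T h g m l * ∑ j, rho h g j • vMat h g k j) := by
        rw [h3, h2]
        simp only [mul_smul_comm, mul_one, Finset.smul_sum, smul_smul, mul_comm (rho h g k)]
    _ = _ := by
        rw [Finset.sum_comm]
        simp only [Matrix.vecMulVec_apply, Finset.mul_sum, Finset.smul_sum, mul_smul_comm, smul_smul]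

end GLhg
end Jordanian

namespace Jordanian
open Woronowicz

namespace GLhg
variable {h g : ℂ}

/-- The matrices `f(a), f(b), f(c), f(d)`, arranged as `T`. -/
def arr (A B C D : Matrix (Fin 4) (Fin 4) ℂ) (m n : Fin 2) : Matrix (Fin 4) (Fin 4) ℂ :=
  !![A, B; C, D] m n

theorem F₀_eq : F₀ h g = arr
    !![1, 0, -h, 0; h, 1, -h ^ 2, -h; 0, 0, 1, 0; 0, 0, h, 1]
    !![0, 0, h * (h + g), 0; 0, h + g, -h * g * (h + g), 0; 0, 0, -(h + g), 0;
      0, 0, g * (h + g), 0]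
    !![0, 0, 0, 0; 0, 0, 0, 0; 0, 0, 0, 0; 0, 0, 0, 0]
    !![1, 0, g, 0; -g, 1, -g ^ 2, g; 0, 0, 1, 0; 0, 0, -g, 1] := by
  funext m n
  ext i j
  obtain ⟨⟨p, q⟩, rfl⟩ := (finProdFinEquiv (m := 2) (n := 2)).surjective i
  obtain ⟨⟨u, w⟩, rfl⟩ := (finProdFinEquiv (m := 2) (n := 2)).surjective j
  simp only [F₀, Matrix.reindex_apply, Matrix.submatrix_apply, Equiv.symm_apply_apply,
    Matrix.sum_apply, Matrix.kroneckerMap_apply, Fin.sum_univ_two]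
  fin_cases m <;> fin_cases n <;> fin_cases p <;> fin_cases q <;> fin_cases u <;> fin_cases w <;>
    simp [arr, alphaM, betaM, finProdFinEquiv] <;> ring1

theorem vec4 (p0 p1 p2 p3 q0 q1 q2 q3 : ℂ) : Matrix.vecMulVec ![p0, p1, p2, p3] ![q0, q1, q2, q3] =
    !![p0 * q0, p0 * q1, p0 * q2, p0 * q3; p1 * q0, p1 * q1, p1 * q2, p1 * q3;
      p2 * q0, p2 * q1, p2 * q2, p2 * q3; p3 * q0, p3 * q1, p3 * q2, p3 * q3] := by
  ext i j; fin_cases i <;> fin_cases j <;> rfl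

theorem ext2 {M : Type} {F G : Fin 2 → Fin 2 → M} (h00 : F 0 0 = G 0 0) (h01 : F 0 1 = G 0 1)
    (h10 : F 1 0 = G 1 0) (h11 : F 1 1 = G 1 1) : F = G := by
  funext m n
  fin_cases m <;> fin_cases n <;> assumption

theorem arr_apply (A B C D : Matrix (Fin 4) (Fin 4) ℂ) : arr A B C D 0 0 = A ∧
    arr A B C D 0 1 = B ∧ arr A B C D 1 0 = C ∧ arr A B C D 1 1 = D := ⟨rfl, rfl, rfl, rfl⟩

theorem wRow_apply : wRow h g 0 0 = ![1, 0, -(h + g), -1] ∧ wRow h g 0 1 = ![0, 2, 0, 0] ∧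
    wRow h g 1 0 = ![0, 0, 2, 0] ∧ wRow h g 1 1 = ![-1, 0, -(h + g), 1] := ⟨rfl, rfl, rfl, rfl⟩

theorem wVec_apply : wVec h g 0 0 = ![1, 2 * h, 0, -1] ∧
    wVec h g 0 1 = ![-2 * h, 2 * h * g, 2, -2 * g] ∧
    wVec h g 1 0 = ![0, 2, 0, 0] ∧ wVec h g 1 1 = ![-1, 2 * g, 0, 1] := ⟨rfl, rfl, rfl, rfl⟩

theorem arr₁ (z : ℂ) : arr (A₁ h g z) (B₁ h g z) (C₁ z) (D₁ h g z) =
    (z + 1) • F₀ h g + (z / 2) • fun m n => Matrix.vecMulVec tau (wRow h g m n) := by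
  rw [F₀_eq]
  refine ext2 ?_ ?_ ?_ ?_ <;>
  · simp only [Pi.add_apply, Pi.smul_apply, arr_apply, wRow_apply, tau,
      A₁, B₁, C₁, D₁, vec4, smul4, add4, zero4]
    apply eq4 <;> ring1

theorem arr₂ (z : ℂ) : arr (A₂ h g z) (B₂ h g z) (C₂ h g z) (D₂ h g z) =
    F₀ h g + (z / 2) • fun m n => Matrix.vecMulVec (wVec h g m n) (rho h g) := by
  rw [F₀_eq]
  refine ext2 ?_ ?_ ?_ ?_ <;>
  · simp only [Pi.add_apply, Pi.smul_apply, arr_apply, wVec_apply, rho,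
      A₂, B₂, C₂, D₂, vec4, smul4, add4, zero4]
    apply eq4 <;> ring1

theorem arr₃ (z : ℂ) : arr (A₃ h g z) (B₃ h g) C₃ (D₃ h g z) =
    F₀ h g + (z / 2) • fun m n => if m = n then Matrix.vecMulVec tau (rho h g) else 0 := by
  rw [F₀_eq]
  refine ext2 ?_ ?_ ?_ ?_ <;>
  · simp only [Pi.add_apply, Pi.smul_apply, arr_apply, tau, rho, if_true, if_false, zero_ne_one, one_ne_zero, reduceIte,
      A₃, B₃, C₃, D₃, vec4, smul4, add4, zero4]
    apply eq4 <;> ring1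

end GLhg
end Jordanian

namespace Jordanian
open Woronowicz

/-- The values of the `χ_j` on the quantum determinant. -/
def detRow (h : ℂ) (ra rb rc rd : Matrix (Fin 1) (Fin 4) ℂ) (C D : Matrix (Fin 4) (Fin 4) ℂ) :
    Matrix (Fin 1) (Fin 4) ℂ := rd + ra * D - rb * C + h • (rc + ra * C)

theorem IsGLPoint.blocks {h g : ℂ} {A B C D E : Matrix (Fin 4) (Fin 4) ℂ}
    (H : IsGLPoint h g A B C D E) (ra rb rc rd : Matrix (Fin 1) (Fin 4) ℂ)
    (ca : rc * A = rc + ra * C - g • (rc * C))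
    (cd : rc * D = rc + rd * C - h • (rc * C))
    (db : rb + rd * B = rb * D + g • (detRow h ra rb rc rd C D - (rd + rd * D)))
    (ab : rb + ra * B = rb * A + h • (detRow h ra rb rc rd C D - (ra + ra * A)))
    (cb : rc * B = rb * C - h • (rc + ra * C) - g • (rc + rd * C) + (g * h) • (rc * C))
    (da : ra + rd * A = rd + ra * D + h • (rc + ra * C) - g • (rc + rd * C)) :
    IsGLPoint h g (Matrix.fromBlocks (1 : Matrix (Fin 1) (Fin 1) ℂ) ra 0 A)
      (Matrix.fromBlocks (0 : Matrix (Fin 1) (Fin 1) ℂ) rb 0 B)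
      (Matrix.fromBlocks (0 : Matrix (Fin 1) (Fin 1) ℂ) rc 0 C)
      (Matrix.fromBlocks (1 : Matrix (Fin 1) (Fin 1) ℂ) rd 0 D)
      (Matrix.fromBlocks (1 : Matrix (Fin 1) (Fin 1) ℂ) (-(detRow h ra rb rc rd C D * E)) 0 E) := by
  have sub : ∀ (p p' : Matrix (Fin 1) (Fin 1) ℂ) (q q' : Matrix (Fin 1) (Fin 4) ℂ)
      (r r' : Matrix (Fin 4) (Fin 1) ℂ) (s s' : Matrix (Fin 4) (Fin 4) ℂ),
      Matrix.fromBlocks p q r s - Matrix.fromBlocks p' q' r' s' =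
        Matrix.fromBlocks (p - p') (q - q') (r - r') (s - s') := by
    intros
    ext (_ | _) (_ | _) <;> rfl
  have hD : Matrix.fromBlocks (1 : Matrix (Fin 1) (Fin 1) ℂ) ra 0 A *
        Matrix.fromBlocks (1 : Matrix (Fin 1) (Fin 1) ℂ) rd 0 D -
      Matrix.fromBlocks (0 : Matrix (Fin 1) (Fin 1) ℂ) rb 0 B *
        Matrix.fromBlocks (0 : Matrix (Fin 1) (Fin 1) ℂ) rc 0 C +
      h • (Matrix.fromBlocks (1 : Matrix (Fin 1) (Fin 1) ℂ) ra 0 A *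
        Matrix.fromBlocks (0 : Matrix (Fin 1) (Fin 1) ℂ) rc 0 C) =
      Matrix.fromBlocks 1 (detRow h ra rb rc rd C D) 0 (A * D - B * C + h • (A * C)) := by
    simp [Matrix.fromBlocks_multiply, Matrix.fromBlocks_smul, Matrix.fromBlocks_add, sub, detRow]
  constructor
  · simp [Matrix.fromBlocks_multiply, Matrix.fromBlocks_smul, Matrix.fromBlocks_add, sub, ca, H.ca]
  · simp [Matrix.fromBlocks_multiply, Matrix.fromBlocks_smul, Matrix.fromBlocks_add, sub, cd, H.cd]
  · rw [hD]
    simp [Matrix.fromBlocks_multiply, Matrix.fromBlocks_smul, Matrix.fromBlocks_add, sub, db, H.db]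
  · rw [hD]
    simp [Matrix.fromBlocks_multiply, Matrix.fromBlocks_smul, Matrix.fromBlocks_add, sub, ab, H.ab]
  · simp [Matrix.fromBlocks_multiply, Matrix.fromBlocks_smul, Matrix.fromBlocks_add, sub, cb, H.cb]
  · simp [Matrix.fromBlocks_multiply, Matrix.fromBlocks_smul, Matrix.fromBlocks_add, sub, da, H.da]
  · rw [hD]
    simp [Matrix.fromBlocks_multiply, H.det_e, Matrix.fromBlocks_one]
  · rw [hD]
    simp [Matrix.fromBlocks_multiply, H.e_det, Matrix.fromBlocks_one, Matrix.mul_assoc]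

section Rows
variable (p0 p1 p2 p3 q0 q1 q2 q3 s : ℂ)
theorem rmul (q00 q01 q02 q03 q10 q11 q12 q13 q20 q21 q22 q23 q30 q31 q32 q33 : ℂ) :
    (!![p0, p1, p2, p3] : Matrix (Fin 1) (Fin 4) ℂ) *
    !![q00, q01, q02, q03; q10, q11, q12, q13; q20, q21, q22, q23; q30, q31, q32, q33] =
    !![p0*q00+p1*q10+p2*q20+p3*q30, p0*q01+p1*q11+p2*q21+p3*q31, p0*q02+p1*q12+p2*q22+p3*q32,
      p0*q03+p1*q13+p2*q23+p3*q33] := by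
  ext i j; fin_cases i; fin_cases j <;> simp [Matrix.mul_apply, Fin.sum_univ_four]
theorem radd : (!![p0, p1, p2, p3] : Matrix (Fin 1) (Fin 4) ℂ) + !![q0, q1, q2, q3] =
    !![p0 + q0, p1 + q1, p2 + q2, p3 + q3] := by
  ext i j; fin_cases i; fin_cases j <;> rfl
theorem rsub : (!![p0, p1, p2, p3] : Matrix (Fin 1) (Fin 4) ℂ) - !![q0, q1, q2, q3] =
    !![p0 - q0, p1 - q1, p2 - q2, p3 - q3] := by
  ext i j; fin_cases i; fin_cases j <;> rfl
theorem rsmul : s • (!![p0, p1, p2, p3] : Matrix (Fin 1) (Fin 4) ℂ)  =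
    !![s * p0, s * p1, s * p2, s * p3] := by
  ext i j; fin_cases i; fin_cases j <;> rfl
variable {p0 p1 p2 p3 q0 q1 q2 q3}
theorem req (h0 : p0 = q0) (h1 : p1 = q1) (h2 : p2 = q2) (h3 : p3 = q3) :
    (!![p0, p1, p2, p3] : Matrix (Fin 1) (Fin 4) ℂ) = !![q0, q1, q2, q3] := by
  subst_vars; rfl
end Rows

abbrev e₁ : Matrix (Fin 1) (Fin 4) ℂ := !![1, 0, 0, 0]
abbrev e₂ : Matrix (Fin 1) (Fin 4) ℂ := !![0, 1, 0, 0]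
abbrev e₃ : Matrix (Fin 1) (Fin 4) ℂ := !![0, 0, 1, 0]
abbrev e₄ : Matrix (Fin 1) (Fin 4) ℂ := !![0, 0, 0, 1]

/-- The data of a calculus with basis `θ₁, …, θ₄` and `da = aθ₁ + bθ₃`, and so on. -/
abbrev BlockPoint (h g : ℂ) (A B C D E : Matrix (Fin 4) (Fin 4) ℂ) : Prop :=
  IsGLPoint h g (Matrix.fromBlocks (1 : Matrix (Fin 1) (Fin 1) ℂ) e₁ 0 A)
      (Matrix.fromBlocks (0 : Matrix (Fin 1) (Fin 1) ℂ) e₂ 0 B)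
      (Matrix.fromBlocks (0 : Matrix (Fin 1) (Fin 1) ℂ) e₃ 0 C)
      (Matrix.fromBlocks (1 : Matrix (Fin 1) (Fin 1) ℂ) e₄ 0 D)
      (Matrix.fromBlocks (1 : Matrix (Fin 1) (Fin 1) ℂ) (-(detRow h e₁ e₂ e₃ e₄ C D * E)) 0 E)

theorem blocks₁ (h g z : ℂ) (hz : z ≠ -1) :
    BlockPoint h g (A₁ h g z) (B₁ h g z) (C₁ z) (D₁ h g z) (E₁ h g z) := by
  refine (isGLPoint₁ h g z hz).blocks e₁ e₂ e₃ e₄ ?_ ?_ ?_ ?_ ?_ ?_ <;>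
  simp only [detRow, A₁, B₁, C₁, D₁, e₁, e₂, e₃, e₄, rmul, radd, rsub, rsmul] <;>
  apply req <;> ring1

theorem blocks₂ (h g z : ℂ) :
    BlockPoint h g (A₂ h g z) (B₂ h g z) (C₂ h g z) (D₂ h g z) (U h g) := by
  refine (isGLPoint₂ h g z).blocks e₁ e₂ e₃ e₄ ?_ ?_ ?_ ?_ ?_ ?_ <;>
  simp only [detRow, A₂, B₂, C₂, D₂, e₁, e₂, e₃, e₄, rmul, radd, rsub, rsmul] <;>
  apply req <;> ring1

theorem blocks₃ (h g z : ℂ) (hz : z ≠ -1) :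
    BlockPoint h g (A₃ h g z) (B₃ h g) C₃ (D₃ h g z) (E₃ h g z) := by
  refine (isGLPoint₃ h g z hz).blocks e₁ e₂ e₃ e₄ ?_ ?_ ?_ ?_ ?_ ?_ <;>
  simp only [detRow, A₃, B₃, C₃, D₃, e₁, e₂, e₃, e₄, rmul, radd, rsub, rsmul, zero4] <;>
  apply req <;> ring1

end Jordanian

namespace Woronowicz
variable {A : Type} [Ring A] [HopfAlgebra ℂ A] {I : Type} [Fintype I] [DecidableEq I]

/-- The functionals `x ↦ f_{ij} ⋆ x` as an algebra map into matrices over `A`. -/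
def starLeftHom (f : A →ₐ[ℂ] Matrix I I ℂ) : A →ₐ[ℂ] Matrix I I A :=
  (matrixEquivTensor I ℂ A).symm.toAlgHom.comp
    ((Algebra.TensorProduct.map (AlgHom.id ℂ A) f).comp (Bialgebra.comulAlgHom ℂ A))

def starRightHom (f : A →ₐ[ℂ] Matrix I I ℂ) : A →ₐ[ℂ] Matrix I I A :=
  (matrixEquivTensor I ℂ A).symm.toAlgHom.comp
    ((Algebra.TensorProduct.comm ℂ (Matrix I I ℂ) A).toAlgHom.comp
      ((Algebra.TensorProduct.map f (AlgHom.id ℂ A)).comp (Bialgebra.comulAlgHom ℂ A)))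

theorem starLeftHom_apply (f : A →ₐ[ℂ] Matrix I I ℂ) (x : A) (i j : I) :
    starLeftHom f x i j = starLeft (entry f i j) x := by
  simp only [starLeftHom, starLeft, AlgHom.comp_apply, LinearMap.comp_apply,
    Bialgebra.comulAlgHom_apply]
  induction Coalgebra.comul (R := ℂ) x with
  | zero => simp
  | add x y hx hy => simp only [map_add, Matrix.add_apply, hx, hy]
  | tmul x y => simp [entry, matrixEquivTensor_apply_symm, Algebra.smul_def, Algebra.commutes]

theorem starRightHom_apply (f : A →ₐ[ℂ] Matrix I I ℂ) (x : A) (i j : I) :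
    starRightHom f x i j = starRight (entry f i j) x := by
  simp only [starRightHom, starRight, AlgHom.comp_apply, LinearMap.comp_apply,
    Bialgebra.comulAlgHom_apply]
  induction Coalgebra.comul (R := ℂ) x with
  | zero => simp
  | add x y hx hy => simp only [map_add, Matrix.add_apply, hx, hy]
  | tmul x y => simp [entry, matrixEquivTensor_apply_symm, Algebra.smul_def, Algebra.commutes]

end Woronowicz
namespace Jordanian
open Woronowicz

namespace GLhg
variable {h g : ℂ}

theorem comul_T (m n : Fin 2) :
    Coalgebra.comul (R := ℂ) (T h g m n) = ∑ l, T h g m l ⊗ₜ[ℂ] T h g l n := by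
  have ca : Coalgebra.comul (R := ℂ) (gen h g .a) = _ := lift_a isGLPoint_comul
  have cb : Coalgebra.comul (R := ℂ) (gen h g .b) = _ := lift_b isGLPoint_comul
  have cc : Coalgebra.comul (R := ℂ) (gen h g .c) = _ := lift_c isGLPoint_comul
  have cd : Coalgebra.comul (R := ℂ) (gen h g .d) = _ := lift_d isGLPoint_comul
  fin_cases m <;> fin_cases n <;> simp [T, Fin.sum_univ_two, ca, cb, cc, cd]

theorem compat_of_gen {I : Type} [Fintype I] [DecidableEq I] (f : GLhg h g →ₐ[ℂ] Matrix I I ℂ)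
    (v : Matrix I I (GLhg h g))
    (H : ∀ m n i k, ∑ j, ∑ l, f (T h g m l) j k • (v j i * T h g l n) =
      ∑ j, ∑ l, f (T h g l n) i j • (T h g m l * v k j)) (x : GLhg h g) :
    v.transpose * starRightHom f x = starLeftHom f x * v.transpose := by
  have hmul : ∀ x y : GLhg h g,
      v.transpose * starRightHom f x = starLeftHom f x * v.transpose →
      v.transpose * starRightHom f y = starLeftHom f y * v.transpose →
      v.transpose * starRightHom f (x * y) =
        starLeftHom f (x * y) * v.transpose := by
    intro x y hx hy
    rw [map_mul, map_mul, ← mul_assoc, hx, mul_assoc, hy, mul_assoc]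
  have hadd : ∀ x y : GLhg h g,
      v.transpose * starRightHom f x = starLeftHom f x * v.transpose →
      v.transpose * starRightHom f y = starLeftHom f y * v.transpose →
      v.transpose * starRightHom f (x + y) =
        starLeftHom f (x + y) * v.transpose := by
    intro x y hx hy
    rw [map_add, map_add, mul_add, add_mul, hx, hy]
  have hsmul : ∀ (r : ℂ) (x : GLhg h g),
      v.transpose * starRightHom f x = starLeftHom f x * v.transpose →
      v.transpose * starRightHom f (r • x) =
        starLeftHom f (r • x) * v.transpose := by
    intro r x hx
    rw [map_smul, map_smul, mul_smul_comm, hx, smul_mul_assoc]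
  have hT : ∀ m n, v.transpose * starRightHom f (T h g m n) =
      starLeftHom f (T h g m n) * v.transpose := by
    have hc := comul_T (h := h) (g := g)
    intro m n
    ext i k
    refine Eq.trans ?_ ((H m n i k).trans ?_)
    · simp [Matrix.mul_apply, starRightHom_apply, starRight, hc, entry, Finset.mul_sum, mul_add]
    · simp [Matrix.mul_apply, starLeftHom_apply, starLeft, hc, entry, Finset.sum_mul, add_mul]
  induction x using GLhg.induction with
  | hmap r =>
    rw [AlgHom.commutes, AlgHom.commutes, Algebra.commutes]
  | hadd x y hx hy => exact hadd x y hx hy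
  | hmul x y hx hy => exact hmul x y hx hy
  | hgen t =>
    rcases t with _ | _ | _ | _ | _
    · exact hT 0 0
    · exact hT 0 1
    · exact hT 1 0
    · exact hT 1 1
    · obtain ⟨D, hD, hDe, heD⟩ : ∃ D : GLhg h g,
          (v.transpose * starRightHom f D = starLeftHom f D * v.transpose) ∧
          D * gen h g .detInv = 1 ∧ gen h g .detInv * D = 1 := by
        refine ⟨_, ?_, isGLPoint_gen.det_e, isGLPoint_gen.e_det⟩
        rw [sub_eq_add_neg, ← neg_one_smul ℂ]
        exact hadd _ _ (hadd _ _ (hmul _ _ (hT 0 0) (hT 1 1)) (hsmul _ _ (hmul _ _ (hT 0 1) (hT 1 0))))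
          (hsmul _ _ (hmul _ _ (hT 0 0) (hT 1 0)))
      generalize gen h g .detInv = e at *
      calc v.transpose * starRightHom f e
          = starLeftHom f e * (starLeftHom f D * v.transpose) * starRightHom f e := by
            rw [← mul_assoc (starLeftHom f e), ← map_mul, heD, map_one, one_mul]
        _ = starLeftHom f e * v.transpose := by
            rw [← hD, mul_assoc, mul_assoc, ← map_mul, hDe, map_one, mul_one]


theorem counit_T (m n : Fin 2) : Coalgebra.counit (R := ℂ) (T h g m n) = if m = n then 1 else 0 := by
  have ca : Coalgebra.counit (R := ℂ) (gen h g .a) = _ := lift_a isGLPoint_counit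
  have cb : Coalgebra.counit (R := ℂ) (gen h g .b) = _ := lift_b isGLPoint_counit
  have cc : Coalgebra.counit (R := ℂ) (gen h g .c) = _ := lift_c isGLPoint_counit
  have cd : Coalgebra.counit (R := ℂ) (gen h g .d) = _ := lift_d isGLPoint_counit
  fin_cases m <;> fin_cases n <;> simp [T, ca, cb, cc, cd]

section Calculus
variable {A B C D E : Matrix (Fin 4) (Fin 4) ℂ}

/-- The functionals `χ_j` with `dx = ∑ (χ_j ⋆ x) θ_j`. -/
def chi (HB : BlockPoint h g A B C D E) (j : Fin 4) : GLhg h g →ₗ[ℂ] ℂ := entry (lift HB) (Sum.inl 0) (Sum.inr j)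

theorem lift_blocks (H : IsGLPoint h g A B C D E)
    (HB : BlockPoint h g A B C D E) (x : GLhg h g) : lift HB x = Matrix.fromBlocks
    (Matrix.of fun _ _ => Coalgebra.counit (R := ℂ) x) (Matrix.of fun _ j => chi HB j x) 0
    (lift H x) := by
  suffices h : ∃ r : Matrix (Fin 1) (Fin 4) ℂ, lift HB x = Matrix.fromBlocks
      (Coalgebra.counit (R := ℂ) x • 1) r 0 (lift H x) by
    obtain ⟨r, hr⟩ := h
    have : Matrix.of (fun _ j => chi HB j x) = r := by
      ext i j
      obtain rfl := Subsingleton.elim i 0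
      simp [chi, entry, hr]
    rw [this, hr]
    congr 1
    ext i j
    simp [Subsingleton.elim i j]
  induction x using GLhg.induction with
  | hmap r =>
    refine ⟨0, ?_⟩
    rw [AlgHom.commutes, AlgHom.commutes, Bialgebra.counit_algebraMap,
      Algebra.algebraMap_eq_smul_one, Algebra.algebraMap_eq_smul_one, ← Matrix.fromBlocks_one,
      Matrix.fromBlocks_smul]
    simp
  | hadd x y hx hy =>
    obtain ⟨r, hr⟩ := hx
    obtain ⟨s, hs⟩ := hy
    exact ⟨r + s, by simp [hr, hs, Matrix.fromBlocks_add, add_smul]⟩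
  | hmul x y hx hy =>
    obtain ⟨r, hr⟩ := hx
    obtain ⟨s, hs⟩ := hy
    refine ⟨Coalgebra.counit (R := ℂ) x • s + r * lift H y, ?_⟩
    rw [map_mul, hr, hs, Matrix.fromBlocks_multiply, Bialgebra.counit_mul, map_mul]
    simp [mul_smul, smul_comm (Coalgebra.counit (R := ℂ) x)]
  | hgen t =>
    have ca : Coalgebra.counit (R := ℂ) (gen h g .a) = _ := lift_a isGLPoint_counit
    have cb : Coalgebra.counit (R := ℂ) (gen h g .b) = _ := lift_b isGLPoint_counit
    have cc : Coalgebra.counit (R := ℂ) (gen h g .c) = _ := lift_c isGLPoint_counit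
    have cd : Coalgebra.counit (R := ℂ) (gen h g .d) = _ := lift_d isGLPoint_counit
    have ce : Coalgebra.counit (R := ℂ) (gen h g .detInv) = _ := lift_detInv isGLPoint_counit
    rcases t with _ | _ | _ | _ | _
    · exact ⟨_, by rw [lift_a, lift_a, ca, one_smul]⟩
    · exact ⟨_, by rw [lift_b, lift_b, cb, zero_smul]⟩
    · exact ⟨_, by rw [lift_c, lift_c, cc, zero_smul]⟩
    · exact ⟨_, by rw [lift_d, lift_d, cd, one_smul]⟩
    · exact ⟨_, by rw [lift_detInv, lift_detInv, ce, one_smul]⟩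

theorem chi_T (HB : BlockPoint h g A B C D E) (m n : Fin 2) (j : Fin 4) :
    chi HB j (T h g m n) = if j = finProdFinEquiv (m, n) then 1 else 0 := by
  fin_cases m <;> fin_cases n <;> fin_cases j <;>
    simp [chi, entry, T, finProdFinEquiv, e₁, e₂, e₃, e₄]

/-- The bicovariant calculus with `da = aθ₁ + bθ₃`, `db = aθ₂ + bθ₄`, `dc = cθ₁ + dθ₃`,
`dd = cθ₂ + dθ₄` and `θ_i T_{pq} = ∑ f(T_{rq})_{ij} T_{pr} θ_j`. -/
def mkCalculus (H : IsGLPoint h g A B C D E) (HB : BlockPoint h g A B C D E)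
    (HC : CompatGen h g (arr A B C D)) : BicovariantCalculus (GLhg h g) (Fin 4) where
  f := lift H
  v := vMat h g
  comul_v := comul_vMat
  counit_v := counit_vMat
  compat := by
    intro x i k
    have := compat_of_gen (lift H) (vMat h g) (by
      have hf : ∀ m n, lift H (T h g m n) = arr A B C D m n := by
        intro m n
        fin_cases m <;> fin_cases n
        exacts [lift_a H, lift_b H, lift_c H, lift_d H]
      intro m n i k
      simp only [hf]
      exact HC m n i k) x
    simpa only [Matrix.mul_apply, Matrix.transpose_apply, starLeftHom_apply, starRightHom_apply]
      using congrFun (congrFun this i) k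
  χ := chi HB
  χ_mul := by
    intro i x y
    have := congrFun (congrFun (map_mul (lift HB) x y) (Sum.inl 0)) (Sum.inr i)
    rw [lift_blocks H HB, lift_blocks H HB, lift_blocks H HB, Matrix.fromBlocks_multiply] at this
    simpa [Matrix.mul_apply, add_comm] using this
  χ_right := by
    intro j x
    have hf : ∀ m n, lift H (T h g m n) = arr A B C D m n := by
      intro m n
      fin_cases m <;> fin_cases n
      exacts [lift_a H, lift_b H, lift_c H, lift_d H]
    have := compat_of_gen (lift HB) (Matrix.fromBlocks (1 : Matrix (Fin 1) (Fin 1) (GLhg h g)) 0 0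
      (vMat h g)) (by
        rintro m n (i | i) (k | k)
        · obtain rfl := Subsingleton.elim i 0
          obtain rfl := Subsingleton.elim k 0
          simp only [lift_blocks H HB, Fintype.sum_sum_type]
          fin_cases m <;> fin_cases n <;> simp [counit_T]
        · obtain rfl := Subsingleton.elim i 0
          obtain ⟨⟨s, t⟩, rfl⟩ := (finProdFinEquiv (m := 2) (n := 2)).surjective k
          have key := congrArg (fun y => y * T h g t n) (T_antipode (h := h) (g := g) m s)
          simp only [Fin.sum_univ_two, add_mul, mul_assoc, ← vMat_apply] at key
          simp only [lift_blocks H HB, Fintype.sum_sum_type]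
          simp [chi_T, Finset.sum_add_distrib]
          refine Eq.trans ?_ key.symm
          fin_cases m <;> fin_cases t <;> fin_cases s <;> simp
        · simp [lift_blocks H HB]
        · simp only [lift_blocks H HB, Fintype.sum_sum_type]
          simpa [hf] using! HC m n i k) x
    have h2 := congrFun (congrFun this (Sum.inl 0)) (Sum.inr j)
    rw [Matrix.fromBlocks_transpose] at h2
    simp only [Matrix.mul_apply, Fintype.sum_sum_type, starLeftHom_apply, starRightHom_apply] at h2
    simpa [chi] using h2.symm
  χ_span := by
    intro i
    obtain ⟨⟨m, n⟩, rfl⟩ := (finProdFinEquiv (m := 2) (n := 2)).surjective i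
    exact ⟨T h g m n, fun j => by rw [chi_T]; simp only [eq_comm]⟩

end Calculus

end GLhg

open GLhg

theorem compatGen₁ (h g z : ℂ) :
    CompatGen h g (arr (A₁ h g z) (B₁ h g z) (C₁ z) (D₁ h g z)) := by
  rw [arr₁]
  exact (compatGen_F₀.smul _).add (compatGen_wRow.smul _)

theorem compatGen₂ (h g z : ℂ) :
    CompatGen h g (arr (A₂ h g z) (B₂ h g z) (C₂ h g z) (D₂ h g z)) := by
  rw [arr₂]
  exact compatGen_F₀.add (compatGen_wVec.smul _)

theorem compatGen₃ (h g z : ℂ) :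
    CompatGen h g (arr (A₃ h g z) (B₃ h g) C₃ (D₃ h g z)) := by
  rw [arr₃]
  exact compatGen_F₀.add (compatGen_tau_rho.smul _)

/-- The first family `Γ₁`. -/
def calculus₁ (h g z : ℂ) (hz : z ≠ -1) : BicovariantCalculus (GLhg h g) (Fin 4) :=
  mkCalculus (isGLPoint₁ h g z hz) (blocks₁ h g z hz) (compatGen₁ h g z)

/-- The second family `Γ₂`. -/
def calculus₂ (h g z : ℂ) : BicovariantCalculus (GLhg h g) (Fin 4) :=
  mkCalculus (isGLPoint₂ h g z) (blocks₂ h g z) (compatGen₂ h g z)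

/-- The third family `Γ₃`. -/
def calculus₃ (h g z : ℂ) (hz : z ≠ -1) : BicovariantCalculus (GLhg h g) (Fin 4) :=
  mkCalculus (isGLPoint₃ h g z hz) (blocks₃ h g z hz) (compatGen₃ h g z)

end Jordanian

namespace Woronowicz
variable {A : Type} [Ring A] [HopfAlgebra ℂ A] {I : Type} [Fintype I] [DecidableEq I]
namespace BicovariantCalculus
variable (Γ : BicovariantCalculus A I)

/-- The differential `dx = ∑ (χ_j ⋆ x) θ_j`. -/
def d : A →ₗ[ℂ] (I → A) := LinearMap.pi fun j => starLeft (Γ.χ j)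

theorem leibniz (x y : A) : Γ.d (x * y) = Γ.rightMul (Γ.d x) y + x • Γ.d y := by
  have key : ∀ (P Q : A ⊗[ℂ] A) (j : I),
      TensorProduct.rid ℂ A ((Γ.χ j).lTensor A (P * Q)) =
      ∑ i, TensorProduct.rid ℂ A ((Γ.χ i).lTensor A P) *
        TensorProduct.rid ℂ A ((entry Γ.f i j).lTensor A Q) +
      TensorProduct.rid ℂ A (Coalgebra.counit.lTensor A P) *
        TensorProduct.rid ℂ A ((Γ.χ j).lTensor A Q) := by
    intro P Q j
    induction P with
    | zero => simp
    | add x y hx hy =>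
      simp only [add_mul, map_add, hx, hy, Finset.sum_add_distrib]
      abel
    | tmul x y =>
      induction Q with
      | zero => simp
      | add z w hz hw =>
        simp only [mul_add, map_add, hz, hw, Finset.sum_add_distrib]
        abel
      | tmul z w =>
        simp only [Algebra.TensorProduct.tmul_mul_tmul, LinearMap.lTensor_tmul,
          TensorProduct.rid_tmul, Γ.χ_mul, add_smul, Finset.sum_smul, smul_mul_smul_comm]
        rfl
  funext j
  have h := key (Coalgebra.comul x) (Coalgebra.comul y) j
  rw [← Bialgebra.comul_mul, Coalgebra.lTensor_counit_comul, TensorProduct.rid_tmul, one_smul] at h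
  exact h

end BicovariantCalculus
end Woronowicz

namespace Jordanian
open Woronowicz
namespace GLhg

theorem d_T {h g : ℂ} {A B C D E : Matrix (Fin 4) (Fin 4) ℂ} (H : IsGLPoint h g A B C D E)
    (HB : BlockPoint h g A B C D E) (HC : CompatGen h g (arr A B C D)) (m n : Fin 2) :
    (mkCalculus H HB HC).d (T h g m n) =
      ∑ l, T h g m l • Pi.single (finProdFinEquiv (l, n) : Fin 4) 1 := by
  have hc := comul_T (h := h) (g := g) m n
  funext j
  change starLeft (chi HB j) (T h g m n) = _
  simp only [starLeft, LinearMap.comp_apply, hc, map_sum, LinearMap.lTensor_tmul, chi_T,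
    LinearEquiv.coe_coe, TensorProduct.rid_tmul, Finset.sum_apply, Pi.smul_apply, Pi.single_apply]
  refine Finset.sum_congr rfl fun l _ => ?_
  split_ifs <;> simp

end GLhg
end Jordanian

namespace Jordanian
open Woronowicz GLhg

section Relations
variable {B : Type} [Ring B] [Algebra ℂ B]

/-- The ten mis-ordered products of `θ₁, θ₂, θ₃, θ₄` for the order `θ₂ ≺ θ₁ ≺ θ₄ ≺ θ₃`. -/
def misordered (θ : Fin 4 → B) : Fin 10 → B :=
  let θ₁ := θ 0; let θ₂ := θ 1; let θ₃ := θ 2; let θ₄ := θ 3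
  ![θ₃ * θ₃, θ₃ * θ₄, θ₃ * θ₁, θ₃ * θ₂, θ₄ * θ₄, θ₄ * θ₁, θ₄ * θ₂, θ₁ * θ₁, θ₁ * θ₂, θ₂ * θ₂]

/-- The right-hand sides of the commutation relations for the first family, in the order of
`misordered`. -/
def reordered₁ (h g z : ℂ) (θ : Fin 4 → B) : Fin 10 → B :=
  let θ₁ := θ 0; let θ₂ := θ 1; let θ₃ := θ 2; let θ₄ := θ 3
  ![0,
    -((2 * z + 1) / (z + 1)) • (θ₄ * θ₃) + (z / (z + 1)) • (θ₁ * θ₃),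
    -(1 / (z + 1)) • (θ₁ * θ₃) - (z / (z + 1)) • (θ₄ * θ₃),
    -(θ₂ * θ₃) + (h + g) • (θ₁ * θ₃) - (h + g) • (θ₄ * θ₃),
    (z / (z + 1)) • (θ₂ * θ₃) - (z * (h + g) / (z + 1)) • (θ₁ * θ₃)
      + (z * (h + g) / (z + 1)) • (θ₄ * θ₃),
    -(θ₁ * θ₄) - (z * (h + g) / (z + 1)) • (θ₁ * θ₃) + (z * (h + g) / (z + 1)) • (θ₄ * θ₃),
    -((2 * z + 1) / (z + 1)) • (θ₂ * θ₄) + (z / (z + 1)) • (θ₂ * θ₁)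
      + ((2 * z + 1) * (h + g) / (z + 1)) • (θ₂ * θ₃)
      - ((h + g) ^ 2) • (θ₁ * θ₃) + ((h + g) ^ 2) • (θ₄ * θ₃),
    -(z / (z + 1)) • (θ₂ * θ₃),
    -(1 / (z + 1)) • (θ₂ * θ₁) - (z / (z + 1)) • (θ₂ * θ₄) - ((h + g) / (z + 1)) • (θ₂ * θ₃),
    (h + g) • (θ₂ * θ₁) - (h + g) • (θ₂ * θ₄) + ((h + g) ^ 2) • (θ₂ * θ₃)]

/-- The right-hand sides of the commutation relations for the second and the third family, in the
order of `misordered`. -/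
def reordered₂₃ (h g : ℂ) (θ : Fin 4 → B) : Fin 10 → B :=
  let θ₁ := θ 0; let θ₂ := θ 1; let θ₃ := θ 2; let θ₄ := θ 3
  ![0,
    -(θ₄ * θ₃),
    -(θ₁ * θ₃),
    -(θ₂ * θ₃) + (h + g) • (θ₁ * θ₃) - (h + g) • (θ₄ * θ₃),
    0,
    -(θ₁ * θ₄),
    -(θ₂ * θ₄) + (h + g) • (θ₂ * θ₃) - ((h + g) ^ 2) • (θ₁ * θ₃) + ((h + g) ^ 2) • (θ₄ * θ₃),
    0,
    -(θ₂ * θ₁) - (h + g) • (θ₂ * θ₃),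
    (h + g) • (θ₂ * θ₁) - (h + g) • (θ₂ * θ₄) + ((h + g) ^ 2) • (θ₂ * θ₃)]

/-- The ordered monomial `θ₂^α θ₁^β θ₄^γ θ₃^δ`, where `ε = (α, β, γ, δ)`. -/
def orderedMonomial (θ : Fin 4 → B) (ε : Fin 4 → Fin 2) : B :=
  let θ₁ := θ 0; let θ₂ := θ 1; let θ₃ := θ 2; let θ₄ := θ 3
  θ₂ ^ (ε 0 : ℕ) * θ₁ ^ (ε 1 : ℕ) * θ₄ ^ (ε 2 : ℕ) * θ₃ ^ (ε 3 : ℕ)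

/-- The bi-invariant form `Tr_h Θ = θ₁ + (h + g) θ₃ + θ₄`. -/
def traceForm (h g : ℂ) (θ : Fin 4 → B) : B :=
  let θ₁ := θ 0; let θ₃ := θ 2; let θ₄ := θ 3
  θ₁ + (h + g) • θ₃ + θ₄

/-- The entries of `Θ ∧ Θ` for `Θ = (θ₁, θ₂; θ₃, θ₄)`; by the Maurer–Cartan equation
`dθ_i = -(Θ ∧ Θ)_i`. -/
def thetaSq (θ : Fin 4 → B) : Fin 4 → B :=
  let θ₁ := θ 0; let θ₂ := θ 1; let θ₃ := θ 2; let θ₄ := θ 3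
  ![θ₁ * θ₁ + θ₂ * θ₃, θ₁ * θ₂ + θ₂ * θ₄, θ₃ * θ₁ + θ₄ * θ₃, θ₃ * θ₂ + θ₄ * θ₄]

end Relations

/-- The form `θ₁ + (h + g) θ₃ + θ₄` is right-invariant. -/
theorem coactRight_trace {h g : ℂ} (Γ : BicovariantBimodule (GLhg h g) (Fin 4))
    (hΓ : Γ.v = vMat h g) :
    Γ.coactRight (fun k => (![1, 0, h + g, 1] : Fin 4 → ℂ) k • (1 : GLhg h g)) =
      (fun k => (![1, 0, h + g, 1] : Fin 4 → ℂ) k • (1 : GLhg h g)) ⊗ₜ[ℂ] 1 := by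
  have key : ∀ i, ∑ j, rho h g j • vMat h g i j = rho h g i • 1 := rho_vMat
  change Γ.coactRight (fun k => rho h g k • (1 : GLhg h g)) =
      (fun k => rho h g k • (1 : GLhg h g)) ⊗ₜ[ℂ] 1
  have h1 : Γ.coactRight (fun k => rho h g k • (1 : GLhg h g)) =
      ∑ j, (LinearMap.single ℂ (fun _ => GLhg h g) j 1) ⊗ₜ[ℂ] ∑ i, rho h g i • vMat h g j i := by
    simp only [BicovariantBimodule.coactRight, LinearMap.sum_apply, LinearMap.comp_apply,
      LinearMap.proj_apply, map_smul, Bialgebra.comul_one, LinearMap.mulRight_apply, one_mul, hΓ,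
      LinearMap.rTensor_tmul, TensorProduct.tmul_sum, TensorProduct.tmul_smul]
    rw [Finset.sum_comm]
  rw [h1]
  simp only [key, TensorProduct.tmul_smul, TensorProduct.smul_tmul', ← TensorProduct.sum_tmul]
  congr 1
  ext j
  simp [Pi.single_apply]

section Presentation
open BicovariantBimodule
variable (h g : ℂ) (Γ : BicovariantBimodule (GLhg h g) (Fin 4))

/-- What is asserted of ten homogeneous quadratic relations `rel k = 0` in the external algebra
of `Γ`. -/
structure IsWedgePresentation (rel : Fin 10 → Γ.TensorAlg) : Prop where
  /-- They generate all relations: the kernel of `Γ^⊗ → Ω` is the two-sided ideal they span. -/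
  complete : ∀ ω : Γ.TensorAlg,
    ExteriorAlg.proj Γ ω = 0 ↔ ω ∈ TwoSidedIdeal.span (Set.range rel)
  /-- Consistency with the bimodule relations: an element of `A` is moved from the right to the
  left of the relations without producing any new relation. -/
  bimodule : ∀ (k : Fin 10) (x : GLhg h g), ∃ c : Fin 10 → GLhg h g,
    rel k * TensorAlg.coeff Γ x = ∑ l, TensorAlg.coeff Γ (c l) * rel l
  /-- Consistency with `Tr_h Θ ∧ Tr_h Θ = 0`: this is a consequence of the relations. -/
  trace : ∃ c : Fin 10 → ℂ,
    traceForm h g (TensorAlg.form Γ) * traceForm h g (TensorAlg.form Γ) =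
      ∑ l, c l • rel l
  /-- The ordered monomials are a basis of `Ω` as a left `A`-module. -/
  basis : ∀ ω : Γ.ExteriorAlg, ∃! c : (Fin 4 → Fin 2) → GLhg h g,
    ω = ∑ ε, ExteriorAlg.coeff Γ (c ε) * orderedMonomial (ExteriorAlg.form Γ) ε
  /-- The ordered monomials of degree `n` span the forms of degree `n`, so that these are a free
  module of rank `4.choose n`. -/
  graded : ∀ (n : ℕ) (t : (Fin n → Fin 4) → GLhg h g), ∃ c : (Fin 4 → Fin 2) → GLhg h g,
    (∀ ε, ∑ i, (ε i : ℕ) ≠ n → c ε = 0) ∧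
    ExteriorAlg.proj Γ (TensorAlg.incl Γ n t) =
      ∑ ε, ExteriorAlg.coeff Γ (c ε) * orderedMonomial (ExteriorAlg.form Γ) ε
  /-- The ordered monomials span the algebra of left-invariant forms over `ℂ`. -/
  invariant : Submodule.span ℂ (Set.range (orderedMonomial (ExteriorAlg.form Γ))) =
    Subalgebra.toSubmodule (Algebra.adjoin ℂ (Set.range (ExteriorAlg.form Γ)))

/-- The relations `misordered = reordered₁` in the tensor algebra, as elements to be set to zero. -/
def relators₁ (z : ℂ) : Fin 10 → Γ.TensorAlg := fun k =>
  misordered (TensorAlg.form Γ) k - reordered₁ h g z (TensorAlg.form Γ) k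

/-- The relations `misordered = reordered₂₃` in the tensor algebra, as elements to be set to
zero. -/
def relators₂₃ : Fin 10 → Γ.TensorAlg := fun k =>
  misordered (TensorAlg.form Γ) k - reordered₂₃ h g (TensorAlg.form Γ) k

end Presentation

/-- The bimodule of the first family. -/
abbrev Γ₁ (h g z : ℂ) (hz : z ≠ -1) : BicovariantBimodule (GLhg h g) (Fin 4) :=
  (calculus₁ h g z hz).toBicovariantBimodule

/-- The bimodule of the second family. -/
abbrev Γ₂ (h g z : ℂ) : BicovariantBimodule (GLhg h g) (Fin 4) :=
  (calculus₂ h g z).toBicovariantBimodule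

/-- The bimodule of the third family. -/
abbrev Γ₃ (h g z : ℂ) (hz : z ≠ -1) : BicovariantBimodule (GLhg h g) (Fin 4) :=
  (calculus₃ h g z hz).toBicovariantBimodule

end Jordanian

end

/-! Let `X` be the free left `A`-module on the sixteen ordered monomials. Explicit operators
`rightOp` and `leftOp` on `X` describe multiplication by the `θ_k` on either side, as the ten
relations prescribe it. Multiplying on the right one factor at a time gives every tensor of degree
`n` a normal form in `X`. Modulo the ten relations the tensor equals that normal form (`map_incl`),
so the point is to show that `ker W_n` has normal form zero.

This is done with braided derivatives `∂_t` on `X` obeying the twisted Leibniz rule `∂_t(x θ_k) =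
δ_{tk} x - ∑ Λ_{ik,jt} ∂_i(x) θ_j`. The antisymmetrizer factors as `W_{n+1} = W_n C_n`, with `W_n`
acting on the first `n` slots, and the coset sums satisfy `C_{m+1} = 1 - Λ_m C_m`. This is the
Leibniz recursion: the normal form of the `θ_k`-component of `C_n t` is `∂_k` of the normal form of
`t` (`normalForm_cosetSum`). If `W_{n+1} t = 0`, induction makes all derivatives of the normal form
vanish. The common kernel of the `∂_k` consists of constants, and a normal form of positive degree
has no constant term, so it is zero (`normalForm_eq_zero`). Hence `ker W_n` lies in the ideal of the
ten relations for every `n`. In degree two the argument reverses, so the relations themselves lie in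
`ker W_2`; together this is `proj_eq_zero_iff`. Since `Λ` is right `A`-linear, `ker W_2` is a
sub-bimodule, which gives consistency with the bimodule relations.

Spanning holds because the left span of the monomials is stable under right multiplication. For
independence, the tensor algebra acts on `X` from the left (`regularRep`). The relations act by
zero: they do so on vectors with scalar coordinates by `leftOp_relations`, and coefficients can be
moved through them. The action therefore kills the kernel of the projection to `Ω`, and applying `∑
c_i m_i` to the monomial `1` returns the coordinates `c_i`.

With `p = z / (z + 1)` for the first family, `p = 0` for the others, and `s = h + g`, the three
lists of relations become one. The braiding of `Γ₃` is that of `Γ₂` at `z = 0`, so two systems of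
derivatives suffice. What is particular to the families is a finite set of polynomial identities. -/

noncomputable section

namespace Jordanian

/-! ### Operators on normal forms: multiplications and braided derivatives. -/

section NormalForms

theorem forall_fin_four {P : Fin 4 → Prop} : (∀ i, P i) ↔ P 0 ∧ P 1 ∧ P 2 ∧ P 3 := by
  simp [Fin.forall_fin_succ]

theorem forall_fin_sixteen {P : Fin 16 → Prop} : (∀ i, P i) ↔
    P 0 ∧ P 1 ∧ P 2 ∧ P 3 ∧ P 4 ∧ P 5 ∧ P 6 ∧ P 7 ∧
    P 8 ∧ P 9 ∧ P 10 ∧ P 11 ∧ P 12 ∧ P 13 ∧ P 14 ∧ P 15 := by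
  simp [Fin.forall_fin_succ]

variable {M : Type*} [AddCommGroup M] [Module ℂ M]

theorem pi_sixteen {V : Type*} [AddCommGroup V] [Module ℂ V]
    (f₀ f₁ f₂ f₃ f₄ f₅ f₆ f₇ f₈ f₉ f₁₀ f₁₁ f₁₂ f₁₃ f₁₄ f₁₅ : V →ₗ[ℂ] M) (x : V) :
    LinearMap.pi ![f₀, f₁, f₂, f₃, f₄, f₅, f₆, f₇, f₈, f₉, f₁₀, f₁₁, f₁₂, f₁₃, f₁₄, f₁₅] x =
      ![f₀ x, f₁ x, f₂ x, f₃ x, f₄ x, f₅ x, f₆ x, f₇ x, f₈ x, f₉ x, f₁₀ x, f₁₁ x, f₁₂ x, f₁₃ x,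
        f₁₄ x, f₁₅ x] := by
  funext i
  revert i
  rw [forall_fin_sixteen]
  exact ⟨rfl, rfl, rfl, rfl, rfl, rfl, rfl, rfl, rfl, rfl, rfl, rfl, rfl, rfl, rfl, rfl⟩

/-- Right multiplication by `θ₁, …, θ₄` in normal form. -/
def rightOp (p s : ℂ) : Fin 4 → (Fin 16 → M) →ₗ[ℂ] (Fin 16 → M) :=
  let x : Fin 16 → (Fin 16 → M) →ₗ[ℂ] M := LinearMap.proj
  ![LinearMap.pi ![0, 0, x 0, x 1, 0, 0, -x 4, -x 5, 0, -p • x 2, -(s * p) • x 4 + (p - 1) • x 8,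
      -(s * p) • x 3 - (s * p) • x 5 + (p ^ 2) • x 6 + (p - 1) • x 9, (s * p) • x 4 - p • x 8,
      (s * p) • x 3 + (s * p) • x 5 - (p + p ^ 2) • x 6 - p • x 9,
      (s * p) • x 6 - p • x 10 + (1 - p) • x 12, -p • x 11 + (1 - p) • x 13],
    LinearMap.pi ![0, x 0, 0, s • x 1 + (p - 1) • x 2 + p • x 4, 0, -s • x 1 - p • x 2 - (1 + p) • x 4, 0,
      -s • x 3 - s • x 5 + x 6, 0, (s ^ 2) • x 1 + (s * p - s) • x 2 + (s + s * p) • x 4 - x 8,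
      -(s ^ 2) • x 4 + s • x 8,
      -(s ^ 2 * p) • x 3 - (s ^ 2 * p) • x 5 + (2 * s * p - s) • x 6 + (1 - p) • x 10 - p • x 12,
      (s ^ 2) • x 4 - s • x 8,
      (s ^ 2 + s ^ 2 * p) • x 3 + (s ^ 2 + s ^ 2 * p) • x 5 - (s + 2 * s * p) • x 6 + p • x 10 + (1 + p) • x 12,
      (s ^ 2) • x 6 - s • x 10 - s • x 12, -x 14],
    LinearMap.pi ![0, 0, 0, 0, 0, 0, 0, 0, x 0, x 1, x 2, x 3, x 4, x 5, x 6, x 7],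
    LinearMap.pi ![0, 0, 0, 0, x 0, x 1, x 2, x 3, 0, p • x 4, -(s * p) • x 4 + p • x 8,
      (p ^ 2 - p) • x 6 + p • x 9, (s * p) • x 4 - (1 + p) • x 8,
      -(p ^ 2) • x 6 - (1 + p) • x 9, (s * p) • x 6 - (1 + p) • x 10 - p • x 12,
      -(1 + p) • x 11 - p • x 13]]

/-- Left multiplication by `θ₁, …, θ₄` in normal form. -/
def leftOp (p s : ℂ) : Fin 4 → (Fin 16 → M) →ₗ[ℂ] (Fin 16 → M) :=
  let x : Fin 16 → (Fin 16 → M) →ₗ[ℂ] M := LinearMap.proj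
  ![LinearMap.pi ![0, 0, x 0, (p - 1) • x 1, 0, -p • x 1, x 4, p • x 3 + (p - 1) • x 5, 0,
      (s * p - s) • x 1 - p • x 2, x 8,
      (s + s * p ^ 2 - s * p) • x 3 + (s * p ^ 2 - s * p) • x 5 - (p ^ 2) • x 6 + (p - 1) • x 9,
      0, -(s * p ^ 2) • x 3 + (s - s * p ^ 2) • x 5 + (p + p ^ 2) • x 6 - p • x 9, x 12,
      -s • x 7 + p • x 11 + (p - 1) • x 13],
    LinearMap.pi ![0, x 0, 0, s • x 1 + x 2, 0, -s • x 1 + x 4, 0, s • x 3 + s • x 5 + x 6, 0,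
      (s ^ 2) • x 1 + x 8, 0, (s ^ 2 * p - s ^ 2) • x 3 + (s ^ 2 * p) • x 5 + s • x 9 + x 10,
      0, -(s ^ 2 * p) • x 3 - (s ^ 2 + s ^ 2 * p) • x 5 - s • x 9 + x 12, 0,
      (s ^ 2) • x 7 + s • x 11 + s • x 13 + x 14],
    LinearMap.pi ![0, 0, 0, 0, 0, 0, 0, 0, x 0, -x 1, s • x 1 + (p - 1) • x 2 + p • x 4,
      (1 - p) • x 3 - p • x 5, -s • x 1 - p • x 2 - (1 + p) • x 4, p • x 3 + (1 + p) • x 5,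
      -s • x 3 - s • x 5 + x 6, -x 7],
    LinearMap.pi ![0, 0, 0, p • x 1, x 0, -(1 + p) • x 1, -x 2, (1 + p) • x 3 + p • x 5, 0,
      (s + s * p) • x 1 + p • x 4, -(s ^ 2) • x 1 - (s * p) • x 2 - (s * p) • x 4,
      (s * p + s * p ^ 2 - s) • x 3 + (s * p + s * p ^ 2) • x 5 + (p - p ^ 2) • x 6 + p • x 9,
      (s ^ 2) • x 1 + (s * p) • x 2 + (s * p) • x 4 + x 8,
      -(2 * s * p + s * p ^ 2) • x 3 - (s + 2 * s * p + s * p ^ 2) • x 5 + (p ^ 2) • x 6 - (1 + p) • x 9,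
      (s ^ 2) • x 3 + (s ^ 2) • x 5 - x 10, s • x 7 + (1 + p) • x 11 + p • x 13]]

/-- The braided derivatives of the first family. -/
def derivOp₁ (p s : ℂ) : Fin 4 → (Fin 16 → M) →ₗ[ℂ] (Fin 16 → M) :=
  let x : Fin 16 → (Fin 16 → M) →ₗ[ℂ] M := LinearMap.proj
  ![LinearMap.pi ![x 2, x 3, 0, 0, -x 6, -x 7, 0, 0, (s ^ 2) • x 3 - s • x 9 - (1 + p) • x 10 - p • x 12,
      -(1 + p) • x 11 - p • x 13, -(s ^ 2 * p) • x 7 + s • x 11 - p • x 14, -p • x 15,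
      (s ^ 2 + s ^ 2 * p) • x 7 + s • x 13 + (1 + p) • x 14, (1 + p) • x 15, -s • x 15, 0],
    LinearMap.pi ![x 1, 0, -x 3, 0, -x 5, 0, x 7, 0, s • x 3 - s • x 5 - p • x 6 - x 9, -p • x 7,
      (s - s * p) • x 7 + x 11, 0, (s + s * p) • x 7 + x 13, 0, -x 15, 0],
    LinearMap.pi ![x 8, p • x 6 + x 9, -(s * p) • x 6 + (1 + p) • x 10 + p • x 12,
      (1 + p) • x 11 + p • x 13, (s * p) • x 6 - p • x 10 + (1 - p) • x 12,
      -p • x 11 + (1 - p) • x 13, x 14, x 15,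
      -(s ^ 3) • x 3 - (s ^ 2 + s ^ 2 * p) • x 6 + (s ^ 2) • x 9 + (s + 2 * s * p) • x 10 + (2 * s * p - s) • x 12,
      -(s ^ 2) • x 7 + (s + 2 * s * p) • x 11 + (2 * s * p - s) • x 13 - p • x 14,
      (s ^ 3 * p) • x 7 - (s ^ 2) • x 11 + (3 * s * p - s) • x 14, (2 * s * p - s) • x 15,
      -(s ^ 3 + s ^ 3 * p) • x 7 - (s ^ 2) • x 13 - (s + 3 * s * p) • x 14,
      -(s + 2 * s * p) • x 15, (s ^ 2) • x 15, 0],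
    LinearMap.pi ![x 4, x 5, x 6, x 7, 0, 0, 0, 0, -(s ^ 2) • x 3 + s • x 9 + p • x 10 + (p - 1) • x 12,
      p • x 11 + (p - 1) • x 13, (s ^ 2 * p) • x 7 - s • x 11 + (p - 1) • x 14, (p - 1) • x 15,
      -(s ^ 2 + s ^ 2 * p) • x 7 - s • x 13 - p • x 14, -p • x 15, s • x 15, 0]]

/-- The braided derivatives of the second family. -/
def derivOp₂ (z s : ℂ) : Fin 4 → (Fin 16 → M) →ₗ[ℂ] (Fin 16 → M) :=
  let x : Fin 16 → (Fin 16 → M) →ₗ[ℂ] M := LinearMap.proj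
  ![LinearMap.pi ![x 2, (1 - z) • x 3 + z • x 5, -(s * z) • x 3 + z • x 9, z • x 7,
      (s * z) • x 3 - x 6 - z • x 9, (z - 1) • x 7, (s * z) • x 7 + z • x 11 + z • x 13, 0,
      (s ^ 2 + s ^ 2 * z) • x 3 + (s * z) • x 6 - (s + s * z) • x 9 - (1 + z) • x 10 + z • x 12,
      (s * z) • x 7 - x 11, (s ^ 2 * z) • x 7 + (s + s * z) • x 11 + (s * z) • x 13 + z • x 14,
      0, (s ^ 2) • x 7 + s • x 13 + (1 + z) • x 14, x 15, -s • x 15, 0],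
    LinearMap.pi ![x 1, 0, -x 3, 0, -x 5, 0, x 7, 0, s • x 3 - s • x 5 - x 9, 0, s • x 7 + x 11, 0,
      s • x 7 + x 13, 0, -x 15, 0],
    LinearMap.pi ![x 8, -(s * z) • x 3 + (s * z) • x 5 + x 9, -(s ^ 2 * z) • x 3 + (s * z) • x 9 + x 10,
      (s * z) • x 7 + x 11, (s ^ 2 * z) • x 3 - (s * z) • x 9 + x 12, (s * z) • x 7 + x 13,
      (s ^ 2 * z) • x 7 + (s * z) • x 11 + (s * z) • x 13 + x 14, x 15,
      (s ^ 3 * z - s ^ 3) • x 3 + (s ^ 2 * z - s ^ 2) • x 6 + (s ^ 2 - s ^ 2 * z) • x 9 + (s - s * z) • x 10 + (s * z - s) • x 12,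
      (s ^ 2 * z - s ^ 2) • x 7 + s • x 11 - s • x 13,
      (s ^ 3 * z) • x 7 + (s ^ 2 * z - s ^ 2) • x 11 + (s ^ 2 * z) • x 13 + (s * z - s) • x 14,
      -s • x 15, -(s ^ 3) • x 7 - (s ^ 2) • x 13 + (s * z - s) • x 14, -s • x 15,
      (s ^ 2) • x 15, 0],
    LinearMap.pi ![x 4, -z • x 3 + (1 + z) • x 5, -(s * z) • x 3 + x 6 + z • x 9, (1 + z) • x 7,
      (s * z) • x 3 - z • x 9, z • x 7, (s * z) • x 7 + z • x 11 + z • x 13, 0,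
      (s ^ 2 * z - s ^ 2) • x 3 + (s * z) • x 6 + (s - s * z) • x 9 - z • x 10 + (z - 1) • x 12,
      (s * z) • x 7 - x 13,
      (s ^ 2 * z) • x 7 + (s * z - s) • x 11 + (s * z) • x 13 + (z - 1) • x 14, -x 15,
      -(s ^ 2) • x 7 - s • x 13 + z • x 14, 0, s • x 15, 0]]
/-- The values `f(v_{sk})` for the first family. -/
def braid₁ (p s : ℂ) : Fin 4 → Fin 4 → Matrix (Fin 4) (Fin 4) ℂ :=
  ![
    ![!![1, 0, 0, 0; 0, 1, 0, 0; 0, 0, 1, 0; 0, 0, 0, 1],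
      !![0, p, 0, 0; 0, s, 0, 0; 0, 0, -s, 0; 0, p, s ^ 2, 0],
      !![0, 0, -p, 0; 0, 0, 0, 0; 0, 0, 0, 0; 0, 0, -p, 0],
      !![0, 0, s * p, 0; 0, 0, 0, 0; 0, 0, 0, 0; 0, 0, s * p, 0]],
    ![!![0, 0, p, 0; 0, 0, 0, 0; 0, 0, 0, 0; 0, 0, p, 0],
      !![1 - p, 0, s - s * p, p; -s, 1, -s ^ 2, s; 0, 0, 1, 0; -p, 0, -s - s * p, 1 + p],
      !![0, 0, 0, 0; 0, 0, 0, 0; 0, 0, 0, 0; 0, 0, 0, 0],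
      !![0, 0, -p, 0; 0, 0, 0, 0; 0, 0, 0, 0; 0, 0, -p, 0]],
    ![!![-s * p, -p, s ^ 2 * p, s * p; -s ^ 2, -s, s ^ 3, s ^ 2; 0, 0, s, 0; -s * p, -p, s ^ 2 * p - s ^ 2, s * p],
      !![0, -s * p, 0, 0; 0, -s ^ 2, 0, 0; 0, 0, -s ^ 2, 0; 0, -s * p, s ^ 3, 0],
      !![1 + p, 0, -s - 2 * s * p, -p; s, 1, -s ^ 2, -s; 0, 0, 1, 0; p, 0, s - 2 * s * p, 1 - p],
      !![0, p, s ^ 2 + s ^ 2 * p, 0; 0, s, 0, 0; 0, 0, -s, 0; 0, p, s ^ 2 * p, 0]],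
    ![!![0, 0, 0, 0; 0, 0, 0, 0; 0, 0, 0, 0; 0, 0, 0, 0],
      !![0, -p, 0, 0; 0, -s, 0, 0; 0, 0, s, 0; 0, -p, -s ^ 2, 0],
      !![0, 0, p, 0; 0, 0, 0, 0; 0, 0, 0, 0; 0, 0, p, 0],
      !![1, 0, -s * p, 0; 0, 1, 0, 0; 0, 0, 1, 0; 0, 0, -s * p, 1]]]

/-- The values `f(v_{sk})` for the second family. -/
def braid₂ (z s : ℂ) : Fin 4 → Fin 4 → Matrix (Fin 4) (Fin 4) ℂ :=
  ![
    ![!![1, 0, 0, 0; s * z, 1, s ^ 2 * z, s * z; 0, 0, 1, 0; 0, 0, 0, 1],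
      !![0, 0, 0, 0; 0, s, 0, 0; z, 0, s * z - s, z; -s * z, 0, s ^ 2 - s ^ 2 * z, -s * z],
      !![0, 0, 0, 0; -z, 0, -s * z, -z; 0, 0, 0, 0; 0, 0, 0, 0],
      !![0, 0, 0, 0; 0, 0, 0, 0; 0, 0, 0, 0; 0, 0, 0, 0]],
    ![!![0, 0, 0, 0; z, 0, s * z, z; 0, 0, 0, 0; 0, 0, 0, 0],
      !![1 - z, 0, s - s * z, -z; 2 * s * z - s, 1, 2 * s ^ 2 * z - s ^ 2, s + 2 * s * z; 0, 0, 1, 0; z, 0, s * z - s, 1 + z],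
      !![0, 0, 0, 0; 0, 0, 0, 0; 0, 0, 0, 0; 0, 0, 0, 0],
      !![0, 0, 0, 0; -z, 0, -s * z, -z; 0, 0, 0, 0; 0, 0, 0, 0]],
    ![!![0, 0, 0, 0; -s ^ 2 - s ^ 2 * z, -s, s ^ 3 - s ^ 3 * z, s ^ 2 - s ^ 2 * z; -z, 0, s - s * z, -z; s * z, 0, s ^ 2 * z - s ^ 2, s * z],
      !![0, 0, 0, 0; 0, -s ^ 2, 0, 0; s * z, 0, s ^ 2 * z - s ^ 2, s * z; -s ^ 2 * z, 0, s ^ 3 - s ^ 3 * z, -s ^ 2 * z],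
      !![1 + z, 0, s * z - s, z; s + s * z, 1, s ^ 2 * z - s ^ 2, s * z - s; 0, 0, 1, 0; -z, 0, s - s * z, 1 - z],
      !![-s * z, 0, s ^ 2 - s ^ 2 * z, -s * z; 0, s, 0, 0; z, 0, s * z - s, z; 0, 0, 0, 0]],
    ![!![0, 0, 0, 0; -s * z, 0, -s ^ 2 * z, -s * z; 0, 0, 0, 0; 0, 0, 0, 0],
      !![0, 0, 0, 0; 0, -s, 0, 0; -z, 0, s - s * z, -z; s * z, 0, s ^ 2 * z - s ^ 2, s * z],
      !![0, 0, 0, 0; z, 0, s * z, z; 0, 0, 0, 0; 0, 0, 0, 0],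
      !![1, 0, 0, 0; 0, 1, 0, 0; 0, 0, 1, 0; 0, 0, 0, 1]]]

set_option maxHeartbeats 8000000 in
-- The twisted Leibniz rule, which is what ties the derivatives to the braiding. In each of the
-- sixteen coordinates it is a linear identity whose coefficients are polynomials in `p` and `s`, so
-- it holds over every coefficient module.
theorem derivOp₁_rightOp (p s : ℂ) (x : Fin 16 → M) (k t : Fin 4) :
    derivOp₁ p s t (rightOp p s k x) = (if t = k then x else 0) -
      ∑ i, ∑ j, braid₁ p s j k i t • rightOp p s j (derivOp₁ p s i x) := by
  revert k t
  simp only [forall_fin_four, Fin.sum_univ_four, Fin.reduceEq, if_true, if_false, reduceIte]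
  refine ⟨⟨?_, ?_, ?_, ?_⟩, ⟨?_, ?_, ?_, ?_⟩, ⟨?_, ?_, ?_, ?_⟩, ⟨?_, ?_, ?_, ?_⟩⟩ <;>
  · simp only [braid₁, Matrix.cons_val, Matrix.of_apply, zero_smul, add_zero, zero_add, one_smul]
    simp only [derivOp₁, rightOp, Matrix.cons_val, pi_sixteen, LinearMap.add_apply,
      LinearMap.sub_apply, LinearMap.neg_apply, LinearMap.smul_apply, LinearMap.zero_apply,
      LinearMap.proj_apply]
    funext i
    revert i
    rw [forall_fin_sixteen]
    simp only [Pi.add_apply, Pi.sub_apply, Pi.smul_apply, Pi.zero_apply, Matrix.cons_val]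
    refine ⟨?_, ?_, ?_, ?_, ?_, ?_, ?_, ?_, ?_, ?_, ?_, ?_, ?_, ?_, ?_, ?_⟩ <;> module

theorem derivOp₁_single_zero (p s : ℂ) (m : M) (t : Fin 4) :
    derivOp₁ p s t (Pi.single 0 m) = 0 := by
  revert t
  rw [forall_fin_four]
  refine ⟨?_, ?_, ?_, ?_⟩ <;>
  · simp only [derivOp₁, Matrix.cons_val, pi_sixteen, LinearMap.add_apply,
      LinearMap.sub_apply, LinearMap.neg_apply, LinearMap.smul_apply, LinearMap.zero_apply,
      LinearMap.proj_apply]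
    funext i
    revert i
    rw [forall_fin_sixteen]
    simp [Pi.single_apply]

set_option maxHeartbeats 8000000 in
-- Here `z` enters the derivatives and the braiding but not the multiplication, which is taken at `p
-- = 0`. This is why the relations of the second family do not involve `z`.
theorem derivOp₂_rightOp (z s : ℂ) (x : Fin 16 → M) (k t : Fin 4) :
    derivOp₂ z s t (rightOp 0 s k x) = (if t = k then x else 0) -
      ∑ i, ∑ j, braid₂ z s j k i t • rightOp 0 s j (derivOp₂ z s i x) := by
  revert k t
  simp only [forall_fin_four, Fin.sum_univ_four, Fin.reduceEq, if_true, if_false, reduceIte]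
  refine ⟨⟨?_, ?_, ?_, ?_⟩, ⟨?_, ?_, ?_, ?_⟩, ⟨?_, ?_, ?_, ?_⟩, ⟨?_, ?_, ?_, ?_⟩⟩ <;>
  · simp only [braid₂, Matrix.cons_val, Matrix.of_apply, zero_smul, add_zero, zero_add, one_smul]
    simp only [derivOp₂, rightOp, Matrix.cons_val, pi_sixteen, LinearMap.add_apply,
      LinearMap.sub_apply, LinearMap.neg_apply, LinearMap.smul_apply, LinearMap.zero_apply,
      LinearMap.proj_apply]
    funext i
    revert i
    rw [forall_fin_sixteen]
    simp only [Pi.add_apply, Pi.sub_apply, Pi.smul_apply, Pi.zero_apply, Matrix.cons_val]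
    refine ⟨?_, ?_, ?_, ?_, ?_, ?_, ?_, ?_, ?_, ?_, ?_, ?_, ?_, ?_, ?_, ?_⟩ <;> module

theorem derivOp₂_single_zero (z s : ℂ) (m : M) (t : Fin 4) :
    derivOp₂ z s t (Pi.single 0 m) = 0 := by
  revert t
  rw [forall_fin_four]
  refine ⟨?_, ?_, ?_, ?_⟩ <;>
  · simp only [derivOp₂, Matrix.cons_val, pi_sixteen, LinearMap.add_apply,
      LinearMap.sub_apply, LinearMap.neg_apply, LinearMap.smul_apply, LinearMap.zero_apply,
      LinearMap.proj_apply]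
    funext i
    revert i
    rw [forall_fin_sixteen]
    simp [Pi.single_apply]

/-- Up to constants an element is recovered from its derivatives: the linear system is triangular
except for two-by-two blocks of determinant one, so no value of `p` is exceptional. -/
theorem eq_zero_of_derivOp₁ (p s : ℂ) (x : Fin 16 → M) (hx : ∀ t, derivOp₁ p s t x = 0)
    (h0 : x 0 = 0) : x = 0 := by
  have h := fun t i => congrFun (hx t) i
  simp only [forall_fin_four, forall_fin_sixteen, derivOp₁, Matrix.cons_val, pi_sixteen,
    LinearMap.add_apply, LinearMap.sub_apply, LinearMap.neg_apply, LinearMap.smul_apply,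
    LinearMap.zero_apply, LinearMap.proj_apply, Pi.zero_apply] at h
  obtain ⟨⟨h2, h3, -⟩, ⟨h1, -⟩, ⟨h8, a1, a2, a3, a4, a5, h14, h15, -⟩, ⟨h4, h5, h6, h7, -⟩⟩ := h
  have h9 : x 9 = 0 := by simpa [h6] using a1
  -- The pairs `(x 10, x 12)` and `(x 11, x 13)` both enter through the matrix with rows `(1 + p,
  -- p)` and `(-p, 1 - p)`, of determinant one. The weights in these four lines come from its
  -- inverse, and the multiple of `h6` removes the remaining `x 6`.
  have h10 : x 10 = 0 := by linear_combination (norm := module) (1 - p) • a2 - p • a4 + (s * p) • h6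
  have h12 : x 12 = 0 := by linear_combination (norm := module) p • a2 + (1 + p) • a4 - (s * p) • h6
  have h11 : x 11 = 0 := by linear_combination (norm := module) (1 - p) • a3 - p • a5
  have h13 : x 13 = 0 := by linear_combination (norm := module) p • a3 + (1 + p) • a5
  funext i
  revert i
  rw [forall_fin_sixteen]
  exact ⟨h0, h1, h2, h3, h4, h5, h6, h7, h8, h9, h10, h11, h12, h13, h14, h15⟩

theorem eq_zero_of_derivOp₂ (z s : ℂ) (x : Fin 16 → M) (hx : ∀ t, derivOp₂ z s t x = 0)
    (h0 : x 0 = 0) : x = 0 := by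
  have h := fun t i => congrFun (hx t) i
  simp only [forall_fin_four, forall_fin_sixteen, derivOp₂, Matrix.cons_val, pi_sixteen,
    LinearMap.add_apply, LinearMap.sub_apply, LinearMap.neg_apply, LinearMap.smul_apply,
    LinearMap.zero_apply, LinearMap.proj_apply, Pi.zero_apply] at h
  obtain ⟨⟨h2, a0, -⟩, ⟨h1, -, -, -, -, -, h7, -⟩, ⟨h8, a1, a2, a3, a4, a5, a6, h15, -⟩,
    ⟨h4, b1, b2, -⟩⟩ := h
  -- The pair `(x 3, x 5)` enters through the matrix with rows `(1 - z, z)` and `(-z, 1 + z)`, again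
  -- of determinant one; the weights are the rows of its inverse.
  have h3 : x 3 = 0 := by linear_combination (norm := module) (1 + z) • a0 - z • b1
  have h5 : x 5 = 0 := by linear_combination (norm := module) z • a0 + (1 - z) • b1
  have h9 : x 9 = 0 := by simpa [h3, h5] using a1
  have h10 : x 10 = 0 := by simpa [h3, h9] using a2
  have h11 : x 11 = 0 := by simpa [h7] using a3
  have h12 : x 12 = 0 := by simpa [h3, h9] using a4
  have h13 : x 13 = 0 := by simpa [h7] using a5
  have h14 : x 14 = 0 := by simpa [h7, h11, h13] using a6
  have h6 : x 6 = 0 := by simpa [h3, h9] using b2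
  funext i
  revert i
  rw [forall_fin_sixteen]
  exact ⟨h0, h1, h2, h3, h4, h5, h6, h7, h8, h9, h10, h11, h12, h13, h14, h15⟩

end NormalForms

end Jordanian

namespace Jordanian

/-! ### Naturality, grading and consistency of the multiplication operators. -/

section Degrees

variable {M N : Type*} [AddCommGroup M] [Module ℂ M] [AddCommGroup N] [Module ℂ N]

/-- The degrees of the ordered monomials. -/
def monomialDegree : Fin 16 → ℕ := ![0, 1, 1, 2, 1, 2, 2, 3, 1, 2, 2, 3, 2, 3, 3, 4]

/-- The matrix of the operator consists of complex numbers, so it commutes with every linear change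
of coefficients. This carries normal forms from `A` into a quotient algebra and from `ℂ` into an
algebra. -/
theorem rightOp_comp (p s : ℂ) (φ : M →ₗ[ℂ] N) (k : Fin 4) (x : Fin 16 → M) :
    rightOp p s k (φ ∘ x) = φ ∘ rightOp p s k x := by
  funext i
  revert k i
  simp only [forall_fin_four, forall_fin_sixteen, rightOp, Matrix.cons_val, pi_sixteen,
    LinearMap.add_apply, LinearMap.sub_apply, LinearMap.neg_apply, LinearMap.smul_apply,
    LinearMap.zero_apply, LinearMap.proj_apply, Function.comp_apply, map_add, map_sub, map_neg,
    map_smul, map_zero, and_self]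

theorem leftOp_comp (p s : ℂ) (φ : M →ₗ[ℂ] N) (k : Fin 4) (x : Fin 16 → M) :
    leftOp p s k (φ ∘ x) = φ ∘ leftOp p s k x := by
  funext i
  revert k i
  simp only [forall_fin_four, forall_fin_sixteen, leftOp, Matrix.cons_val, pi_sixteen,
    LinearMap.add_apply, LinearMap.sub_apply, LinearMap.neg_apply, LinearMap.smul_apply,
    LinearMap.zero_apply, LinearMap.proj_apply, Function.comp_apply, map_add, map_sub, map_neg,
    map_smul, map_zero, and_self]

/-- The relations are homogeneous, so a coordinate of the product involves only coordinates of
degree one less. -/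
theorem rightOp_apply_eq_zero (p s : ℂ) (x : Fin 16 → M) (k : Fin 4) (i : Fin 16)
    (h : ∀ j, monomialDegree j + 1 = monomialDegree i → x j = 0) : rightOp p s k x i = 0 := by
  revert k i
  simp only [forall_fin_four, forall_fin_sixteen, monomialDegree, rightOp, Matrix.cons_val,
    pi_sixteen, LinearMap.add_apply, LinearMap.sub_apply, LinearMap.neg_apply, LinearMap.smul_apply,
    LinearMap.zero_apply, LinearMap.proj_apply]
  simp +contextual

theorem rightOp_support (p s : ℂ) (x : Fin 16 → M) (k : Fin 4) (n : ℕ)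
    (h : ∀ j, monomialDegree j ≠ n → x j = 0) (i : Fin 16) (hi : monomialDegree i ≠ n + 1) :
    rightOp p s k x i = 0 :=
  rightOp_apply_eq_zero p s x k i fun j hj => h j fun hn => hi (by rw [← hj, hn])

/-- The degree-one monomials are the four `θ_k`, so a one-form is determined by its normal form.
This is what lets degree two be inverted. -/
theorem eq_zero_of_sum_rightOp (p s : ℂ) (y : Fin 4 → M)
    (h : ∑ k, rightOp p s k (Pi.single 0 (y k)) = 0) : y = 0 := by
  have h' := fun i => congrFun h i
  simp only [forall_fin_sixteen, Fin.sum_univ_four, Pi.add_apply, rightOp, Matrix.cons_val,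
    pi_sixteen, LinearMap.add_apply, LinearMap.sub_apply, LinearMap.neg_apply, LinearMap.smul_apply,
    LinearMap.zero_apply, LinearMap.proj_apply, Pi.zero_apply, Pi.single_apply, Fin.reduceEq,
    if_false, if_true, reduceIte, add_zero, zero_add] at h'
  obtain ⟨-, h1, h2, -, h4, -, -, -, h8, -⟩ := h'
  funext i
  revert i
  rw [forall_fin_four]
  simp_all

set_option maxHeartbeats 2000000 in
-- The consistency check behind the independence of the ordered monomials: the operators of left
-- multiplication themselves satisfy the ten relations on all sixteen coordinates.
theorem leftOp_relations (p s : ℂ) (x : Fin 16 → M) :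
    let L := fun i j => leftOp p s i (leftOp p s j x)
    L 2 2 = 0 ∧
    L 2 3 = -(1 + p) • L 3 2 + p • L 0 2 ∧
    L 2 0 = -(1 - p) • L 0 2 - p • L 3 2 ∧
    L 2 1 = -L 1 2 + s • L 0 2 - s • L 3 2 ∧
    L 3 3 = p • L 1 2 - (p * s) • L 0 2 + (p * s) • L 3 2 ∧
    L 3 0 = -L 0 3 - (p * s) • L 0 2 + (p * s) • L 3 2 ∧
    L 3 1 = -(1 + p) • L 1 3 + p • L 1 0 + ((1 + p) * s) • L 1 2 - (s ^ 2) • L 0 2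
      + (s ^ 2) • L 3 2 ∧
    L 0 0 = -p • L 1 2 ∧
    L 0 1 = -(1 - p) • L 1 0 - p • L 1 3 - ((1 - p) * s) • L 1 2 ∧
    L 1 1 = s • L 1 0 - s • L 1 3 + (s ^ 2) • L 1 2 := by
  intro L
  simp only [L]
  refine ⟨?_, ?_, ?_, ?_, ?_, ?_, ?_, ?_, ?_, ?_⟩ <;>
  · simp only [leftOp, Matrix.cons_val, pi_sixteen, LinearMap.add_apply,
      LinearMap.sub_apply, LinearMap.neg_apply, LinearMap.smul_apply, LinearMap.zero_apply,
      LinearMap.proj_apply]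
    funext i
    revert i
    rw [forall_fin_sixteen]
    simp only [Pi.add_apply, Pi.sub_apply, Pi.smul_apply, Pi.neg_apply, Pi.zero_apply,
      Matrix.cons_val]
    refine ⟨?_, ?_, ?_, ?_, ?_, ?_, ?_, ?_, ?_, ?_, ?_, ?_, ?_, ?_, ?_, ?_⟩ <;>
      first | trivial | module

end Degrees

end Jordanian

namespace Jordanian

/-! ### The ten relations as a reordering rule. -/

section Reordering

theorem sum_fin_sixteen {M : Type*} [AddCommMonoid M] (f : Fin 16 → M) : ∑ i, f i =
    f 0 + f 1 + f 2 + f 3 + f 4 + f 5 + f 6 + f 7 + f 8 + f 9 + f 10 + f 11 + f 12 + f 13 + f 14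
      + f 15 := by
  simp only [Fin.sum_univ_castSucc, Fin.sum_univ_zero, zero_add]
  rfl

variable {B : Type} [Ring B] [Algebra ℂ B]

/-- The right-hand sides of the commutation relations of the three families, in terms of
`p = z / (z + 1)` for the first family and `p = 0` for the other two. -/
def reordered (p s : ℂ) (θ : Fin 4 → B) : Fin 10 → B :=
  let θ₁ := θ 0; let θ₂ := θ 1; let θ₃ := θ 2; let θ₄ := θ 3
  ![0,
    -(1 + p) • (θ₄ * θ₃) + p • (θ₁ * θ₃),
    -(1 - p) • (θ₁ * θ₃) - p • (θ₄ * θ₃),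
    -(θ₂ * θ₃) + s • (θ₁ * θ₃) - s • (θ₄ * θ₃),
    p • (θ₂ * θ₃) - (p * s) • (θ₁ * θ₃) + (p * s) • (θ₄ * θ₃),
    -(θ₁ * θ₄) - (p * s) • (θ₁ * θ₃) + (p * s) • (θ₄ * θ₃),
    -(1 + p) • (θ₂ * θ₄) + p • (θ₂ * θ₁) + ((1 + p) * s) • (θ₂ * θ₃) - (s ^ 2) • (θ₁ * θ₃)
      + (s ^ 2) • (θ₄ * θ₃),
    -p • (θ₂ * θ₃),
    -(1 - p) • (θ₂ * θ₁) - p • (θ₂ * θ₄) - ((1 - p) * s) • (θ₂ * θ₃),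
    s • (θ₂ * θ₁) - s • (θ₂ * θ₄) + (s ^ 2) • (θ₂ * θ₃)]

/-- With `p = z / (z + 1)` one has `1 / (z + 1) = 1 - p` and `(2 z + 1) / (z + 1) = 1 + p`, so every
coefficient becomes a polynomial in `p` and `s`. -/
theorem reordered₁_eq (h g z : ℂ) (hz : z ≠ -1) (θ : Fin 4 → B) :
    reordered₁ h g z θ = reordered (z / (z + 1)) (h + g) θ := by
  have hz' : z + 1 ≠ 0 := fun h0 => hz (by linear_combination h0)
  have h1 : 1 / (z + 1) = 1 - z / (z + 1) := by field_simp; ring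
  have h2 : (2 * z + 1) / (z + 1) = 1 + z / (z + 1) := by field_simp; ring
  have h3 : z * (h + g) / (z + 1) = z / (z + 1) * (h + g) := by field_simp
  have h4 : (2 * z + 1) * (h + g) / (z + 1) = (1 + z / (z + 1)) * (h + g) := by field_simp; ring
  have h5 : (h + g) / (z + 1) = (1 - z / (z + 1)) * (h + g) := by field_simp; ring
  simp only [reordered₁, reordered, h1, h2, h3, h4, h5]

theorem reordered₂₃_eq (h g : ℂ) (θ : Fin 4 → B) :
    reordered₂₃ h g θ = reordered 0 (h + g) θ := by
  simp [reordered₂₃, reordered]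

/-- The ordered monomials `θ₂^α θ₁^β θ₄^γ θ₃^δ`, numbered by `α + 2 β + 4 γ + 8 δ`. -/
def monomial (θ : Fin 4 → B) : Fin 16 → B :=
  let θ₁ := θ 0; let θ₂ := θ 1; let θ₃ := θ 2; let θ₄ := θ 3
  ![1, θ₂, θ₁, θ₂ * θ₁, θ₄, θ₂ * θ₄, θ₁ * θ₄, θ₂ * θ₁ * θ₄,
    θ₃, θ₂ * θ₃, θ₁ * θ₃, θ₂ * θ₁ * θ₃, θ₄ * θ₃, θ₂ * θ₄ * θ₃, θ₁ * θ₄ * θ₃, θ₂ * θ₁ * θ₄ * θ₃]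

theorem orderedMonomial_symm (θ : Fin 4 → B) (i : Fin 16) :
    orderedMonomial θ (finFunctionFinEquiv.symm i) = monomial θ i := by
  revert i
  rw [forall_fin_sixteen]
  simp [orderedMonomial, monomial, finFunctionFinEquiv]

theorem monomialDegree_eq (i : Fin 16) :
    ∑ j, ((finFunctionFinEquiv (m := 2) (n := 4)).symm i j : ℕ) = monomialDegree i := by
  revert i
  rw [forall_fin_sixteen]
  simp [monomialDegree, Fin.sum_univ_four, finFunctionFinEquiv]

set_option maxHeartbeats 4000000 in
-- This justifies the table in `rightOp`: rewriting with the ten relations until only ordered words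
-- remain produces exactly its entries. No independence of the monomials is involved.
theorem sum_monomial_mul {p s : ℂ} {θ : Fin 4 → B} (h : misordered θ = reordered p s θ)
    (x : Fin 16 → B) (k : Fin 4) :
    (∑ i, x i * monomial θ i) * θ k = ∑ i, rightOp p s k x i * monomial θ i := by
  -- Words are kept right-associated, so each relation is also needed with a tail `y`.
  have r : ∀ {u v w : B}, u * v = w → ∀ y, u * (v * y) = w * y := by
    rintro u v w rfl y; rw [mul_assoc]
  have h33 := congrFun h 0
  have h34 := congrFun h 1
  have h31 := congrFun h 2
  have h32 := congrFun h 3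
  have h44 := congrFun h 4
  have h41 := congrFun h 5
  have h42 := congrFun h 6
  have h11 := congrFun h 7
  have h12 := congrFun h 8
  have h22 := congrFun h 9
  simp only [misordered, reordered, Matrix.cons_val] at h33 h34 h31 h32 h44 h41 h42 h11 h12 h22
  revert k
  rw [forall_fin_four]
  simp only [sum_fin_sixteen, monomial, Matrix.cons_val]
  generalize θ 0 = θ₁ at *
  generalize θ 1 = θ₂ at *
  generalize θ 2 = θ₃ at *
  generalize θ 3 = θ₄ at *
  refine ⟨?_, ?_, ?_, ?_⟩ <;>
  · simp only [rightOp, Matrix.cons_val, pi_sixteen, LinearMap.add_apply,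
      LinearMap.sub_apply, LinearMap.neg_apply, LinearMap.smul_apply, LinearMap.zero_apply,
      LinearMap.proj_apply]
    simp only [add_mul, sub_mul, neg_mul, mul_add, mul_sub, mul_neg, smul_mul_assoc,
      mul_smul_comm, mul_assoc, mul_one, zero_mul, mul_zero, smul_add, smul_sub, smul_neg,
      h33, h34, h31, h32, h44, h41, h42, h11, h12, h22,
      r h33, r h34, r h31, r h32, r h44, r h41, r h42, r h11, r h12, r h22]
    module

end Reordering

end Jordanian

/-! ### Slices of tensors and the recursion of the antisymmetrizer. -/

namespace Woronowicz

variable {A : Type} [Ring A] [HopfAlgebra ℂ A] {I : Type} [Fintype I] [DecidableEq I]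

/-- The components of a tensor with last factor `θ_k`. -/
def slice {n : ℕ} (k : I) : ((Fin (n + 1) → I) → A) →ₗ[ℂ] ((Fin n → I) → A) :=
  LinearMap.funLeft ℂ A fun J => Fin.snoc J k

@[simp] theorem slice_apply {n : ℕ} (k : I) (t : (Fin (n + 1) → I) → A) (J : Fin n → I) :
    slice k t J = t (Fin.snoc J k) := rfl

theorem eq_of_slice {n : ℕ} {t u : (Fin (n + 1) → I) → A} (h : ∀ k, slice k t = slice k u) :
    t = u := by
  funext J
  rw [← Fin.snoc_init_self J]
  exact congrFun (h _) _

/-- The normal form of a tensor, where `R k` is right multiplication by `θ_k` on the module `X` of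
normal forms and `u` is the inclusion of `A`. -/
def normalForm {X : Type*} [AddCommGroup X] [Module ℂ X] (R : I → X →ₗ[ℂ] X) (u : A →ₗ[ℂ] X) :
    (n : ℕ) → ((Fin n → I) → A) →ₗ[ℂ] X
  | 0 => u ∘ₗ LinearMap.proj default
  | n + 1 => ∑ k, R k ∘ₗ normalForm R u n ∘ₗ slice k

theorem normalForm_succ {X : Type*} [AddCommGroup X] [Module ℂ X] (R : I → X →ₗ[ℂ] X)
    (u : A →ₗ[ℂ] X) (n : ℕ) (t : (Fin (n + 1) → I) → A) :
    normalForm R u (n + 1) t = ∑ k, R k (normalForm R u n (slice k t)) := by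
  simp [normalForm]

namespace BicovariantBimodule

variable (Γ : BicovariantBimodule A I)

/-- The alternating sum of the braids of the minimal coset representatives of `S_m` in `S_{m+1}`. -/
def cosetSum (n m : ℕ) : Module.End A ((Fin n → I) → A) :=
  ∑ k ∈ Finset.range (m + 1), (-1) ^ k * Γ.braidChain n m k

theorem braidAt_snoc {n j : ℕ} (hj : j + 1 < n) (t : (Fin (n + 1) → I) → A) (k : I) :
    slice k (Γ.braidAt (n + 1) j t) = Γ.braidAt n j (slice k t) := by
  funext J
  have h1 : (⟨j, by omega⟩ : Fin (n + 1)) = Fin.castSucc ⟨j, by omega⟩ := rfl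
  have h2 : (⟨j + 1, by omega⟩ : Fin (n + 1)) = Fin.castSucc ⟨j + 1, hj⟩ := rfl
  simp only [slice_apply, braidAt, hj, dif_pos, show j + 1 < n + 1 by omega, LinearMap.coe_mk,
    AddHom.coe_mk, h1, h2, Fin.snoc_castSucc, Fin.snoc_update]

/-- The braiding of the last two slots only mixes the corresponding slices, with numerical
coefficients. This is the term that the twisted Leibniz rule reproduces. -/
theorem braidAt_last_snoc {n : ℕ} (t : (Fin (n + 2) → I) → A) (k l : I) :
    slice k (slice l (Γ.braidAt (n + 2) n t)) =
      ∑ i, ∑ j, Γ.braidCoeff i j k l • slice i (slice j t) := by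
  funext J
  have h1 : (⟨n, by omega⟩ : Fin (n + 2)) = Fin.castSucc (Fin.last n) := rfl
  have h2 : (⟨n + 1, by omega⟩ : Fin (n + 2)) = Fin.last (n + 1) := rfl
  simp only [slice_apply, braidAt, dif_pos, show n + 1 < n + 2 by omega, LinearMap.coe_mk,
    AddHom.coe_mk, h1, h2, Fin.snoc_castSucc, Fin.snoc_last, ← Fin.snoc_update,
    Fin.update_snoc_last, Finset.sum_apply, Pi.smul_apply]

theorem braidChain_snoc {n m i : ℕ} (hm : m < n) (hi : i ≤ m) (t : (Fin (n + 1) → I) → A) (k : I) :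
    slice k (Γ.braidChain (n + 1) m i t) = Γ.braidChain n m i (slice k t) := by
  induction i generalizing t with
  | zero => rfl
  | succ i ih =>
    simp only [braidChain, Module.End.mul_apply]
    rw [ih (by omega), braidAt_snoc Γ (by omega)]

theorem neg_one_pow_mul_apply {V : Type*} [AddCommGroup V] [Module A V] (i : ℕ)
    (f : Module.End A V) (v : V) : ((-1) ^ i * f) v = (-1 : ℤ) ^ i • f v := by
  rcases neg_one_pow_eq_or (Module.End A V) i with h | h
  · rcases Nat.even_or_odd i with h' | h'
    · simp [h'.neg_one_pow]
    · simp [h'.neg_one_pow]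
  · rcases Nat.even_or_odd i with h' | h'
    · simp [h'.neg_one_pow]
    · simp [h'.neg_one_pow]

theorem cosetSum_apply (n m : ℕ) (t : (Fin n → I) → A) : Γ.cosetSum n m t =
    ∑ k ∈ Finset.range (m + 1), (-1 : ℤ) ^ k • Γ.braidChain n m k t := by
  simp only [cosetSum, LinearMap.sum_apply, neg_one_pow_mul_apply]

theorem cosetSum_snoc {n m : ℕ} (hm : m < n) (t : (Fin (n + 1) → I) → A) (k : I) :
    slice k (Γ.cosetSum (n + 1) m t) = Γ.cosetSum n m (slice k t) := by
  rw [cosetSum_apply, cosetSum_apply, map_sum]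
  refine Finset.sum_congr rfl fun i hi => ?_
  rw [map_zsmul, braidChain_snoc Γ hm (by rw [Finset.mem_range] at hi; omega)]

theorem antisymmetrizerAux_succ_apply (n m : ℕ) (t : (Fin n → I) → A) :
    Γ.antisymmetrizerAux n (m + 1) t = Γ.antisymmetrizerAux n m (Γ.cosetSum n m t) := rfl

/-- The first `m ≤ n` slots are not affected by fixing the last one. This makes an induction on the
degree possible. -/
theorem antisymmetrizerAux_snoc {n m : ℕ} (hm : m ≤ n) (t : (Fin (n + 1) → I) → A) (k : I) :
    slice k (Γ.antisymmetrizerAux (n + 1) m t) = Γ.antisymmetrizerAux n m (slice k t) := by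
  induction m generalizing t with
  | zero => rfl
  | succ m ih =>
    rw [antisymmetrizerAux_succ_apply, ih (by omega), cosetSum_snoc Γ (by omega),
      antisymmetrizerAux_succ_apply]

/-- The definition adds factors to a chain on the right; the recursion for the coset sums needs the
leftmost factor split off instead. -/
theorem braidChain_succ_succ (n m k : ℕ) :
    Γ.braidChain n (m + 1) (k + 1) = Γ.braidAt n m * Γ.braidChain n m k := by
  induction k with
  | zero => simp [braidChain]
  | succ k ih =>
    rw [braidChain, ih, mul_assoc, braidChain, show m + 1 - 1 - (k + 1) = m - 1 - k by omega]

theorem cosetSum_zero (n : ℕ) : Γ.cosetSum n 0 = 1 := by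
  simp [cosetSum, braidChain]

/-- Each nontrivial coset representative is `Λ_m` times a representative one level below, with the
opposite sign. -/
theorem cosetSum_succ (n m : ℕ) :
    Γ.cosetSum n (m + 1) = 1 - Γ.braidAt n m * Γ.cosetSum n m := by
  rw [cosetSum, Finset.sum_range_succ', cosetSum, Finset.mul_sum, sub_eq_add_neg,
    ← Finset.sum_neg_distrib, add_comm]
  simp only [braidChain_succ_succ]
  rw [braidChain, pow_zero, mul_one]
  congr 1
  refine Finset.sum_congr rfl fun k _ => ?_
  refine LinearMap.ext fun t => ?_
  rw [neg_one_pow_mul_apply, LinearMap.neg_apply, Module.End.mul_apply, Module.End.mul_apply,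
    neg_one_pow_mul_apply, map_zsmul, pow_succ, mul_neg_one, neg_smul]

/-! ### Braided derivatives compute the antisymmetrizer. -/

section Derivation

variable {X : Type*} [AddCommGroup X] [Module ℂ X] {R d : I → X →ₗ[ℂ] X} {u : A →ₗ[ℂ] X}

/-- The operators `d_k` on normal forms are the components of the antisymmetrizing coset sum. -/
theorem normalForm_cosetSum
    (hd : ∀ k t x, d t (R k x) = (if t = k then x else 0) -
      ∑ i, ∑ j, Γ.braidCoeff i k j t • R j (d i x))
    (hu : ∀ k a, d k (u a) = 0) (n : ℕ) (t : (Fin (n + 1) → I) → A) (k : I) :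
    normalForm R u n (slice k (Γ.cosetSum (n + 1) n t)) = d k (normalForm R u (n + 1) t) := by
  induction n generalizing k with
  | zero =>
    rw [cosetSum_zero, normalForm_succ, map_sum]
    simp only [hd, normalForm, LinearMap.comp_apply, hu, map_zero, smul_zero, Finset.sum_const_zero,
      sub_zero, Module.End.one_apply, Finset.sum_ite_eq, Finset.mem_univ, if_true]
  -- In `C_{n+1} = 1 - Λ_n C_n`, the identity gives the term `x` of the Leibniz rule. Slicing the
  -- other term in its last two slots produces the braid coefficients. Since `C_n` ignores the last
  -- slot, the induction hypothesis turns the inner slice into a derivative.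
  | succ n ih =>
    rw [cosetSum_succ, LinearMap.sub_apply, Module.End.one_apply, map_sub, map_sub,
      normalForm_succ R u (n + 1) t, map_sum, Module.End.mul_apply]
    simp only [hd, Finset.sum_sub_distrib, Finset.sum_ite_eq, Finset.mem_univ, if_true]
    congr 1
    rw [normalForm_succ]
    simp only [braidAt_last_snoc, map_sum, map_smul, cosetSum_snoc Γ (Nat.lt_succ_self n), ih]
    rw [Finset.sum_comm]
    conv_rhs => rw [Finset.sum_comm]
    refine Finset.sum_congr rfl fun i _ => ?_
    rw [Finset.sum_comm]

/-- From `W_{n+1} = W_n C_n`, every slice of `C_n t` lies in `ker W_n`, so by induction all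
derivatives of the normal form of `t` vanish. The injectivity assumption concerns only sums of right
multiples: on constants the derivatives are zero. -/
theorem normalForm_eq_zero
    (hd : ∀ k t x, d t (R k x) = (if t = k then x else 0) -
      ∑ i, ∑ j, Γ.braidCoeff i k j t • R j (d i x))
    (hu : ∀ k a, d k (u a) = 0)
    (hinj : ∀ y : I → X, (∀ t, d t (∑ k, R k (y k)) = 0) → ∑ k, R k (y k) = 0)
    (n : ℕ) (t : (Fin n → I) → A) (ht : Γ.antisymmetrizer n t = 0) : normalForm R u n t = 0 := by
  induction n with
  | zero =>
    have : t = 0 := ht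
    rw [this, map_zero]
  | succ n ih =>
    rw [normalForm_succ]
    refine hinj _ fun k => ?_
    rw [← normalForm_succ, ← Γ.normalForm_cosetSum hd hu]
    apply ih
    rw [antisymmetrizer, ← antisymmetrizerAux_snoc Γ le_rfl, ← antisymmetrizerAux_succ_apply]
    exact (congrArg (slice k) ht).trans (map_zero _)

theorem antisymmetrizer_two (t : (Fin 2 → I) → A) :
    Γ.antisymmetrizer 2 t = Γ.cosetSum 2 1 t := by
  rw [antisymmetrizer, antisymmetrizerAux_succ_apply, antisymmetrizerAux_succ_apply, cosetSum_zero]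
  rfl

theorem antisymmetrizer_two_eq_zero_iff (t : (Fin 2 → I) → A) :
    Γ.antisymmetrizer 2 t = 0 ↔ Γ.braidAt 2 0 t = t := by
  rw [antisymmetrizer_two, cosetSum_succ, cosetSum_zero, mul_one, LinearMap.sub_apply,
    Module.End.one_apply, sub_eq_zero, eq_comm]

/-- A converse in degree two: the slices of `C_1 t` are one-forms whose normal forms are derivatives
of zero, and a one-form with zero normal form is zero. -/
theorem antisymmetrizer_two_eq_zero
    (hd : ∀ k t x, d t (R k x) = (if t = k then x else 0) -
      ∑ i, ∑ j, Γ.braidCoeff i k j t • R j (d i x))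
    (hu : ∀ k a, d k (u a) = 0)
    (hinj : ∀ y : I → A, ∑ k, R k (u (y k)) = 0 → y = 0)
    (t : (Fin 2 → I) → A) (ht : normalForm R u 2 t = 0) : Γ.antisymmetrizer 2 t = 0 := by
  rw [antisymmetrizer_two]
  refine eq_of_slice fun k => ?_
  have h := Γ.normalForm_cosetSum hd hu 1 t k
  rw [ht, map_zero, normalForm_succ] at h
  rw [map_zero]
  refine eq_of_slice fun j => ?_
  funext J
  obtain rfl := Subsingleton.elim J default
  exact congrFun (hinj (fun j => slice j (slice k (Γ.cosetSum 2 1 t)) default) h) j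

end Derivation

end BicovariantBimodule

end Woronowicz

/-! ### The tensor algebra: universal property and homogeneous elements. -/

namespace Woronowicz

variable {A : Type} [Ring A] [HopfAlgebra ℂ A] {I : Type} [Fintype I] [DecidableEq I]

namespace BicovariantBimodule

variable (Γ : BicovariantBimodule A I)

/-- Both the coproduct and `f` are multiplicative, so `x ↦ (f_{ij} ⋆ x)` is a matrix representation
of `A` over itself. -/
theorem starLeft_mul (i j : I) (x y : A) : starLeft (entry Γ.f i j) (x * y) =
    ∑ k, starLeft (entry Γ.f i k) x * starLeft (entry Γ.f k j) y := by
  simp only [← starLeftHom_apply, map_mul, Matrix.mul_apply]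

namespace TensorAlg

theorem form_mul_coeff (i : I) (x : A) : form Γ i * coeff Γ x =
    ∑ j, coeff Γ (starLeft (entry Γ.f i j) x) * form Γ j := by
  have h := RingQuot.mkAlgHom_rel ℂ (TensorRel.form_mul (Γ := Γ) i x)
  rw [map_mul, map_sum] at h
  simp only [map_mul] at h
  exact h

variable {Γ} in
theorem induction {P : Γ.TensorAlg → Prop} (hcoeff : ∀ x, P (coeff Γ x)) (hform : ∀ i, P (form Γ i))
    (hadd : ∀ x y, P x → P y → P (x + y)) (hmul : ∀ x y, P x → P y → P (x * y))
    (ω : Γ.TensorAlg) : P ω := by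
  obtain ⟨y, rfl⟩ := RingQuot.mkAlgHom_surjective ℂ Γ.TensorRel ω
  induction y using FreeAlgebra.induction with
  | grade0 r =>
    rw [AlgHom.commutes]
    have h := hcoeff (algebraMap ℂ A r)
    rwa [AlgHom.commutes] at h
  | grade1 t =>
    rcases t with x | i
    · exact hcoeff x
    · exact hform i
  | mul x y hx hy => rw [map_mul]; exact hmul _ _ hx hy
  | add x y hx hy => rw [map_add]; exact hadd _ _ hx hy

/-- The universal property of the tensor algebra. -/
def lift {B : Type*} [Ring B] [Algebra ℂ B] (φ : A →ₐ[ℂ] B) (θ : I → B)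
    (h : ∀ i x, θ i * φ x = ∑ j, φ (starLeft (entry Γ.f i j) x) * θ j) : Γ.TensorAlg →ₐ[ℂ] B :=
  RingQuot.liftAlgHom ℂ ⟨FreeAlgebra.lift ℂ (Sum.elim φ θ), by
    rintro _ _ (r | ⟨x, y⟩ | ⟨x, y⟩ | ⟨i, x⟩)
    · simp
    · simp
    · simp
    · simp [h]⟩

section lift
variable {B : Type*} [Ring B] [Algebra ℂ B] (φ : A →ₐ[ℂ] B) (θ : I → B)
    (h : ∀ i x, θ i * φ x = ∑ j, φ (starLeft (entry Γ.f i j) x) * θ j)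

@[simp] theorem lift_coeff (x : A) : lift Γ φ θ h (coeff Γ x) = φ x :=
  (RingQuot.liftAlgHom_mkAlgHom_apply ..).trans (by simp)

@[simp] theorem lift_form (i : I) : lift Γ φ θ h (form Γ i) = θ i :=
  (RingQuot.liftAlgHom_mkAlgHom_apply ..).trans (by simp)

end lift

theorem incl_zero (t : (Fin 0 → I) → A) : incl Γ 0 t = coeff Γ (t default) := by
  simp [incl]

/-- Splitting off the last factor matches the recursion that defines `normalForm`. -/
theorem incl_succ (n : ℕ) (t : (Fin (n + 1) → I) → A) :
    incl Γ (n + 1) t = ∑ k, incl Γ n (slice k t) * form Γ k := by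
  rw [incl, ← (Fin.snocEquiv fun _ => I).sum_comp, Fintype.sum_prod_type]
  refine Finset.sum_congr rfl fun k _ => ?_
  rw [incl, Finset.sum_mul]
  refine Finset.sum_congr rfl fun J _ => ?_
  simp only [Fin.snocEquiv, Equiv.coe_fn_mk, slice_apply, List.ofFn_succ', List.concat_eq_append,
    List.prod_append, List.prod_singleton, Fin.snoc_castSucc, Fin.snoc_last, mul_assoc]

theorem snoc_snoc_default (i k : I) :
    (Fin.snoc (Fin.snoc (default : Fin 0 → I) i : Fin 1 → I) k : Fin 2 → I) = ![i, k] := by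
  funext j
  fin_cases j <;> rfl

theorem incl_two (t : (Fin 2 → I) → A) :
    incl Γ 2 t = ∑ k, (∑ i, coeff Γ (t ![i, k]) * form Γ i) * form Γ k := by
  rw [incl_succ]
  simp only [incl_succ, incl_zero, slice_apply, snoc_snoc_default]

theorem incl_two_mul_coeff (t : (Fin 2 → I) → A) (x : A) :
    incl Γ 2 t * coeff Γ x = incl Γ 2 (Γ.rightMul₂ t x) := by
  rw [incl_two, incl_two]
  simp only [rightMul₂, Finset.sum_mul, mul_assoc, form_mul_coeff, Finset.mul_sum, map_sum, map_mul,
    Matrix.cons_val_zero, Matrix.cons_val_one]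
  simp only [← mul_assoc (form Γ _) (coeff Γ _), form_mul_coeff, Finset.mul_sum, Finset.sum_mul,
    mul_assoc]
  calc _ = ∑ k, ∑ i, ∑ k', ∑ i', coeff Γ (t ![i, k]) *
        (coeff Γ (starLeft (entry Γ.f i i') (starLeft (entry Γ.f k k') x)) *
          (form Γ i' * form Γ k')) := rfl
    _ = ∑ k', ∑ i', ∑ k, ∑ i, coeff Γ (t ![i, k]) *
        (coeff Γ (starLeft (entry Γ.f i i') (starLeft (entry Γ.f k k') x)) *
          (form Γ i' * form Γ k')) := sum_four_comm _
    _ = _ := Finset.sum_congr rfl fun k' _ => Finset.sum_congr rfl fun i' _ => Finset.sum_comm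

end TensorAlg

end BicovariantBimodule

end Woronowicz

namespace Jordanian
open Woronowicz

/-! ### Quadratic expressions and the coefficient matrices of the relations. -/

section Quadratic

theorem sum_fin_ten {M : Type*} [AddCommMonoid M] (f : Fin 10 → M) : ∑ i, f i =
    f 0 + f 1 + f 2 + f 3 + f 4 + f 5 + f 6 + f 7 + f 8 + f 9 := by
  simp only [Fin.sum_univ_castSucc, Fin.sum_univ_zero, zero_add]
  rfl

theorem forall_fin_ten {P : Fin 10 → Prop} : (∀ i, P i) ↔
    P 0 ∧ P 1 ∧ P 2 ∧ P 3 ∧ P 4 ∧ P 5 ∧ P 6 ∧ P 7 ∧ P 8 ∧ P 9 := by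
  simp [Fin.forall_fin_succ]

section Module
variable {M N : Type*} [AddCommGroup M] [Module ℂ M] [AddCommGroup N] [Module ℂ N]

/-- The coefficients of the mis-ordered products in `∑ q_{jk} θ_j θ_k`. -/
def misorderedCoeff (q : Fin 4 → Fin 4 → M) : Fin 10 → M :=
  ![q 2 2, q 2 3, q 2 0, q 2 1, q 3 3, q 3 0, q 3 1, q 0 0, q 0 1, q 1 1]

/-- The coefficients of `∑ q_{jk} θ_j θ_k` in terms of ordered monomials. -/
def quadraticNormalForm (p s : ℂ) (q : Fin 4 → Fin 4 → M) : Fin 16 → M :=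
  ∑ k, rightOp p s k (∑ j, rightOp p s j (Pi.single 0 (q j k)))

theorem single_zero_comp (φ : M →ₗ[ℂ] N) (m : M) :
    (Pi.single 0 (φ m) : Fin 16 → N) = φ ∘ Pi.single 0 m := by
  funext i
  by_cases hi : i = 0 <;> simp [Pi.single_apply, hi]

theorem sum_comp {κ : Type*} (S : Finset κ) (φ : M →ₗ[ℂ] N) (x : κ → Fin 16 → M) :
    ∑ k ∈ S, φ ∘ x k = φ ∘ ∑ k ∈ S, x k := by
  funext i
  simp

theorem quadraticNormalForm_comp (p s : ℂ) (φ : M →ₗ[ℂ] N) (q : Fin 4 → Fin 4 → M) :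
    quadraticNormalForm p s (fun j k => φ (q j k)) = φ ∘ quadraticNormalForm p s q := by
  simp only [quadraticNormalForm, single_zero_comp, rightOp_comp, sum_comp]

/-- In the numbering of the monomials `θ₂, θ₁, θ₄, θ₃` have numbers `1, 2, 4, 8`; this resolves the
first of the two multiplications. -/
theorem quadraticNormalForm_apply (p s : ℂ) (q : Fin 4 → Fin 4 → M) :
    quadraticNormalForm p s q =
      ∑ k, rightOp p s k ![0, q 1 k, q 0 k, 0, q 3 k, 0, 0, 0, q 2 k, 0, 0, 0, 0, 0, 0, 0] := by
  refine Finset.sum_congr rfl fun k _ => congrArg _ ?_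
  rw [Fin.sum_univ_four]
  simp only [rightOp, Matrix.cons_val, pi_sixteen, LinearMap.add_apply, LinearMap.sub_apply,
    LinearMap.neg_apply, LinearMap.smul_apply, LinearMap.zero_apply, LinearMap.proj_apply]
  funext i
  revert i
  rw [forall_fin_sixteen]
  simp [Pi.single_apply]

end Module

/-- The matrices `q` of the ten relations `∑ q_{jk} θ_j θ_k = 0`. -/
def relationMatrix (p s : ℂ) : Fin 10 → Fin 4 → Fin 4 → ℂ :=
  ![![0, 0, ![0, 0, 1, 0], 0],
    ![![0, 0, -p, 0], 0, ![0, 0, 0, 1], ![0, 0, 1 + p, 0]],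
    ![![0, 0, 1 - p, 0], 0, ![1, 0, 0, 0], ![0, 0, p, 0]],
    ![![0, 0, -s, 0], ![0, 0, 1, 0], ![0, 1, 0, 0], ![0, 0, s, 0]],
    ![![0, 0, p * s, 0], ![0, 0, -p, 0], 0, ![0, 0, -(p * s), 1]],
    ![![0, 0, p * s, 1], 0, 0, ![1, 0, -(p * s), 0]],
    ![![0, 0, s ^ 2, 0], ![-p, 0, -((1 + p) * s), 1 + p], 0, ![0, 1, -s ^ 2, 0]],
    ![![1, 0, 0, 0], ![0, 0, p, 0], 0, 0],
    ![![0, 1, 0, 0], ![1 - p, 0, (1 - p) * s, p], 0, 0],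
    ![0, ![-s, 1, -s ^ 2, s], 0, 0]]

/-- Each relation has exactly one mis-ordered product. Hence the coefficients in any combination of
relations can be read off from its mis-ordered part. -/
theorem misorderedCoeff_relationMatrix (p s : ℂ) (l : Fin 10) :
    misorderedCoeff (relationMatrix p s l) = Pi.single l 1 := by
  funext i
  revert l i
  simp [forall_fin_ten, misorderedCoeff, relationMatrix, Pi.single_apply]

set_option maxHeartbeats 2000000 in
theorem quadraticNormalForm_relationMatrix (p s : ℂ) (l : Fin 10) :
    quadraticNormalForm p s (relationMatrix p s l) = 0 := by
  rw [quadraticNormalForm_apply, Fin.sum_univ_four]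
  revert l
  rw [forall_fin_ten]
  refine ⟨?_, ?_, ?_, ?_, ?_, ?_, ?_, ?_, ?_, ?_⟩ <;>
  · simp only [relationMatrix, rightOp, Matrix.cons_val, pi_sixteen, LinearMap.add_apply,
      LinearMap.sub_apply, LinearMap.neg_apply, LinearMap.smul_apply, LinearMap.zero_apply,
      LinearMap.proj_apply, Pi.zero_apply]
    funext i
    revert i
    rw [forall_fin_sixteen]
    simp only [Pi.add_apply, Pi.zero_apply, Matrix.cons_val, smul_eq_mul, mul_zero, zero_mul,
      add_zero, zero_add, sub_zero, zero_sub, neg_zero, and_self, true_and, and_true]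
    all_goals repeat' apply And.intro
    all_goals ring1

variable {B : Type} [Ring B] [Algebra ℂ B]

set_option maxHeartbeats 2000000 in
-- In degree two one replacement of each mis-ordered product already leaves ordered words. The
-- identity therefore holds in every algebra, with no relation assumed, and keeps the error as an
-- explicit left combination of the relations.
theorem quadratic_reordering (p s : ℂ) (θ : Fin 4 → B) (q : Fin 4 → Fin 4 → B) :
    ∑ k, (∑ j, q j k * θ j) * θ k =
      ∑ l, misorderedCoeff q l * (misordered θ l - reordered p s θ l) +
        ∑ i, quadraticNormalForm p s q i * monomial θ i := by
  rw [quadraticNormalForm_apply, Fin.sum_univ_four, sum_fin_ten, sum_fin_sixteen]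
  simp only [Fin.sum_univ_four, rightOp, Matrix.cons_val, pi_sixteen, LinearMap.add_apply,
      LinearMap.sub_apply, LinearMap.neg_apply, LinearMap.smul_apply, LinearMap.zero_apply,
      LinearMap.proj_apply, misorderedCoeff, misordered, reordered, monomial, Pi.add_apply]
  simp only [add_mul, sub_mul, neg_mul, mul_add, mul_sub, mul_neg, smul_mul_assoc,
      mul_smul_comm, mul_assoc, mul_one, zero_mul, mul_zero, smul_add, smul_sub, smul_neg,
      smul_zero]
  module

end Quadratic

end Jordanian

namespace Jordanian
open Woronowicz BicovariantBimodule

/-! ### The kernels of the antisymmetrizers and the ideal of the ten relations. -/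

section Reduction

variable {A : Type} [Ring A] [HopfAlgebra ℂ A] {Γ : BicovariantBimodule A (Fin 4)} {p s : ℂ}

variable (Γ p s) in
/-- The ten quadratic relations in the tensor algebra, as elements to be set to zero. -/
def relator (l : Fin 10) : Γ.TensorAlg :=
  misordered (TensorAlg.form Γ) l - reordered p s (TensorAlg.form Γ) l

variable (A p s) in
/-- The normal form of a tensor with respect to the ordered monomials. -/
abbrev orderedForm (n : ℕ) : ((Fin n → Fin 4) → A) →ₗ[ℂ] (Fin 16 → A) :=
  normalForm (rightOp p s) (LinearMap.single ℂ (fun _ => A) 0) n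

theorem map_misordered {B C : Type} [Ring B] [Algebra ℂ B] [Ring C] [Algebra ℂ C] (q : B →ₐ[ℂ] C)
    (θ : Fin 4 → B) (l : Fin 10) : q (misordered θ l) = misordered (fun i => q (θ i)) l := by
  revert l
  simp [forall_fin_ten, misordered]

theorem map_reordered {B C : Type} [Ring B] [Algebra ℂ B] [Ring C] [Algebra ℂ C] (q : B →ₐ[ℂ] C)
    (θ : Fin 4 → B) (l : Fin 10) :
    q (reordered p s θ l) = reordered p s (fun i => q (θ i)) l := by
  revert l
  simp [forall_fin_ten, reordered]

theorem map_relator {C : Type} [Ring C] [Algebra ℂ C] (q : Γ.TensorAlg →ₐ[ℂ] C) (l : Fin 10) :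
    q (relator Γ p s l) = misordered (fun i => q (TensorAlg.form Γ i)) l -
      reordered p s (fun i => q (TensorAlg.form Γ i)) l := by
  rw [relator, map_sub, map_misordered, map_reordered]

/-- In a quotient by the quadratic relations, a tensor equals its normal form. -/
theorem map_incl {C : Type} [Ring C] [Algebra ℂ C] (q : Γ.TensorAlg →ₐ[ℂ] C)
    (hq : ∀ l, q (relator Γ p s l) = 0) (n : ℕ) (t : (Fin n → Fin 4) → A) :
    q (TensorAlg.incl Γ n t) = ∑ i, q (TensorAlg.coeff Γ (orderedForm A p s n t i)) *
      monomial (fun i => q (TensorAlg.form Γ i)) i := by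
  have hrel : misordered (fun i => q (TensorAlg.form Γ i)) =
      reordered p s (fun i => q (TensorAlg.form Γ i)) := by
    funext l
    rw [← sub_eq_zero, ← map_relator, hq]
  induction n with
  | zero =>
    rw [TensorAlg.incl_zero, Finset.sum_eq_single 0]
    · simp [normalForm, monomial]
    · intro i _ hi
      simp [normalForm, hi]
    · simp
  | succ n ih =>
    rw [TensorAlg.incl_succ, map_sum, orderedForm, normalForm_succ]
    simp only [Finset.sum_apply, map_sum, Finset.sum_mul]
    rw [Finset.sum_comm]
    refine Finset.sum_congr rfl fun k _ => ?_
    rw [map_mul, ih, sum_monomial_mul hrel]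
    refine Finset.sum_congr rfl fun i _ => ?_
    congr 1
    exact congrFun (rightOp_comp p s (q.toLinearMap ∘ₗ (TensorAlg.coeff Γ).toLinearMap) k
      (orderedForm A p s n (slice k t))) i

theorem orderedForm_two (t : (Fin 2 → Fin 4) → A) :
    orderedForm A p s 2 t = quadraticNormalForm p s fun j k => t ![j, k] := by
  rw [orderedForm, normalForm_succ, quadraticNormalForm]
  refine Finset.sum_congr rfl fun k _ => congrArg _ ?_
  rw [normalForm_succ]
  refine Finset.sum_congr rfl fun j _ => congrArg _ ?_
  simp only [normalForm, LinearMap.comp_apply, LinearMap.proj_apply, slice_apply,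
    TensorAlg.snoc_snoc_default]
  rfl

/-- A tensor of degree two is the sum of its normal form and a combination of the relations. -/
theorem incl_two_eq (t : (Fin 2 → Fin 4) → A) : TensorAlg.incl Γ 2 t =
    ∑ l, TensorAlg.coeff Γ (misorderedCoeff (fun j k => t ![j, k]) l) * relator Γ p s l +
      ∑ i, TensorAlg.coeff Γ (orderedForm A p s 2 t i) * monomial (TensorAlg.form Γ) i := by
  rw [TensorAlg.incl_two, quadratic_reordering p s, orderedForm_two]
  refine congrArg₂ (· + ·) (Finset.sum_congr rfl fun l _ => congrArg (· * _) ?_)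
    (Finset.sum_congr rfl fun i _ => congrArg (· * _) ?_)
  · revert l
    simp [forall_fin_ten, misorderedCoeff, relator]
  · exact congrFun (quadraticNormalForm_comp p s (TensorAlg.coeff Γ).toLinearMap
      (fun j k => t ![j, k])) i

variable (A p s) in
/-- The coefficients of `relator l`. -/
def relationTensor (l : Fin 10) (J : Fin 2 → Fin 4) : A :=
  algebraMap ℂ A (relationMatrix p s l (J 0) (J 1))

theorem orderedForm_relationTensor (l : Fin 10) :
    orderedForm A p s 2 (relationTensor A p s l) = 0 := by
  rw [orderedForm_two]
  refine (quadraticNormalForm_comp p s (Algebra.linearMap ℂ A) (relationMatrix p s l)).trans ?_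
  rw [quadraticNormalForm_relationMatrix]
  funext i
  simp

/-- In `incl_two_eq` the normal form is zero and the mis-ordered coefficients form a unit vector, so
a single relation survives. -/
theorem incl_relationTensor (l : Fin 10) :
    TensorAlg.incl Γ 2 (relationTensor A p s l) = relator Γ p s l := by
  have h : misorderedCoeff (fun j k => relationTensor A p s l ![j, k]) = Pi.single l 1 := by
    have h' := misorderedCoeff_relationMatrix p s l
    funext i
    have h2 : misorderedCoeff (fun j k => relationTensor A p s l ![j, k]) i =
        algebraMap ℂ A (misorderedCoeff (relationMatrix p s l) i) := by
      revert i
      simp [forall_fin_ten, misorderedCoeff, relationTensor]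
    rw [h2, h']
    by_cases hi : i = l <;> simp [Pi.single_apply, hi]
  rw [incl_two_eq (p := p) (s := s), orderedForm_relationTensor, h,
    Finset.sum_eq_single l (fun b _ hb => by simp [hb]) (by simp)]
  simp

variable (Γ p s) in
/-- Braided derivatives on normal forms: the components of the antisymmetrizing coset sums. -/
structure IsBraidedDerivation (d : Fin 4 → (Fin 16 → A) →ₗ[ℂ] (Fin 16 → A)) : Prop where
  rightOp : ∀ k t x, d t (rightOp p s k x) = (if t = k then x else 0) -
    ∑ i, ∑ j, Γ.braidCoeff i k j t • Jordanian.rightOp p s j (d i x)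
  single_zero : ∀ k a, d k (Pi.single 0 a) = 0
  eq_zero : ∀ x, (∀ t, d t x = 0) → x 0 = 0 → x = 0

section
variable {d : Fin 4 → (Fin 16 → A) →ₗ[ℂ] (Fin 16 → A)} (H : IsBraidedDerivation Γ p s d)
include H

theorem IsBraidedDerivation.orderedForm_eq_zero (n : ℕ) (t : (Fin n → Fin 4) → A)
    (ht : Γ.antisymmetrizer n t = 0) : orderedForm A p s n t = 0 := by
  refine Γ.normalForm_eq_zero H.rightOp H.single_zero (fun y hy => H.eq_zero _ hy ?_) n t ht
  -- Coordinate `0` belongs to the monomial `1`, and no right multiple of a form has a component of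
  -- degree zero.
  rw [Finset.sum_apply]
  refine Finset.sum_eq_zero fun k _ => rightOp_apply_eq_zero p s _ k 0 fun j hj => ?_
  simp [monomialDegree] at hj

theorem IsBraidedDerivation.antisymmetrizer_two_eq_zero (t : (Fin 2 → Fin 4) → A)
    (ht : orderedForm A p s 2 t = 0) : Γ.antisymmetrizer 2 t = 0 :=
  Γ.antisymmetrizer_two_eq_zero H.rightOp H.single_zero
    (fun y hy => eq_zero_of_sum_rightOp p s y hy) t ht

/-- The relations have zero normal form by construction, and in degree two this forces membership in
`ker W_2`. -/
theorem IsBraidedDerivation.antisymmetrizer_relationTensor (l : Fin 10) :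
    Γ.antisymmetrizer 2 (relationTensor A p s l) = 0 :=
  H.antisymmetrizer_two_eq_zero _ (orderedForm_relationTensor l)

/-- The relations commute with `A` up to coefficients on the left. -/
theorem IsBraidedDerivation.relator_mul_coeff (l : Fin 10) (x : A) : ∃ c : Fin 10 → A,
    relator Γ p s l * TensorAlg.coeff Γ x = ∑ m, TensorAlg.coeff Γ (c m) * relator Γ p s m := by
  have h := H.antisymmetrizer_relationTensor l
  rw [antisymmetrizer_two_eq_zero_iff] at h
  -- In degree two `ker W_2` is the fixed space of `Λ`, which right multiplication by `x` preserves.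
  -- With zero normal form, only the combination of relations is left in `incl_two_eq`.
  have h2 : orderedForm A p s 2 (Γ.rightMul₂ (relationTensor A p s l) x) = 0 := by
    apply H.orderedForm_eq_zero
    rw [antisymmetrizer_two_eq_zero_iff, braid_rightMul, h]
  refine ⟨misorderedCoeff fun j k => Γ.rightMul₂ (relationTensor A p s l) x ![j, k], ?_⟩
  rw [← incl_relationTensor, TensorAlg.incl_two_mul_coeff, incl_two_eq (p := p) (s := s), h2]
  simp

theorem IsBraidedDerivation.proj_relator (l : Fin 10) :
    ExteriorAlg.proj Γ (relator Γ p s l) = 0 := by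
  rw [← incl_relationTensor]
  refine (RingQuot.mkAlgHom_rel ℂ
    (ExteriorRel.ker 2 le_rfl _ (H.antisymmetrizer_relationTensor l))).trans (map_zero _)

theorem IsBraidedDerivation.misordered_form :
    misordered (ExteriorAlg.form Γ) = reordered p s (ExteriorAlg.form Γ) := by
  funext l
  rw [← sub_eq_zero]
  exact (map_relator _ l).symm.trans (H.proj_relator l)

/-- Modulo the relations a tensor equals its normal form, and that of an element of `ker W_n` is
zero. This shows that no relations of higher degree are needed. -/
theorem IsBraidedDerivation.incl_mem_span (n : ℕ) (t : (Fin n → Fin 4) → A)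
    (ht : Γ.antisymmetrizer n t = 0) :
    TensorAlg.incl Γ n t ∈ TwoSidedIdeal.span (Set.range (relator Γ p s)) := by
  set K := TwoSidedIdeal.span (Set.range (relator Γ p s)) with hK
  let q : Γ.TensorAlg →ₐ[ℂ] K.ringCon.Quotient := { K.ringCon.mk' with commutes' := fun r => rfl }
  have hq : ∀ ω, q ω = 0 ↔ ω ∈ K := fun ω => by
    rw [TwoSidedIdeal.mem_iff, ← RingCon.eq]
    rfl
  rw [← hq, map_incl q (p := p) (s := s), H.orderedForm_eq_zero n t ht]
  · simp
  · intro l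
    rw [hq]
    exact TwoSidedIdeal.subset_span ⟨l, rfl⟩

theorem IsBraidedDerivation.proj_eq_zero_iff (ω : Γ.TensorAlg) :
    ExteriorAlg.proj Γ ω = 0 ↔ ω ∈ TwoSidedIdeal.span (Set.range (relator Γ p s)) := by
  set K := TwoSidedIdeal.span (Set.range (relator Γ p s)) with hK
  constructor
  · intro h
    let q : Γ.TensorAlg →ₐ[ℂ] K.ringCon.Quotient := { K.ringCon.mk' with commutes' := fun r => rfl }
    have hq : ∀ ω, q ω = 0 ↔ ω ∈ K := fun ω => by
      rw [TwoSidedIdeal.mem_iff, ← RingCon.eq]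
      rfl
    -- All the kernels lie in `K`, so the quotient map by `K` factors through the external algebra.
    have hr : ∀ ⦃x y⦄, Γ.ExteriorRel x y → q x = q y := by
      rintro _ _ ⟨n, hn, t, ht⟩
      rw [map_zero, hq]
      exact H.incl_mem_span n t ht
    rw [← hq, ← RingQuot.liftAlgHom_mkAlgHom_apply ℂ q hr]
    exact (congrArg _ h).trans (map_zero _)
  · intro h
    have hle : K ≤ TwoSidedIdeal.ker (ExteriorAlg.proj Γ) := by
      rw [hK, TwoSidedIdeal.span_le]
      rintro _ ⟨l, rfl⟩
      exact (TwoSidedIdeal.mem_ker _).2 (H.proj_relator l)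
    exact (TwoSidedIdeal.mem_ker _).1 (hle h)

end

end Reduction

end Jordanian

namespace Jordanian
open Woronowicz BicovariantBimodule

/-! ### Independence of the ordered monomials through a left representation. -/

section Representation

variable {A : Type} [Ring A] [HopfAlgebra ℂ A] {Γ : BicovariantBimodule A (Fin 4)} {p s : ℂ}

theorem leftOp_smul (k : Fin 4) (a : A) (x : Fin 16 → A) :
    leftOp p s k (a • x) = a • leftOp p s k x :=
  leftOp_comp p s (LinearMap.mulLeft ℂ a) k x

variable (Γ p s) in
/-- Left multiplication by `θ_i` on normal forms. -/
def leftFormOp (i : Fin 4) : Module.End ℂ (Fin 16 → A) :=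
  ∑ j, leftOp p s j ∘ₗ (starLeft (entry Γ.f i j)).compLeft (Fin 16)

variable (Γ p s) in
/-- The left regular representation of the tensor algebra on normal forms. -/
def regularRep : Γ.TensorAlg →ₐ[ℂ] Module.End ℂ (Fin 16 → A) :=
  TensorAlg.lift Γ (Algebra.lsmul ℂ ℂ (Fin 16 → A)) (leftFormOp Γ p s) <| by
    intro i a
    refine LinearMap.ext fun x => ?_
    -- A form twists the coefficients as it passes them. Multiplicativity of this twist is the
    -- defining bimodule relation of the tensor algebra.
    have h : ∀ j, (starLeft (entry Γ.f i j)).compLeft (Fin 16) (a • x) =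
        ∑ k, starLeft (entry Γ.f i k) a • (starLeft (entry Γ.f k j)).compLeft (Fin 16) x := by
      intro j
      funext e
      simp [starLeft_mul]
    simp only [leftFormOp, Module.End.mul_apply, LinearMap.sum_apply, LinearMap.comp_apply,
      Algebra.lsmul_coe, h, map_sum, leftOp_smul, Finset.smul_sum]
    exact Finset.sum_comm

theorem regularRep_coeff (a : A) (x : Fin 16 → A) :
    regularRep Γ p s (TensorAlg.coeff Γ a) x = a • x := by
  rw [regularRep, TensorAlg.lift_coeff]
  rfl

/-- Since `f_{ij} ⋆ 1 = δ_{ij}`, the twist disappears on vectors with scalar coordinates. -/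
theorem regularRep_form (i : Fin 4) (c : Fin 16 → ℂ) :
    regularRep Γ p s (TensorAlg.form Γ i) (Algebra.linearMap ℂ A ∘ c) =
      Algebra.linearMap ℂ A ∘ leftOp p s i c := by
  rw [regularRep, TensorAlg.lift_form, leftFormOp, LinearMap.sum_apply, Finset.sum_eq_single i]
  · rw [← leftOp_comp, LinearMap.comp_apply]
    congr 1
    funext e
    simp [Algebra.algebraMap_eq_smul_one, starLeft_one]
  · intro j _ hj
    rw [LinearMap.comp_apply]
    refine (congrArg _ ?_).trans (map_zero _)
    funext e
    simp [Algebra.algebraMap_eq_smul_one, starLeft_one, hj.symm]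
  · simp

theorem regularRep_relator_apply (l : Fin 10) (c : Fin 16 → ℂ) :
    regularRep Γ p s (relator Γ p s l) (Algebra.linearMap ℂ A ∘ c) = 0 := by
  have h : ∀ i j, (regularRep Γ p s (TensorAlg.form Γ i) * regularRep Γ p s (TensorAlg.form Γ j))
      (Algebra.linearMap ℂ A ∘ c) = leftOp p s i (leftOp p s j (Algebra.linearMap ℂ A ∘ c)) := by
    intro i j
    rw [Module.End.mul_apply, regularRep_form, regularRep_form, leftOp_comp, leftOp_comp]
  obtain ⟨h0, h1, h2, h3, h4, h5, h6, h7, h8, h9⟩ :=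
    leftOp_relations p s (Algebra.linearMap ℂ A ∘ c)
  rw [map_relator, LinearMap.sub_apply, sub_eq_zero]
  revert l
  rw [forall_fin_ten]
  simp only [misordered, reordered, Matrix.cons_val, LinearMap.add_apply, LinearMap.sub_apply,
    LinearMap.neg_apply, LinearMap.smul_apply, LinearMap.zero_apply, h]
  exact ⟨h0, h1, h2, h3, h4, h5, h6, h7, h8, h9⟩

theorem sum_smul_single (x : Fin 16 → A) :
    ∑ i, x i • (Algebra.linearMap ℂ A ∘ Pi.single i 1) = x := by
  funext j
  rw [Finset.sum_apply, Finset.sum_eq_single j]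
  · simp
  · intro i _ hi
    simp [Pi.single_apply, hi.symm]
  · simp

theorem IsBraidedDerivation.regularRep_relator {d : Fin 4 → (Fin 16 → A) →ₗ[ℂ] (Fin 16 → A)}
    (H : IsBraidedDerivation Γ p s d) (l : Fin 10) : regularRep Γ p s (relator Γ p s l) = 0 := by
  refine LinearMap.ext fun x => ?_
  -- A general vector is a left combination of scalar ones. By `relator_mul_coeff` each coefficient
  -- moves to the left of the relations, which then act on a scalar vector and give zero.
  rw [← sum_smul_single x, map_sum]
  refine Finset.sum_eq_zero fun i _ => ?_
  obtain ⟨c, hc⟩ := H.relator_mul_coeff l (x i)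
  rw [← regularRep_coeff (Γ := Γ) (p := p) (s := s), ← Module.End.mul_apply, ← map_mul, hc, map_sum,
    LinearMap.sum_apply]
  refine Finset.sum_eq_zero fun m _ => ?_
  rw [map_mul, Module.End.mul_apply, regularRep_relator_apply, map_zero]

theorem leftOp_single (p s : ℂ) :
    let e : Fin 16 → Fin 16 → ℂ := fun i => Pi.single i 1
    (leftOp p s 1 (e 0) = e 1 ∧ leftOp p s 0 (e 0) = e 2 ∧ leftOp p s 3 (e 0) = e 4 ∧
      leftOp p s 2 (e 0) = e 8) ∧
    (leftOp p s 0 (e 4) = e 6 ∧ leftOp p s 0 (e 8) = e 10 ∧ leftOp p s 3 (e 8) = e 12 ∧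
      leftOp p s 0 (e 12) = e 14) ∧
    leftOp p s 1 (e 2) = e 3 ∧ leftOp p s 1 (e 4) = e 5 ∧ leftOp p s 1 (e 6) = e 7 ∧
      leftOp p s 1 (e 8) = e 9 ∧ leftOp p s 1 (e 10) = e 11 ∧ leftOp p s 1 (e 12) = e 13 ∧
      leftOp p s 1 (e 14) = e 15 := by
  intro e
  refine ⟨⟨?_, ?_, ?_, ?_⟩, ⟨?_, ?_, ?_, ?_⟩, ?_, ?_, ?_, ?_, ?_, ?_, ?_⟩ <;>
  · simp only [e, leftOp, Matrix.cons_val, pi_sixteen, LinearMap.add_apply, LinearMap.sub_apply,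
      LinearMap.neg_apply, LinearMap.smul_apply, LinearMap.zero_apply, LinearMap.proj_apply]
    funext i
    revert i
    rw [forall_fin_sixteen]
    simp [Pi.single_apply]

/-- The factors are applied from right to left, each preceding those already present in the chosen
order, so no reordering occurs. -/
theorem regularRep_monomial (i : Fin 16) :
    regularRep Γ p s (monomial (TensorAlg.form Γ) i) (Algebra.linearMap ℂ A ∘ Pi.single 0 1) =
      Algebra.linearMap ℂ A ∘ Pi.single i 1 := by
  obtain ⟨⟨h1, h2, h4, h8⟩, ⟨h6, h10, h12, h14⟩, h3, h5, h7, h9, h11, h13, h15⟩ := leftOp_single p s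
  revert i
  rw [forall_fin_sixteen]
  simp only [monomial, Matrix.cons_val, map_mul, map_one, Module.End.mul_apply,
    Module.End.one_apply, regularRep_form, h1, h2, h4, h8, h6, h10, h12, h14, h3, h5, h7, h9, h11,
    h13, h15, and_self]

theorem map_monomial {B C : Type} [Ring B] [Algebra ℂ B] [Ring C] [Algebra ℂ C] (q : B →ₐ[ℂ] C)
    (θ : Fin 4 → B) (i : Fin 16) : q (monomial θ i) = monomial (fun i => q (θ i)) i := by
  revert i
  simp [forall_fin_sixteen, monomial]

theorem regularRep_sum (c : Fin 16 → A) :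
    regularRep Γ p s (∑ i, TensorAlg.coeff Γ (c i) * monomial (TensorAlg.form Γ) i)
      (Algebra.linearMap ℂ A ∘ Pi.single 0 1) = c := by
  simp only [map_sum, LinearMap.sum_apply, map_mul, Module.End.mul_apply, regularRep_monomial,
    regularRep_coeff, sum_smul_single]

/-- The ordered monomials are linearly independent over `A`. -/
theorem IsBraidedDerivation.monomial_injective {d : Fin 4 → (Fin 16 → A) →ₗ[ℂ] (Fin 16 → A)}
    (H : IsBraidedDerivation Γ p s d) (c c' : Fin 16 → A)
    (h : ∑ i, ExteriorAlg.coeff Γ (c i) * monomial (ExteriorAlg.form Γ) i =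
      ∑ i, ExteriorAlg.coeff Γ (c' i) * monomial (ExteriorAlg.form Γ) i) : c = c' := by
  have hproj : ∀ c : Fin 16 → A, ExteriorAlg.proj Γ (∑ i, TensorAlg.coeff Γ (c i) *
      monomial (TensorAlg.form Γ) i) =
      ∑ i, ExteriorAlg.coeff Γ (c i) * monomial (ExteriorAlg.form Γ) i := by
    intro c
    simp only [map_sum, map_mul, map_monomial]
    rfl
  -- The representation kills the ideal of the relations, which is the kernel of the projection to
  -- `Ω`. The two sums thus act alike, and their values on the monomial `1` are `c` and `c'`.
  have hle : TwoSidedIdeal.span (Set.range (relator Γ p s)) ≤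
      TwoSidedIdeal.ker (regularRep Γ p s) := by
    rw [TwoSidedIdeal.span_le]
    rintro _ ⟨l, rfl⟩
    exact (TwoSidedIdeal.mem_ker _).2 (H.regularRep_relator l)
  have h0 := (TwoSidedIdeal.mem_ker _).1 (hle ((H.proj_eq_zero_iff
    (∑ i, TensorAlg.coeff Γ (c i) * monomial (TensorAlg.form Γ) i -
      ∑ i, TensorAlg.coeff Γ (c' i) * monomial (TensorAlg.form Γ) i)).1
      (by rw [map_sub, hproj, hproj, h, sub_self])))
  rw [map_sub, sub_eq_zero] at h0
  rw [← regularRep_sum (Γ := Γ) (p := p) (s := s) c, h0, regularRep_sum]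

end Representation

/-! ### Spanning, over `A` and over `ℂ`, and the grading. -/

section Spanning

variable {A : Type} [Ring A] [HopfAlgebra ℂ A] {Γ : BicovariantBimodule A (Fin 4)} {p s : ℂ}

variable (Γ) in
/-- The left `A`-span of the ordered monomials in the external algebra. -/
def monomialSpan : AddSubgroup Γ.ExteriorAlg where
  carrier := {ω | ∃ c : Fin 16 → A,
    ω = ∑ i, ExteriorAlg.coeff Γ (c i) * monomial (ExteriorAlg.form Γ) i}
  zero_mem' := ⟨0, by simp⟩
  add_mem' := by
    rintro _ _ ⟨c, rfl⟩ ⟨c', rfl⟩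
    exact ⟨c + c', by simp [add_mul, Finset.sum_add_distrib]⟩
  neg_mem' := by
    rintro _ ⟨c, rfl⟩
    exact ⟨-c, by simp⟩

theorem coeff_mul_mem_monomialSpan (a : A) {ω : Γ.ExteriorAlg} (h : ω ∈ monomialSpan Γ) :
    ExteriorAlg.coeff Γ a * ω ∈ monomialSpan Γ := by
  obtain ⟨c, rfl⟩ := h
  exact ⟨a • c, by simp [Finset.mul_sum, mul_assoc]⟩

theorem form_mul_coeff' (i : Fin 4) (x : A) : ExteriorAlg.form Γ i * ExteriorAlg.coeff Γ x =
    ∑ j, ExteriorAlg.coeff Γ (starLeft (entry Γ.f i j) x) * ExteriorAlg.form Γ j := by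
  have h := congrArg (ExteriorAlg.proj Γ) (TensorAlg.form_mul_coeff Γ i x)
  simpa only [map_mul, map_sum] using! h

section
variable (hrel : misordered (ExteriorAlg.form Γ) = reordered p s (ExteriorAlg.form Γ))
include hrel

theorem mul_form_mem_monomialSpan (k : Fin 4) {ω : Γ.ExteriorAlg} (h : ω ∈ monomialSpan Γ) :
    ω * ExteriorAlg.form Γ k ∈ monomialSpan Γ := by
  obtain ⟨c, rfl⟩ := h
  refine ⟨rightOp p s k c, ?_⟩
  rw [sum_monomial_mul hrel]
  refine Finset.sum_congr rfl fun i _ => congrArg (· * _) ?_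
  exact congrFun (rightOp_comp p s (ExteriorAlg.coeff Γ).toLinearMap k c) i

theorem monomial_mul_coeff_mem (i : Fin 16) (x : A) :
    monomial (ExteriorAlg.form Γ) i * ExteriorAlg.coeff Γ x ∈ monomialSpan Γ := by
  have h1 : ∀ x, 1 * ExteriorAlg.coeff Γ x ∈ monomialSpan Γ := fun x =>
    ⟨Pi.single 0 x, by
      rw [Finset.sum_eq_single 0 (fun i _ hi => by simp [hi]) (by simp)]
      simp [monomial]⟩
  -- The quantifier over all `x` is essential: passing `x` through `θ_k` replaces it by the elements
  -- `f_{kj} ⋆ x`.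
  have hmul : ∀ (k : Fin 4) {b : Γ.ExteriorAlg},
      (∀ x, b * ExteriorAlg.coeff Γ x ∈ monomialSpan Γ) →
      ∀ x, b * ExteriorAlg.form Γ k * ExteriorAlg.coeff Γ x ∈ monomialSpan Γ := by
    intro k b hb x
    rw [mul_assoc, form_mul_coeff', Finset.mul_sum]
    refine sum_mem fun j _ => ?_
    rw [← mul_assoc]
    exact mul_form_mem_monomialSpan hrel j (hb _)
  have hform : ∀ k x, ExteriorAlg.form Γ k * ExteriorAlg.coeff Γ x ∈ monomialSpan Γ := by
    intro k x
    simpa only [one_mul] using hmul k h1 x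
  revert x
  revert i
  rw [forall_fin_sixteen]
  exact ⟨h1, hform 1, hform 0, hmul 0 (hform 1), hform 3, hmul 3 (hform 1), hmul 3 (hform 0),
    hmul 3 (hmul 0 (hform 1)), hform 2, hmul 2 (hform 1), hmul 2 (hform 0),
    hmul 2 (hmul 0 (hform 1)), hmul 2 (hform 3), hmul 2 (hmul 3 (hform 1)),
    hmul 2 (hmul 3 (hform 0)), hmul 2 (hmul 3 (hmul 0 (hform 1)))⟩

theorem mem_monomialSpan (ω : Γ.ExteriorAlg) : ω ∈ monomialSpan Γ := by
  obtain ⟨ω, rfl⟩ := RingQuot.mkAlgHom_surjective ℂ Γ.ExteriorRel ω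
  -- Stability of the span under right multiplication is closed under products, unlike plain
  -- membership; membership follows by taking `η = 1`.
  suffices h : ∀ η ∈ monomialSpan Γ, η * ExteriorAlg.proj Γ ω ∈ monomialSpan Γ by
    have h1 := h 1 ⟨Pi.single 0 1, by
      rw [Finset.sum_eq_single 0 (fun i _ hi => by simp [hi]) (by simp)]
      simp [monomial]⟩
    rwa [one_mul] at h1
  induction ω using TensorAlg.induction with
  | hcoeff x =>
    rintro _ ⟨c, rfl⟩
    rw [Finset.sum_mul]
    refine sum_mem fun i _ => ?_
    rw [mul_assoc]
    exact coeff_mul_mem_monomialSpan _ (monomial_mul_coeff_mem hrel i x)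
  | hform k => exact fun η hη => mul_form_mem_monomialSpan hrel k hη
  | hadd x y hx hy =>
    intro η hη
    rw [map_add, mul_add]
    exact add_mem (hx η hη) (hy η hη)
  | hmul x y hx hy =>
    intro η hη
    rw [map_mul, ← mul_assoc]
    exact hy _ (hx η hη)

theorem span_monomial_eq_adjoin : Submodule.span ℂ (Set.range (monomial (ExteriorAlg.form Γ))) =
    Subalgebra.toSubmodule (Algebra.adjoin ℂ (Set.range (ExteriorAlg.form Γ))) := by
  apply le_antisymm
  · rw [Submodule.span_le]
    rintro _ ⟨i, rfl⟩
    have h : ∀ k, ExteriorAlg.form Γ k ∈ Algebra.adjoin ℂ (Set.range (ExteriorAlg.form Γ)) :=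
      fun k => Algebra.subset_adjoin ⟨k, rfl⟩
    revert i
    rw [forall_fin_sixteen]
    have h1 := (Algebra.adjoin ℂ (Set.range (ExteriorAlg.form Γ))).one_mem
    have hm := fun {x y} => (Algebra.adjoin ℂ (Set.range (ExteriorAlg.form Γ))).mul_mem (x := x)
      (y := y)
    exact ⟨h1, h 1, h 0, hm (h 1) (h 0), h 3, hm (h 1) (h 3), hm (h 0) (h 3),
      hm (hm (h 1) (h 0)) (h 3), h 2, hm (h 1) (h 2), hm (h 0) (h 2), hm (hm (h 1) (h 0)) (h 2),
      hm (h 3) (h 2), hm (hm (h 1) (h 3)) (h 2), hm (hm (h 0) (h 3)) (h 2),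
      hm (hm (hm (h 1) (h 0)) (h 3)) (h 2)⟩
  · rw [Algebra.adjoin_eq_span, Submodule.span_le]
    intro x hx
    induction hx using Submonoid.closure_induction_right with
    | one => exact Submodule.subset_span ⟨0, rfl⟩
    | mul_right x _ y hy hx =>
      obtain ⟨k, rfl⟩ := hy
      rw [SetLike.mem_coe, Submodule.mem_span_range_iff_exists_fun] at hx ⊢
      obtain ⟨c, rfl⟩ := hx
      -- The operators have complex entries, so the same reordering works with coefficients in `ℂ`.
      refine ⟨rightOp p s k c, ?_⟩
      have h := sum_monomial_mul hrel (Algebra.linearMap ℂ _ ∘ c) k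
      rw [rightOp_comp] at h
      simpa [← Algebra.smul_def] using h.symm

end

theorem orderedForm_support (n : ℕ) (t : (Fin n → Fin 4) → A) (i : Fin 16)
    (hi : monomialDegree i ≠ n) : orderedForm A p s n t i = 0 := by
  induction n generalizing i with
  | zero =>
    have : i ≠ 0 := by
      rintro rfl
      exact hi rfl
    simp [normalForm, this]
  | succ n ih =>
    rw [orderedForm, normalForm_succ, Finset.sum_apply]
    exact Finset.sum_eq_zero fun k _ => rightOp_support p s _ k n (fun j hj => ih _ j hj) i hi

theorem sum_orderedMonomial {B : Type} [Ring B] [Algebra ℂ B] (θ : Fin 4 → B)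
    (c : (Fin 4 → Fin 2) → B) : ∑ ε, c ε * orderedMonomial θ ε =
      ∑ i, c (finFunctionFinEquiv.symm i) * monomial θ i := by
  rw [← (finFunctionFinEquiv (m := 2) (n := 4)).symm.sum_comp]
  exact Finset.sum_congr rfl fun i _ => by rw [orderedMonomial_symm]

end Spanning

/-! ### Identities for the bi-invariant form. -/

section Trace
variable {B : Type} [Ring B] [Algebra ℂ B]

/-- The weights are the coefficients of the mis-ordered products in the square; the ordered parts
then cancel for every `p`. -/
theorem traceForm_mul_self (h g p : ℂ) (θ : Fin 4 → B) : traceForm h g θ * traceForm h g θ =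
    ∑ l, (![(h + g) ^ 2, h + g, h + g, 0, 1, 1, 0, 1, 0, 0] : Fin 10 → ℂ) l •
      (misordered θ l - reordered p (h + g) θ l) := by
  rw [sum_fin_ten]
  simp only [traceForm, misordered, reordered, Matrix.cons_val, mul_add, add_mul, smul_mul_assoc,
    mul_smul_comm]
  module

/-- The weights are again the mis-ordered coefficients of the left side. Here the ordered parts
cancel because `p (z + 1) = z`. -/
theorem traceForm_mul_add (h g z : ℂ) (hz : z ≠ -1) (θ : Fin 4 → B) (i : Fin 4) :
    traceForm h g θ * θ i + θ i * traceForm h g θ + (2 * z) • thetaSq θ i =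
      ∑ l, (![![0, 0, h + g, 0, 0, 1, 0, 2 + 2 * z, 0, 0],
        ![0, 0, 0, h + g, 0, 0, 1, 0, 1 + 2 * z, 0],
        ![2 * (h + g), 1, 1 + 2 * z, 0, 0, 0, 0, 0, 0, 0],
        ![0, h + g, 0, 2 * z, 2 + 2 * z, 1, 0, 0, 0, 0]] : Fin 4 → Fin 10 → ℂ) i l •
        (misordered θ l - reordered (z / (z + 1)) (h + g) θ l) := by
  have hz' : z + 1 ≠ 0 := fun h0 => hz (by linear_combination h0)
  rw [sum_fin_ten]
  revert i
  rw [forall_fin_four]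
  refine ⟨?_, ?_, ?_, ?_⟩ <;>
  · simp only [traceForm, thetaSq, misordered, reordered, Matrix.cons_val, mul_add, add_mul,
      smul_mul_assoc, mul_smul_comm]
    match_scalars <;> field_simp <;> ring

end Trace

/-! ### All assertions from a system of braided derivatives. -/

section Main
variable {h g p : ℂ} {Γ : BicovariantBimodule (GLhg h g) (Fin 4)}
  {d : Fin 4 → (Fin 16 → GLhg h g) →ₗ[ℂ] (Fin 16 → GLhg h g)}

theorem IsBraidedDerivation.isWedgePresentation (H : IsBraidedDerivation Γ p (h + g) d) :
    IsWedgePresentation h g Γ (relator Γ p (h + g)) where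
  complete := H.proj_eq_zero_iff
  bimodule := H.relator_mul_coeff
  trace := ⟨_, traceForm_mul_self h g p _⟩
  basis ω := by
    obtain ⟨c, hc⟩ := mem_monomialSpan H.misordered_form ω
    refine ⟨fun ε => c (finFunctionFinEquiv ε), ?_, fun c' hc' => ?_⟩
    · simp only
      rw [sum_orderedMonomial _ fun ε => ExteriorAlg.coeff Γ (c (finFunctionFinEquiv ε)), hc]
      simp
    · replace hc' : ω = ∑ ε, ExteriorAlg.coeff Γ (c' ε) *
          orderedMonomial (ExteriorAlg.form Γ) ε := hc'
      rw [sum_orderedMonomial _ fun ε => ExteriorAlg.coeff Γ (c' ε)] at hc'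
      have := H.monomial_injective _ _ (hc.symm.trans hc')
      funext ε
      simp only [this, Equiv.symm_apply_apply]
  graded n t := by
    -- The coordinates are those of the normal form of `t`, which is homogeneous of degree `n`.
    refine ⟨fun ε => orderedForm _ p (h + g) n t (finFunctionFinEquiv ε), fun ε hε => ?_, ?_⟩
    · apply orderedForm_support
      rwa [← monomialDegree_eq, Equiv.symm_apply_apply]
    · rw [sum_orderedMonomial _ fun ε => ExteriorAlg.coeff Γ
        (orderedForm _ p (h + g) n t (finFunctionFinEquiv ε)),
        map_incl (ExteriorAlg.proj Γ) H.proj_relator]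
      simp only [Equiv.apply_symm_apply]
      rfl
  invariant := by
    rw [← span_monomial_eq_adjoin H.misordered_form,
      ← (finFunctionFinEquiv (m := 2) (n := 4)).symm.surjective.range_comp]
    congr 2
    funext i
    exact orderedMonomial_symm _ i

end Main

end Jordanian

namespace Jordanian
open Woronowicz BicovariantBimodule GLhg

/-! ### The braidings of the three families. -/

section Braidings
variable {h g : ℂ}

theorem lift_antipode {A B C D E : Matrix (Fin 4) (Fin 4) ℂ} (H : IsGLPoint h g A B C D E) :
    let S := HopfAlgebra.antipode ℂ (A := GLhg h g)
    lift H (S (gen h g .a)) = E * (D + g • C) ∧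
    lift H (S (gen h g .b)) = E * (g • D - g • A - B + (g ^ 2) • C) ∧
    lift H (S (gen h g .c)) = (-1 : ℂ) • (E * C) ∧
    lift H (S (gen h g .d)) = E * (A - g • C) := by
  simp [antipode_a, antipode_b, antipode_c, antipode_d]

set_option maxHeartbeats 8000000 in
-- The parameter `z` cancels between `f(S(T_{is}))` and `f(T_{tk})`, leaving the braiding of the
-- second family at `z = 0`. This is why `derivOp₂ 0` serves the third family.
theorem lift_vMat₃ (z : ℂ) (hz : z ≠ -1) (j k : Fin 4) :
    lift (isGLPoint₃ h g z hz) (vMat h g j k) = braid₂ 0 (h + g) j k := by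
  have hz' : z + 1 ≠ 0 := fun h0 => hz (by linear_combination h0)
  obtain ⟨ha, hb, hc, hd⟩ := lift_antipode (isGLPoint₃ h g z hz)
  revert j k
  simp only [forall_fin_four]
  refine ⟨⟨?_, ?_, ?_, ?_⟩, ⟨?_, ?_, ?_, ?_⟩, ⟨?_, ?_, ?_, ?_⟩, ⟨?_, ?_, ?_, ?_⟩⟩ <;>
  · simp only [vMat, braid₂, Matrix.cons_val, Matrix.of_apply, map_mul, ha, hb, hc, hd, lift_a,
      lift_b, lift_c, lift_d]
    simp only [A₃, B₃, C₃, D₃, E₃, U, mul4, add4, sub4, smul4, zero4, mul_zero, zero_mul, add_zero,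
      zero_add, sub_zero, zero_sub, mul_one, one_mul, neg_zero] <;>
    apply eq4 <;> first | ring1 | (field_simp; done) | (field_simp; ring1)

set_option maxHeartbeats 8000000 in
theorem lift_vMat₂ (z : ℂ) (j k : Fin 4) :
    lift (isGLPoint₂ h g z) (vMat h g j k) = braid₂ z (h + g) j k := by
  obtain ⟨ha, hb, hc, hd⟩ := lift_antipode (isGLPoint₂ h g z)
  revert j k
  simp only [forall_fin_four]
  refine ⟨⟨?_, ?_, ?_, ?_⟩, ⟨?_, ?_, ?_, ?_⟩, ⟨?_, ?_, ?_, ?_⟩, ⟨?_, ?_, ?_, ?_⟩⟩ <;>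
  · simp only [vMat, braid₂, Matrix.cons_val, Matrix.of_apply, map_mul, ha, hb, hc, hd, lift_a,
      lift_b, lift_c, lift_d]
    simp only [A₂, B₂, C₂, D₂, U, mul4, add4, sub4, smul4, zero4, mul_zero, zero_mul, add_zero,
      zero_add, sub_zero, zero_sub, mul_one, one_mul, neg_zero] <;>
    apply eq4 <;> ring1

set_option maxHeartbeats 8000000 in
-- Although `f` depends on `h`, `g` and `z`, its values on the `v_{jk}` depend only on `s = h + g`
-- and `p = z / (z + 1)`.
theorem lift_vMat₁ (z : ℂ) (hz : z ≠ -1) (j k : Fin 4) :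
    lift (isGLPoint₁ h g z hz) (vMat h g j k) = braid₁ (z / (z + 1)) (h + g) j k := by
  have hz' : z + 1 ≠ 0 := fun h0 => hz (by linear_combination h0)
  obtain ⟨ha, hb, hc, hd⟩ := lift_antipode (isGLPoint₁ h g z hz)
  revert j k
  simp only [forall_fin_four]
  refine ⟨⟨?_, ?_, ?_, ?_⟩, ⟨?_, ?_, ?_, ?_⟩, ⟨?_, ?_, ?_, ?_⟩, ⟨?_, ?_, ?_, ?_⟩⟩ <;>
  · simp only [vMat, braid₁, Matrix.cons_val, Matrix.of_apply, map_mul, ha, hb, hc, hd, lift_a,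
      lift_b, lift_c, lift_d]
    simp only [A₁, B₁, C₁, D₁, E₁, U, mul4, add4, sub4, smul4, zero4, mul_zero, zero_mul, add_zero,
      zero_add, sub_zero, zero_sub, mul_one, one_mul, neg_zero] <;>
    apply eq4 <;> first | ring1 | (field_simp; done) | (field_simp; ring1)

theorem isBraidedDerivation₁ (z : ℂ) (hz : z ≠ -1) :
    IsBraidedDerivation (Γ₁ h g z hz) (z / (z + 1)) (h + g) (derivOp₁ (z / (z + 1)) (h + g)) where
  rightOp k t x := by
    rw [derivOp₁_rightOp]
    -- The coefficient `Λ_{ik,jt}` is by definition the entry `(i, t)` of `f(v_{jk})`, so the rest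
    -- is definitional.
    simp only [← lift_vMat₁ z hz]
    rfl
  single_zero k a := derivOp₁_single_zero _ _ a k
  eq_zero := eq_zero_of_derivOp₁ _ _

theorem isBraidedDerivation₂ (z : ℂ) :
    IsBraidedDerivation (Γ₂ h g z) 0 (h + g) (derivOp₂ z (h + g)) where
  rightOp k t x := by
    rw [derivOp₂_rightOp]
    simp only [← lift_vMat₂ z]
    rfl
  single_zero k a := derivOp₂_single_zero _ _ a k
  eq_zero := eq_zero_of_derivOp₂ _ _

theorem isBraidedDerivation₃ (z : ℂ) (hz : z ≠ -1) :
    IsBraidedDerivation (Γ₃ h g z hz) 0 (h + g) (derivOp₂ 0 (h + g)) where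
  rightOp k t x := by
    rw [derivOp₂_rightOp]
    simp only [← lift_vMat₃ z hz]
    rfl
  single_zero k a := derivOp₂_single_zero _ _ a k
  eq_zero := eq_zero_of_derivOp₂ _ _

theorem relators₁_eq (z : ℂ) (hz : z ≠ -1) (Γ : BicovariantBimodule (GLhg h g) (Fin 4)) :
    relators₁ h g Γ z = relator Γ (z / (z + 1)) (h + g) := by
  funext l
  rw [relators₁, relator, reordered₁_eq h g z hz]

theorem relators₂₃_eq (Γ : BicovariantBimodule (GLhg h g) (Fin 4)) :
    relators₂₃ h g Γ = relator Γ 0 (h + g) := by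
  funext l
  rw [relators₂₃, relator, reordered₂₃_eq]

end Braidings

end Jordanian

end

/-! ### The theorem for the three families. -/

open Jordanian Woronowicz.BicovariantBimodule in
theorem mainTheorem3 (h g : ℂ) :
    (∀ (z : ℂ) (hz : z ≠ -1),
      misordered (ExteriorAlg.form (Γ₁ h g z hz)) =
        reordered₁ h g z (ExteriorAlg.form (Γ₁ h g z hz)) ∧
      IsWedgePresentation h g (Γ₁ h g z hz) (relators₁ h g (Γ₁ h g z hz) z) ∧
      (∀ i, ∃ c : Fin 10 → ℂ,
        traceForm h g (TensorAlg.form (Γ₁ h g z hz)) * TensorAlg.form (Γ₁ h g z hz) i +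
            TensorAlg.form (Γ₁ h g z hz) i * traceForm h g (TensorAlg.form (Γ₁ h g z hz)) +
            (2 * z) • thetaSq (TensorAlg.form (Γ₁ h g z hz)) i =
          ∑ l, c l • relators₁ h g (Γ₁ h g z hz) z l)) ∧
    (∀ z : ℂ,
      misordered (ExteriorAlg.form (Γ₂ h g z)) =
        reordered₂₃ h g (ExteriorAlg.form (Γ₂ h g z)) ∧
      IsWedgePresentation h g (Γ₂ h g z) (relators₂₃ h g (Γ₂ h g z))) ∧
    (∀ (z : ℂ) (hz : z ≠ -1),
      misordered (ExteriorAlg.form (Γ₃ h g z hz)) =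
        reordered₂₃ h g (ExteriorAlg.form (Γ₃ h g z hz)) ∧
      IsWedgePresentation h g (Γ₃ h g z hz) (relators₂₃ h g (Γ₃ h g z hz))) := by
  refine ⟨fun z hz => ?_, fun z => ?_, fun z hz => ?_⟩
  · rw [relators₁_eq z hz, reordered₁_eq h g z hz]
    exact ⟨(isBraidedDerivation₁ z hz).misordered_form,
      (isBraidedDerivation₁ z hz).isWedgePresentation,
      fun i => ⟨_, traceForm_mul_add h g z hz _ i⟩⟩
  · rw [relators₂₃_eq, reordered₂₃_eq]
    exact ⟨(isBraidedDerivation₂ z).misordered_form, (isBraidedDerivation₂ z).isWedgePresentation⟩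
  · rw [relators₂₃_eq, reordered₂₃_eq]
    exact ⟨(isBraidedDerivation₃ z hz).misordered_form,
      (isBraidedDerivation₃ z hz).isWedgePresentation⟩
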